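/- For a permutation $\pi$ of $[n]=\{1,\dots,n\}$ (with $\pi(v)$ the position of item $v$) let $\hat\pi=(\pi(v)-\frac{n+1}2)_{v\in[n]}$; the vectors $\hat\pi$ are the vertices of the symmetrized permutahedron, the vectors $(\pi(v))_{v}$ those of the standard one. Fix vectors $s_1,\dots,s_T\in\mathbb R^n$, hidden from the player. In each step $t=1,\dots,T$ the player draws a permutation $\pi_t$ and suffers and observes only the loss $\ell_t=\hat\pi_t's_t$ (in the standard game: $\ell_t=\pi_t's_t$). The expected regret is $\mathbb E\big[\sum_{t}\ell_t\big]-\min_{\pi}\sum_{t}\hat\pi's_t$ (in the standard game with $\pi's_t$). The Plackett–Luce distribution $\mathrm{PL}(w)$, $w\in\mathbb R^n$, draws the item in the first position with probability proportional to $e^{w(u)}$, removes it, and continues in the same way with the remaining items. Algorithm BanditRank with parameters $\gamma\in(0,1]$ and $\eta>0$ starts with $w_0=0$. In step $t$ it draws $\pi_t$ from the mixture $D_t$ of the uniform distribution (with probability $\gamma$) and $\mathrm{PL}(w_{t-1})$ (with probability $1-\gamma$), observes $\ell_t=\hat\pi_t's_t$, and sets $w_t=w_{t-1}+\eta\,\ell_tP_t^{+}\hat\pi_t$,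 where $P_t=\mathbb E_{\sigma\sim D_t}[\hat\sigma\hat\sigma']$ and $P_t^+$ is its Moore–Penrose pseudo-inverse. **Theorem.** (1) There is a universal constant $c>0$ such that for all $a,b,d>0$ there is a constant $C$ (depending only on $a,b,d$) with the following property. For all $n,T\ge1$ and all $\gamma\in(0,1]$, $\eta>0$ with $$a\min\Big(1,\frac{n^{3/2}}{\sqrt T}\Big)\le\gamma\le b\,\frac{n^{3/2}}{\sqrt T},\qquad d\,\frac{\gamma}{n}\le\eta\le c\,\frac{\gamma}{n},$$ and all $s_1,\dots,s_T$ with $|\hat\pi's_t|\le1$ for all $t$ and all $\pi$, the expected regret of BanditRank in the symmetrized game is at most $C\,n^{3/2}\sqrt T$. (2) BanditRank can be implemented, by one program for all $n,\gamma,\eta$, with running time $O(n^3)$ per step in the worst case over the random draws. Running time is counted on a random access machine with exact real arithmetic, where the four arithmetic operations, the exponential function, comparisons, memory accesses and the flip of a coin with a given bias cost one step each. (3) There is a program on the same machine, with parameters $n,\gamma,\eta$, that plays the standard game with running time $O(n^3)$ per step and with the regret guarantee of (1) (possibly with other constants) for the standard game, whenever $|\pi's_t|\le1$ for all $t$ and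 all $\pi$. -/

import Mathlib

namespace PermBandit

noncomputable section

/-! ### Permutations as action vectors

A permutation `π : Equiv.Perm (Fin n)` assigns to every item `v` its position; the 1-based
position of `v` is `(π v : ℝ) + 1`. -/

/-- The vertex `(π(1), …, π(n))` of the standard permutahedron. -/
def stdVec {n : ℕ} (π : Equiv.Perm (Fin n)) : Fin n → ℝ :=
  fun v => ((π v : ℕ) : ℝ) + 1

/-- The vertex `π̂ = (π(1) - (n+1)/2, …, π(n) - (n+1)/2)` of the symmetrized permutahedron. -/
def symVec {n : ℕ} (π : Equiv.Perm (Fin n)) : Fin n → ℝ :=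
  fun v => ((π v : ℕ) : ℝ) + 1 - ((n : ℝ) + 1) / 2

/-! ### Distributions -/

/-- A coin that shows `true` with probability `p`, where `p` is first clamped to `[0, 1]`. -/
def coin (p : ℝ) : PMF Bool :=
  PMF.ofFintype
    (fun b => ENNReal.ofReal (if b then max 0 (min p 1) else 1 - max 0 (min p 1))) (by
      rw [Fintype.sum_bool, if_pos rfl, if_neg (by simp), ← ENNReal.ofReal_add (by simp) (by simp)]
      simp)

/-- Draw an item with probability proportional to `exp (w u)`. -/
def softmax {n : ℕ} (w : Fin (n + 1) → ℝ) : PMF (Fin (n + 1)) :=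
  PMF.ofFintype (fun u => ENNReal.ofReal (Real.exp (w u) / ∑ v, Real.exp (w v))) (by
    have h : (0 : ℝ) < ∑ v, Real.exp (w v) :=
      Finset.sum_pos (fun v _ => Real.exp_pos _) Finset.univ_nonempty
    rw [← ENNReal.ofReal_sum_of_nonneg (fun v _ => by positivity), ← Finset.sum_div,
      div_self h.ne', ENNReal.ofReal_one])

/-- The ranking that places `u` first and ranks the remaining items (item `u.succAbove v` is the
`v`-th remaining one) as `σ` does. -/
def consPerm {n : ℕ} (u : Fin (n + 1)) (σ : Equiv.Perm (Fin n)) : Equiv.Perm (Fin (n + 1)) :=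
  ((finSuccEquiv' u).trans (Equiv.optionCongr σ)).trans (finSuccEquiv' 0).symm

/-- The Plackett–Luce distribution `PL(w)`: the item in the first position is drawn with
probability proportional to `exp (w u)`, it is removed, and the procedure continues with the
remaining items. -/
def plackettLuce : (n : ℕ) → (Fin n → ℝ) → PMF (Equiv.Perm (Fin n))
  | 0, _ => PMF.pure 1
  | n + 1, w =>
    (softmax w).bind fun u =>
      (plackettLuce n fun v => w (u.succAbove v)).map fun σ => consPerm u σ

/-- The mixture of the uniform distribution (with probability `γ`) and of `PL(w)` (with
probability `1 - γ`). -/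
def mixture {n : ℕ} (γ : ℝ) (w : Fin n → ℝ) : PMF (Equiv.Perm (Fin n)) :=
  (coin γ).bind fun b =>
    if b then PMF.uniformOfFintype (Equiv.Perm (Fin n)) else plackettLuce n w

/-- The matrix `E[σ̂ σ̂']` for `σ` drawn from `D`. -/
def secondMoment {n : ℕ} (D : PMF (Equiv.Perm (Fin n))) : Matrix (Fin n) (Fin n) ℝ :=
  ∑ σ, (D σ).toReal • Matrix.vecMulVec (symVec σ) (symVec σ)

/-! ### The Moore–Penrose pseudo-inverse of a real square matrix -/

/-- The four Penrose equations. -/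
structure IsPseudoInverse {n : ℕ} (A X : Matrix (Fin n) (Fin n) ℝ) : Prop where
  mul_mul_left : A * X * A = A
  mul_mul_right : X * A * X = X
  symm_left : (A * X).transpose = A * X
  symm_right : (X * A).transpose = X * A

theorem IsPseudoInverse.unique {n : ℕ} {A X Y : Matrix (Fin n) (Fin n) ℝ}
    (hX : IsPseudoInverse A X) (hY : IsPseudoInverse A Y) : X = Y := by
  have h1 : A * X = A * Y := by
    calc A * X = (A * Y * A) * X := by rw [hY.mul_mul_left]
      _ = (A * Y).transpose * (A * X).transpose := by
          rw [hY.symm_left, hX.symm_left]; simp only [Matrix.mul_assoc]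
      _ = (A * X * A * Y).transpose := by
          rw [← Matrix.transpose_mul]; simp only [Matrix.mul_assoc]
      _ = A * Y := by rw [hX.mul_mul_left, hY.symm_left]
  have h2 : X * A = Y * A := by
    calc X * A = X * (A * Y * A) := by rw [hY.mul_mul_left]
      _ = (X * A).transpose * (Y * A).transpose := by
          rw [hY.symm_right, hX.symm_right]; simp only [Matrix.mul_assoc]
      _ = (Y * (A * X * A)).transpose := by
          rw [← Matrix.transpose_mul]; simp only [Matrix.mul_assoc]
      _ = Y * A := by rw [hX.mul_mul_left, hY.symm_right]
  calc X = X * A * X := hX.mul_mul_right.symm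
    _ = Y * A * Y := by rw [h2, Matrix.mul_assoc, h1, Matrix.mul_assoc]
    _ = Y := hY.mul_mul_right

theorem exists_isPseudoInverse {n : ℕ} {A : Matrix (Fin n) (Fin n) ℝ} (hA : A.IsHermitian) :
    ∃ X, IsPseudoInverse A X := by
  obtain ⟨U, d, hUU, hAU⟩ : ∃ (U : Matrix (Fin n) (Fin n) ℝ) (d : Fin n → ℝ),
      U.transpose * U = 1 ∧ A = U * Matrix.diagonal d * U.transpose := by
    refine ⟨hA.eigenvectorUnitary, hA.eigenvalues, ?_, ?_⟩
    · have := Unitary.coe_star_mul_self hA.eigenvectorUnitary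
      simpa [Matrix.star_eq_conjTranspose] using this
    · have := hA.spectral_theorem
      simpa [Unitary.conjStarAlgAut_apply, Matrix.star_eq_conjTranspose] using this
  have key : ∀ e f : Fin n → ℝ, (U * Matrix.diagonal e * U.transpose) *
      (U * Matrix.diagonal f * U.transpose) =
        U * Matrix.diagonal (fun i => e i * f i) * U.transpose := by
    intro e f
    calc _ = U * Matrix.diagonal e * (U.transpose * U) * Matrix.diagonal f * U.transpose := by
          simp only [Matrix.mul_assoc]
      _ = _ := by rw [hUU, Matrix.mul_one, Matrix.mul_assoc U, Matrix.diagonal_mul_diagonal]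
  have tr : ∀ e : Fin n → ℝ, (U * Matrix.diagonal e * U.transpose).transpose =
      U * Matrix.diagonal e * U.transpose := by
    intro e
    simp [Matrix.transpose_mul, Matrix.mul_assoc]
  refine ⟨U * Matrix.diagonal (fun i => (d i)⁻¹) * U.transpose, ?_, ?_, ?_, ?_⟩ <;>
    simp only [hAU, key, tr] <;> congr 3 <;> ext i <;> by_cases h : d i = 0 <;> simp [h]

open Classical in
/-- The pseudo-inverse: the unique solution of the Penrose equations. It exists for every
symmetric matrix. -/
def pinv {n : ℕ} (A : Matrix (Fin n) (Fin n) ℝ) : Matrix (Fin n) (Fin n) ℝ :=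
  if h : ∃ X, IsPseudoInverse A X then h.choose else 0

/-! ### The bandit game -/

/-- A randomized player with bandit feedback over the permutations of `n` items. In each round the
player draws a permutation with `act`, and after the round it updates its memory with `learn`,
which sees the permutation that was played and the number that was suffered as loss. -/
structure Player (n : ℕ) where
  Mem : Type
  start : Mem
  act : Mem → PMF (Equiv.Perm (Fin n) × Mem)
  learn : Mem → Equiv.Perm (Fin n) → ℝ → PMF Mem

/-- The joint law of the memory after `T` rounds and of the permutations played in these rounds, if
`π` is represented by the action vector `x π` and the hidden weight vectors are `s 0, s 1, …`. -/
def Player.run {n : ℕ} (A : Player n) (x : Equiv.Perm (Fin n) → Fin n → ℝ) (s : ℕ → Fin n → ℝ) :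
    (T : ℕ) → PMF (A.Mem × (Fin T → Equiv.Perm (Fin n)))
  | 0 => PMF.pure (A.start, Fin.elim0)
  | T + 1 =>
    (A.run x s T).bind fun mh =>
      (A.act mh.1).bind fun πm =>
        (A.learn πm.2 πm.1 (x πm.1 ⬝ᵥ s T)).map fun m =>
          (m, Fin.snoc (α := fun _ => Equiv.Perm (Fin n)) mh.2 πm.1)

/-- The law of the permutations played in the first `T` rounds. -/
def Player.plays {n : ℕ} (A : Player n) (x : Equiv.Perm (Fin n) → Fin n → ℝ)
    (s : ℕ → Fin n → ℝ) (T : ℕ) : PMF (Fin T → Equiv.Perm (Fin n)) :=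
  (A.run x s T).map Prod.snd

/-- The expected total loss of `T` rounds. -/
def Player.expectedLoss {n : ℕ} (A : Player n) (x : Equiv.Perm (Fin n) → Fin n → ℝ)
    (s : ℕ → Fin n → ℝ) (T : ℕ) : ℝ :=
  ∑ h : Fin T → Equiv.Perm (Fin n), (A.plays x s T h).toReal * ∑ t : Fin T, x (h t) ⬝ᵥ s t

/-- The total loss of the best fixed permutation. -/
def bestLoss {n : ℕ} (x : Equiv.Perm (Fin n) → Fin n → ℝ) (s : ℕ → Fin n → ℝ) (T : ℕ) : ℝ :=
  Finset.univ.inf' Finset.univ_nonempty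
    fun π : Equiv.Perm (Fin n) => ∑ t ∈ Finset.range T, x π ⬝ᵥ s t

/-- The expected regret after `T` rounds. -/
def Player.expectedRegret {n : ℕ} (A : Player n) (x : Equiv.Perm (Fin n) → Fin n → ℝ)
    (s : ℕ → Fin n → ℝ) (T : ℕ) : ℝ :=
  A.expectedLoss x s T - bestLoss x s T

/-- For a family of players with parameters `γ` and `η`: if `γ` is of the order of
`n^(3/2) / √T` (truncated at `1`) and `η` is of the order of `γ / n`, with a sufficiently small
constant `c` on the upper side of `η`, then the expected regret is `O(n^(3/2) √T)` for all weight
vectors for which the losses are bounded by `1`. -/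
def RegretBound (A : (n : ℕ) → (γ η : ℝ) → Player n)
    (x : (n : ℕ) → Equiv.Perm (Fin n) → Fin n → ℝ) : Prop :=
  ∃ c : ℝ, 0 < c ∧ ∀ a b d : ℝ, 0 < a → 0 < b → 0 < d → ∃ C : ℝ, 0 < C ∧
    ∀ (n T : ℕ), 1 ≤ n → 1 ≤ T → ∀ γ η : ℝ,
      a * min 1 ((n : ℝ) ^ (3 / 2 : ℝ) / √(T : ℝ)) ≤ γ → γ ≤ 1 →
      γ ≤ b * ((n : ℝ) ^ (3 / 2 : ℝ) / √(T : ℝ)) →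
      d * (γ / n) ≤ η → η ≤ c * (γ / n) →
      ∀ s : ℕ → Fin n → ℝ, (∀ t < T, ∀ π : Equiv.Perm (Fin n), |x n π ⬝ᵥ s t| ≤ 1) →
        (A n γ η).expectedRegret (x n) s T ≤ C * ((n : ℝ) ^ (3 / 2 : ℝ) * √(T : ℝ))

/-! ### Algorithm BanditRank -/

/-- Algorithm `BanditRank`. Its memory is the weight vector `w`. It plays `π` from the mixture `D`
of the uniform distribution and `PL(w)`, observes the loss `ℓ`, and adds `η ℓ P⁺ π̂` to `w`, where
`P = E[σ̂ σ̂']` for `σ` drawn from `D`. -/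
def banditRank (n : ℕ) (γ η : ℝ) : Player n where
  Mem := Fin n → ℝ
  start := 0
  act w := (mixture γ w).map fun π => (π, w)
  learn w π ℓ :=
    PMF.pure (w + η • (ℓ • (pinv (secondMoment (mixture γ w))).mulVec (symVec π)))

/-! ### A real random access machine

The machine has natural number registers, and real memory cells that are addressed indirectly, as
two-dimensional arrays. Real arithmetic is exact; the unit cost operations are the four arithmetic
operations, the exponential function, comparisons, the embedding of natural numbers, reading and
writing a cell, and a biased coin flip. The only control structures are branching and counting
loops. -/

structure Store where
  reg : ℕ → ℕ
  mem : ℕ → ℕ → ℕ → ℝ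
  /-- The number of steps so far; programs cannot read it. -/
  clock : ℕ

def Store.setReg (σ : Store) (r k : ℕ) : Store :=
  { σ with reg := Function.update σ.reg r k }

def Store.setMem (σ : Store) (A i j : ℕ) (y : ℝ) : Store :=
  { σ with mem := fun A' i' j' => if A' = A ∧ i' = i ∧ j' = j then y else σ.mem A' i' j' }

def Store.tick (σ : Store) (k : ℕ) : Store :=
  { σ with clock := σ.clock + k }

/-- Natural number expressions. -/
inductive NExp
  | const (k : ℕ)
  | reg (r : ℕ)
  | add (e f : NExp)
  | sub (e f : NExp)

def NExp.eval (σ : Store) : NExp → ℕ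
  | const k => k
  | reg r => σ.reg r
  | add e f => e.eval σ + f.eval σ
  | sub e f => e.eval σ - f.eval σ

/-- The number of operations in an expression. -/
def NExp.cost : NExp → ℕ
  | const _ => 1
  | reg _ => 1
  | add e f => e.cost + f.cost + 1
  | sub e f => e.cost + f.cost + 1

/-- Real expressions; `mem A i j` is the entry `(i, j)` of the array with name `A`. -/
inductive RExp
  | ofNat (e : NExp)
  | mem (A : ℕ) (i j : NExp)
  | add (e f : RExp)
  | sub (e f : RExp)
  | mul (e f : RExp)
  | div (e f : RExp)
  | exp (e : RExp)

def RExp.eval (σ : Store) : RExp → ℝ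
  | ofNat e => (e.eval σ : ℝ)
  | mem A i j => σ.mem A (i.eval σ) (j.eval σ)
  | add e f => e.eval σ + f.eval σ
  | sub e f => e.eval σ - f.eval σ
  | mul e f => e.eval σ * f.eval σ
  | div e f => e.eval σ / f.eval σ
  | exp e => Real.exp (e.eval σ)

/-- The number of operations in an expression. -/
def RExp.cost : RExp → ℕ
  | ofNat e => e.cost + 1
  | mem _ i j => i.cost + j.cost + 1
  | add e f => e.cost + f.cost + 1
  | sub e f => e.cost + f.cost + 1
  | mul e f => e.cost + f.cost + 1
  | div e f => e.cost + f.cost + 1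
  | exp e => e.cost + 1

inductive Cmd
  | skip
  /-- Set register `r`. -/
  | setReg (r : ℕ) (e : NExp)
  /-- Set the entry `(i, j)` of the array `A`. -/
  | setMem (A : ℕ) (i j : NExp) (e : RExp)
  /-- Set register `r` to `1` with probability `p`, and to `0` otherwise. -/
  | flip (r : ℕ) (p : RExp)
  | seq (c₁ c₂ : Cmd)
  /-- Run `c₁` if `e ≤ f`, and `c₂` otherwise (natural numbers). -/
  | ifNat (e f : NExp) (c₁ c₂ : Cmd)
  /-- Run `c₁` if `e ≤ f`, and `c₂` otherwise (real numbers). -/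
  | ifReal (e f : RExp) (c₁ c₂ : Cmd)
  /-- Run `c` for `r = 0, 1, …, k - 1`, where `k` is the value of `e` before the loop. -/
  | loop (r : ℕ) (e : NExp) (c : Cmd)

/-- `k` passes through a loop with counter `r`; every pass takes one step besides those of the
body. -/
def iterate (r : ℕ) (body : Store → PMF Store) : ℕ → Store → PMF Store
  | 0, σ => PMF.pure σ
  | k + 1, σ => (iterate r body k σ).bind fun τ => body ((τ.setReg r k).tick 1)

open Classical in
/-- The random final store of a command. -/
def Cmd.exec : Cmd → Store → PMF Store
  | skip, σ => PMF.pure (σ.tick 1)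
  | setReg r e, σ => PMF.pure ((σ.setReg r (e.eval σ)).tick (e.cost + 1))
  | setMem A i j e, σ =>
    PMF.pure ((σ.setMem A (i.eval σ) (j.eval σ) (e.eval σ)).tick (i.cost + j.cost + e.cost + 1))
  | flip r p, σ =>
    (coin (p.eval σ)).map fun b => (σ.setReg r (if b then 1 else 0)).tick (p.cost + 1)
  | seq c₁ c₂, σ => (c₁.exec σ).bind c₂.exec
  | ifNat e f c₁ c₂, σ =>
    if e.eval σ ≤ f.eval σ then c₁.exec (σ.tick (e.cost + f.cost + 1))
    else c₂.exec (σ.tick (e.cost + f.cost + 1))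
  | ifReal e f c₁ c₂, σ =>
    if e.eval σ ≤ f.eval σ then c₁.exec (σ.tick (e.cost + f.cost + 1))
    else c₂.exec (σ.tick (e.cost + f.cost + 1))
  | loop r e c, σ => iterate r c.exec (e.eval σ) (σ.tick (e.cost + 1))

/-- A program for the bandit game, the same for all `n`: the part of an iteration before the loss
is observed, and the part after it. -/
structure Program where
  draw : Cmd
  update : Cmd

open Classical in
/-- The permutation that is written to the array `1`, as its 1-based positions; the identity, if
the array does not contain a permutation. -/
def Store.output (n : ℕ) (σ : Store) : Equiv.Perm (Fin n) :=
  if h : ∃ π : Equiv.Perm (Fin n), ∀ v : Fin n, σ.mem 1 v 0 = ((π v : ℕ) : ℝ) + 1 then h.choose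
  else 1

/-- The player that runs a program. At the start the register `0` contains `n`, the cells `(0, 0)`
and `(0, 1)` of the array `0` contain `γ` and `η`, and everything else is zero. The observed loss is
written to the cell `(0, 2)` of the array `0`. The clock is reset at the beginning of each iteration,
so that at its end it shows the running time of the iteration. -/
def Program.player (M : Program) (n : ℕ) (γ η : ℝ) : Player n where
  Mem := Store
  start :=
    (Store.setMem (Store.setMem ⟨Function.update 0 0 n, fun _ _ _ => 0, 0⟩ 0 0 0 γ) 0 0 1 η)
  act σ := (M.draw.exec { σ with clock := 0 }).map fun τ => (τ.output n, τ)
  learn σ _ ℓ := M.update.exec (σ.setMem 0 0 2 ℓ)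

/-- Every iteration of the program takes `O(n³)` steps, whatever the random choices are. -/
def Program.CubicTime (M : Program) (x : (n : ℕ) → Equiv.Perm (Fin n) → Fin n → ℝ) : Prop :=
  ∃ K : ℕ, ∀ n : ℕ, 1 ≤ n → ∀ γ η : ℝ, 0 < γ → γ ≤ 1 → 0 < η →
    ∀ (s : ℕ → Fin n → ℝ) (t : ℕ), ∀ mh ∈ ((M.player n γ η).run (x n) s (t + 1)).support,
      Store.clock mh.1 ≤ K * n ^ 3

/-- The program is an implementation of `BanditRank`: it plays the same random permutations. -/
def Program.ImplementsBanditRank (M : Program) : Prop :=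
  ∀ n : ℕ, 1 ≤ n → ∀ γ η : ℝ, 0 < γ → γ ≤ 1 → 0 < η → ∀ (s : ℕ → Fin n → ℝ) (T : ℕ),
    (M.player n γ η).plays symVec s T = (banditRank n γ η).plays symVec s T

end

end PermBandit

namespace PermBandit

noncomputable section

open scoped Matrix

/-! Under `PL(w)` with odds `x v = exp (w v)`, item `u` precedes `v` with probability `x u / (x u +
x v)`. So the mean of `σ̂` is an explicit sum over pairs (`expect_plackettLuce`). Conditioning on
the first item and induction also give the variance of `σ̂'s` in closed form, as a sum over pairs
and triples (`expect_plackettLuce_sq`). All terms are nonnegative. The covariance is therefore the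
Laplacian of a weighted graph whose `n²` weights are sums of `n` terms, and it dominates the sum of
the variances of the single comparisons (`sum_pairVar_le`).

For the regret, let Φ be the sum over unordered pairs, up to diagonal terms, of `log (exp (w u) +
exp (w v)) - (w u + w v) / 2`. Its negative gradient is the Plackett–Luce mean, and its Hessian form
is the sum of the comparison variances, hence at most the covariance form. An update by `δ` with
spread at most 1 thus changes Φ by the linear term plus at most twice that form
(`potential_add_le`). The linear term matches the expected loss because the estimate is unbiased on
zero-sum vectors (`expect_loss_mul_estimate`). The quadratic term costs `O(η² n)` because the
estimate has expected Gram form at most `n`, by a trace computation (`expect_estimate_form`). Since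
`Φ(w) + ρ̂'w ≥ 0` for every ranking `ρ` and `Φ(0) ≤ n²/2`, telescoping bounds the regret by `n²/(2η)
+ T(γ + 4ηn)`, which is `O(n^(3/2) √T)` for the prescribed parameters.

In the standard game each loss has an unknown additive constant. Replacing `σ̂` by `σ̂ - E[σ̂]` in
the estimator removes its influence, so the two cases are treated together with `θ = 0` and `θ = 1`.
Adding the all-ones matrix to the second moment makes it positive definite without changing it on
zero-sum vectors, so the pseudo-inverse becomes an ordinary inverse.

The program draws each item by one pass of reservoir sampling, fills the matrix from the closed
formula, and inverts it by `n` bordering steps, which need no pivoting. All loops have `n` passes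
and nesting depth at most 3. A coupling between program and player shows that both play with the
same law. -/

/-! ### Expectations over finite types -/

/-- The expectation of a real function on a finite probability space. -/
def expect {α : Type*} [Fintype α] (p : PMF α) (f : α → ℝ) : ℝ :=
  ∑ a, (p a).toReal * f a

section Expect

variable {α β : Type*} [Fintype α] [Fintype β]

theorem expect_bind (p : PMF α) (q : α → PMF β) (f : β → ℝ) :
    expect (p.bind q) f = expect p fun a => expect (q a) f := by
  unfold expect
  simp only [PMF.bind_apply, tsum_fintype, Finset.mul_sum]
  rw [Finset.sum_comm]
  refine Finset.sum_congr rfl fun b _ => ?_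
  rw [ENNReal.toReal_sum fun a _ => ENNReal.mul_ne_top (p.apply_ne_top a) ((q a).apply_ne_top b),
    Finset.sum_mul]
  refine Finset.sum_congr rfl fun a _ => ?_
  rw [ENNReal.toReal_mul, mul_assoc]

theorem expect_pure (a : α) (f : α → ℝ) : expect (PMF.pure a) f = f a := by
  classical
  unfold expect
  rw [Finset.sum_eq_single a]
  · simp
  · intro b _ hb
    simp [PMF.pure_apply, hb]
  · simp

theorem expect_map (p : PMF α) (g : α → β) (f : β → ℝ) :
    expect (p.map g) f = expect p fun a => f (g a) := by
  rw [PMF.map, expect_bind]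
  simp [expect_pure]

theorem sum_toReal (p : PMF α) : ∑ a, (p a).toReal = 1 := by
  rw [← ENNReal.toReal_sum fun a _ => p.apply_ne_top a, ← tsum_fintype (L := .unconditional α),
    p.tsum_coe, ENNReal.toReal_one]

theorem expect_const (p : PMF α) (k : ℝ) : expect p (fun _ => k) = k := by
  rw [expect, ← Finset.sum_mul, sum_toReal, one_mul]

theorem expect_add (p : PMF α) (f g : α → ℝ) :
    expect p (fun a => f a + g a) = expect p f + expect p g := by
  simp [expect, mul_add, Finset.sum_add_distrib]

theorem expect_sub (p : PMF α) (f g : α → ℝ) :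
    expect p (fun a => f a - g a) = expect p f - expect p g := by
  simp [expect, mul_sub, Finset.sum_sub_distrib]

theorem expect_const_mul (p : PMF α) (k : ℝ) (f : α → ℝ) :
    expect p (fun a => k * f a) = k * expect p f := by
  rw [expect, expect, Finset.mul_sum]
  exact Finset.sum_congr rfl fun a _ => by ring

theorem expect_sum {ι : Type*} (s : Finset ι) (p : PMF α) (f : ι → α → ℝ) :
    expect p (fun a => ∑ i ∈ s, f i a) = ∑ i ∈ s, expect p (f i) := by
  simp only [expect, Finset.mul_sum]
  exact Finset.sum_comm

theorem expect_mono (p : PMF α) {f g : α → ℝ} (h : ∀ a, f a ≤ g a) : expect p f ≤ expect p g :=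
  Finset.sum_le_sum fun a _ => mul_le_mul_of_nonneg_left (h a) ENNReal.toReal_nonneg

theorem abs_expect_le (p : PMF α) {f : α → ℝ} {k : ℝ} (h : ∀ a, |f a| ≤ k) : |expect p f| ≤ k := by
  rw [abs_le]
  constructor
  · rw [← expect_const p (-k)]
    exact expect_mono p fun a => (abs_le.1 (h a)).1
  · rw [← expect_const p k]
    exact expect_mono p fun a => (abs_le.1 (h a)).2

end Expect

/-! ### Moments of the Plackett–Luce distribution -/

/-- The mean of `σ̂'s` for the Plackett–Luce distribution with the odds `x`. -/
def oddsMean {n : ℕ} (x s : Fin n → ℝ) : ℝ :=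
  1 / 4 * ∑ u, ∑ v, (s u - s v) * ((x v - x u) / (x u + x v))

/-- The change of the mean of `σ̂'s` that is caused by the information that `u` comes first. -/
def oddsShift {n : ℕ} (x s : Fin n → ℝ) (u : Fin n) : ℝ :=
  ∑ v, (s v - s u) * (x v / (x u + x v))

/-- The contribution of the pair `u, v` to the variance of `σ̂'s`. -/
def pairVar {n : ℕ} (x s : Fin n → ℝ) (u v : Fin n) : ℝ :=
  x u * x v / (x u + x v) ^ 2 * (s u - s v) ^ 2

/-- The contribution of `u, v` and a third item `c` to the variance of `σ̂'s`. -/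
def tripleVar {n : ℕ} (x s : Fin n → ℝ) (u v c : Fin n) : ℝ :=
  if u = v ∨ c = u ∨ c = v then 0 else
    x u * x v * x c ^ 2 / ((x u + x v + x c) * (x u + x v) * (x v + x c) * (x u + x c)) *
      (s u - s v) ^ 2

/-- The variance of `σ̂'s` for the Plackett–Luce distribution with the odds `x`. -/
def oddsVar {n : ℕ} (x s : Fin n → ℝ) : ℝ :=
  1 / 2 * ∑ u, ∑ v, pairVar x s u v + ∑ u, ∑ v, ∑ c, tripleVar x s u v c

theorem sum_succAbove {n : ℕ} (u : Fin (n + 1)) (f : Fin (n + 1) → ℝ) :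
    ∑ i, f (u.succAbove i) = ∑ i, if i = u then 0 else f i := by
  rw [Fin.sum_univ_succAbove _ u]
  simp [Fin.succAbove_ne]

/-- Comparisons among the other items keep their law when `u` is known to be first, while those with
`u` become certain. The gap is `1/2 - (x u - x v) / (2 (x u + x v)) = x v / (x u + x v)`. -/
theorem oddsMean_succAbove {n : ℕ} (x s : Fin (n + 1) → ℝ) (hx : ∀ v, 0 < x v) (u : Fin (n + 1)) :
    oddsMean (fun i => x (u.succAbove i)) (fun i => s (u.succAbove i)) + 1 / 2 * ∑ v, (s v - s u) =
      oddsMean x s + oddsShift x s u := by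
  have h1 : ∑ a, ∑ b, (s a - s b) * ((x b - x a) / (x a + x b)) =
      2 * ∑ v, (s v - s u) * ((x u - x v) / (x u + x v)) +
      ∑ i, ∑ j, (s (u.succAbove i) - s (u.succAbove j)) *
        ((x (u.succAbove j) - x (u.succAbove i)) / (x (u.succAbove i) + x (u.succAbove j))) := by
    rw [Fin.sum_univ_succAbove _ u]
    simp_rw [Fin.sum_univ_succAbove _ u, Finset.sum_add_distrib]
    simp only [sub_self, zero_mul, zero_add]
    have : ∀ i, (s u - s (u.succAbove i)) * ((x (u.succAbove i) - x u) /
        (x u + x (u.succAbove i))) = (s (u.succAbove i) - s u) *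
          ((x u - x (u.succAbove i)) / (x u + x (u.succAbove i))) := fun i => by ring
    simp_rw [this, add_comm (x (u.succAbove _)) (x u)]
    ring
  have h2 : 1 / 2 * ∑ v, (s v - s u) =
      1 / 2 * ∑ v, (s v - s u) * ((x u - x v) / (x u + x v)) +
      ∑ v, (s v - s u) * (x v / (x u + x v)) := by
    rw [Finset.mul_sum, Finset.mul_sum, ← Finset.sum_add_distrib]
    refine Finset.sum_congr rfl fun v _ => ?_
    have := (add_pos (hx u) (hx v)).ne'
    field_simp
    ring
  rw [oddsMean, oddsMean, oddsShift, h1, h2]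
  ring

/-- The summand is antisymmetric in the two items. In probabilistic terms, the conditional means
average to the mean. -/
theorem sum_mul_oddsShift {n : ℕ} (x s : Fin n → ℝ) : ∑ u, x u * oddsShift x s u = 0 := by
  have h : ∑ u, x u * oddsShift x s u =
      ∑ u, ∑ v, x u * ((s v - s u) * (x v / (x u + x v))) := by
    simp [oddsShift, Finset.mul_sum]
  have h2 : ∑ u, ∑ v, x u * ((s v - s u) * (x v / (x u + x v))) =
      -∑ u, ∑ v, x u * ((s v - s u) * (x v / (x u + x v))) := by
    conv_lhs => rw [Finset.sum_comm]
    rw [← Finset.sum_neg_distrib]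
    refine Finset.sum_congr rfl fun u _ => ?_
    rw [← Finset.sum_neg_distrib]
    refine Finset.sum_congr rfl fun v _ => ?_
    rw [add_comm (x v)]
    ring
  linarith

theorem sum_rotate {n : ℕ} (F : Fin n → Fin n → Fin n → ℝ) :
    ∑ u, ∑ v, ∑ c, F v c u = ∑ u, ∑ v, ∑ c, F u v c := by
  rw [Finset.sum_comm]
  refine Finset.sum_congr rfl fun u _ => ?_
  rw [Finset.sum_comm]

/-- This is the variance of the conditional mean given the first item, times the total odds. The
factors `x u + x v` and `x u + x v + x c` are the weights with which a pair or a triple loses a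
member to the first position; this makes the induction for the variance close. -/
theorem sum_mul_oddsShift_sq {n : ℕ} (x s : Fin n → ℝ) (hx : ∀ v, 0 < x v) :
    ∑ u, x u * oddsShift x s u ^ 2 =
      1 / 2 * ∑ u, ∑ v, (x u + x v) * pairVar x s u v +
      ∑ u, ∑ v, ∑ c, (x u + x v + x c) * tripleVar x s u v c := by
  -- The off-diagonal terms of the expanded square; the diagonal ones yield the pair contributions.
  set F : Fin n → Fin n → Fin n → ℝ := fun u v c =>
    if u = v ∨ c = u ∨ c = v then 0 else
      x u * ((s v - s u) * (x v / (x u + x v))) * ((s c - s u) * (x c / (x u + x c))) with hF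
  have h1 : ∀ u, x u * oddsShift x s u ^ 2 =
      ∑ v, x u * ((s v - s u) * (x v / (x u + x v))) ^ 2 + ∑ v, ∑ c, F u v c := by
    intro u
    rw [oddsShift, sq, Finset.sum_mul_sum, Finset.mul_sum, ← Finset.sum_add_distrib]
    refine Finset.sum_congr rfl fun v _ => ?_
    rw [Finset.mul_sum, ← Finset.add_sum_erase _ _ (Finset.mem_univ v),
      ← Finset.add_sum_erase _ (F u v) (Finset.mem_univ v)]
    have : F u v v = 0 := by simp [hF]
    rw [this, zero_add]
    congr 1
    · ring
    · refine Finset.sum_congr rfl fun c hc => ?_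
      have hcv : c ≠ v := Finset.ne_of_mem_erase hc
      by_cases huv : u = v
      · simp [hF, huv]
      · by_cases hcu : c = u
        · simp [hF, hcu]
        · simp only [hF, huv, hcu, hcv, or_self, if_false]
          ring
  have h2 : ∑ u, ∑ v, x u * ((s v - s u) * (x v / (x u + x v))) ^ 2 =
      1 / 2 * ∑ u, ∑ v, (x u + x v) * pairVar x s u v := by
    have : ∑ u, ∑ v, (x u + x v) * pairVar x s u v =
        ∑ u, ∑ v, x u * ((s v - s u) * (x v / (x u + x v))) ^ 2 +
        ∑ u, ∑ v, x v * ((s u - s v) * (x u / (x v + x u))) ^ 2 := by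
      rw [← Finset.sum_add_distrib]
      refine Finset.sum_congr rfl fun u _ => ?_
      rw [← Finset.sum_add_distrib]
      refine Finset.sum_congr rfl fun v _ => ?_
      have := (add_pos (hx u) (hx v)).ne'
      rw [pairVar, add_comm (x v)]
      field_simp
      ring
    rw [this, Finset.sum_comm (f := fun u v => x v * ((s u - s v) * (x u / (x v + x u))) ^ 2)]
    ring
  have h3 : ∑ u, ∑ v, ∑ c, F u v c =
      ∑ u, ∑ v, ∑ c, (x u + x v + x c) * tripleVar x s u v c := by
    set G : Fin n → Fin n → Fin n → ℝ := fun u v c =>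
      (x u + x v + x c) * tripleVar x s u v c with hG
    -- `F` and `G` do not agree termwise; only after summing the three cyclic rotations do they
    -- become equal as rational functions.
    have key : ∑ u, ∑ v, ∑ c, (F u v c + F v c u + F c u v) =
        ∑ u, ∑ v, ∑ c, (G u v c + G v c u + G c u v) := by
      refine Finset.sum_congr rfl fun u _ => Finset.sum_congr rfl fun v _ =>
        Finset.sum_congr rfl fun c _ => ?_
      by_cases h : u = v ∨ c = u ∨ c = v
      · have h' : v = c ∨ u = v ∨ u = c := by tauto
        have h'' : c = u ∨ v = c ∨ v = u := by tauto
        simp only [hF, hG, tripleVar, if_pos h, if_pos h', if_pos h'']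
        ring
      · have h' : ¬ (v = c ∨ u = v ∨ u = c) := by tauto
        have h'' : ¬ (c = u ∨ v = c ∨ v = u) := by tauto
        simp only [hF, hG, tripleVar, if_neg h, if_neg h', if_neg h'']
        have a1 := hx u
        have a2 := hx v
        have a3 := hx c
        generalize x u = X at *
        generalize x v = Y at *
        generalize x c = Z at *
        rw [show Y + X = X + Y by ring, show Z + X = X + Z by ring, show Z + Y = Y + Z by ring,
          show Y + Z + X = X + Y + Z by ring, show X + Z + Y = X + Y + Z by ring]
        have b1 : X + Y ≠ 0 := by positivity
        have b2 : Y + Z ≠ 0 := by positivity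
        have b3 : X + Z ≠ 0 := by positivity
        have b4 : X + Y + Z ≠ 0 := by positivity
        field_simp
        ring
    simp only [Finset.sum_add_distrib] at key
    have r1 := sum_rotate F
    have r2 := sum_rotate fun u v c => F v c u
    have r3 := sum_rotate G
    have r4 := sum_rotate fun u v c => G v c u
    linarith
  simp_rw [h1, Finset.sum_add_distrib]
  rw [h2, h3]

theorem sum_mul_avoid_two {n : ℕ} (x : Fin n → ℝ) (a b : Fin n) (hab : a ≠ b) (k : ℝ) :
    ∑ u, x u * (if a = u then 0 else if b = u then 0 else k) = (∑ u, x u - (x a + x b)) * k := by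
  have : ∀ u, x u * (if a = u then 0 else if b = u then 0 else k) =
      x u * k - (if a = u then x u * k else 0) - (if b = u then x u * k else 0) := by
    intro u
    by_cases h1 : a = u
    · have : b ≠ u := fun h => hab (h1.trans h.symm)
      simp [h1, this]
    · by_cases h2 : b = u <;> simp [h1, h2]
  simp_rw [this, Finset.sum_sub_distrib, Finset.sum_ite_eq, Finset.mem_univ, if_true,
    ← Finset.sum_mul]
  ring

theorem sum_mul_avoid_three {n : ℕ} (x : Fin n → ℝ) (a b c : Fin n) (hab : a ≠ b) (hca : c ≠ a)
    (hcb : c ≠ b) (k : ℝ) :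
    ∑ u, x u * (if a = u then 0 else if b = u then 0 else if c = u then 0 else k) =
      (∑ u, x u - (x a + x b + x c)) * k := by
  have : ∀ u, x u * (if a = u then 0 else if b = u then 0 else if c = u then 0 else k) =
      x u * (if a = u then 0 else if b = u then 0 else k) - (if c = u then x u * k else 0) := by
    intro u
    by_cases h1 : c = u
    · subst h1
      simp [hca.symm, hcb.symm]
    · simp [h1]
  simp_rw [this, Finset.sum_sub_distrib, Finset.sum_ite_eq, Finset.mem_univ, if_true,
    sum_mul_avoid_two x a b hab k]
  ring

/-- The law of total variance, times the total odds. A pair survives the removal of the first item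
with weight `∑ x - (x a + x b)`, a triple likewise, and `sum_mul_oddsShift_sq` restores exactly what
is lost. -/
theorem oddsVar_succAbove {n : ℕ} (x s : Fin (n + 1) → ℝ) (hx : ∀ v, 0 < x v) :
    ∑ u, x u * (oddsVar (fun i => x (u.succAbove i)) (fun i => s (u.succAbove i)) +
      oddsShift x s u ^ 2) = (∑ u, x u) * oddsVar x s := by
  have h1 : ∀ u, oddsVar (fun i => x (u.succAbove i)) (fun i => s (u.succAbove i)) =
      1 / 2 * ∑ a, ∑ b, (if a = u then 0 else if b = u then 0 else pairVar x s a b) +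
      ∑ a, ∑ b, ∑ c, (if a = u then 0 else if b = u then 0 else if c = u then 0 else
        tripleVar x s a b c) := by
    intro u
    have e2 : ∀ i j, pairVar (fun i => x (u.succAbove i)) (fun i => s (u.succAbove i)) i j =
        pairVar x s (u.succAbove i) (u.succAbove j) := fun i j => rfl
    have e3 : ∀ i j k, tripleVar (fun i => x (u.succAbove i)) (fun i => s (u.succAbove i)) i j k =
        tripleVar x s (u.succAbove i) (u.succAbove j) (u.succAbove k) := fun i j k => by
      simp only [tripleVar, Fin.succAbove_right_inj]
    unfold oddsVar
    simp_rw [e2, e3]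
    have hk : ∀ f : Fin (n + 1) → ℝ, ∑ i, f (u.succAbove i) = ∑ i, if i = u then 0 else f i :=
      sum_succAbove u
    rw [hk fun a => ∑ j, pairVar x s a (u.succAbove j),
      hk fun a => ∑ j, ∑ k, tripleVar x s a (u.succAbove j) (u.succAbove k)]
    congr 2
    · refine Finset.sum_congr rfl fun a _ => ?_
      rw [hk]
      by_cases h : a = u <;> simp [h]
    · ext a
      rw [hk fun b => ∑ k, tripleVar x s a b (u.succAbove k)]
      by_cases h : a = u
      · simp [h]
      · simp only [h, if_false]
        refine Finset.sum_congr rfl fun b _ => ?_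
        rw [hk]
        by_cases h : b = u <;> simp [h]
  have h2 : ∑ u, x u * ∑ a, ∑ b, (if a = u then 0 else if b = u then 0 else pairVar x s a b) =
      ∑ a, ∑ b, (∑ u, x u - (x a + x b)) * pairVar x s a b := by
    simp_rw [Finset.mul_sum]
    rw [Finset.sum_comm]
    refine Finset.sum_congr rfl fun a _ => ?_
    rw [Finset.sum_comm]
    refine Finset.sum_congr rfl fun b _ => ?_
    by_cases h : a = b
    · simp [pairVar, h]
    · exact sum_mul_avoid_two x a b h _
  have h3 : ∑ u, x u * ∑ a, ∑ b, ∑ c, (if a = u then 0 else if b = u then 0 else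
        if c = u then 0 else tripleVar x s a b c) =
      ∑ a, ∑ b, ∑ c, (∑ u, x u - (x a + x b + x c)) * tripleVar x s a b c := by
    simp_rw [Finset.mul_sum]
    rw [Finset.sum_comm]
    refine Finset.sum_congr rfl fun a _ => ?_
    rw [Finset.sum_comm]
    refine Finset.sum_congr rfl fun b _ => ?_
    rw [Finset.sum_comm]
    refine Finset.sum_congr rfl fun c _ => ?_
    by_cases h : a = b ∨ c = a ∨ c = b
    · simp [tripleVar, h]
    · push Not at h
      exact sum_mul_avoid_three x a b c h.1 h.2.1 h.2.2 _
  simp_rw [h1, mul_add, Finset.sum_add_distrib, mul_left_comm (x _) (1 / 2 : ℝ)]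
  rw [← Finset.mul_sum, h2, h3, sum_mul_oddsShift_sq x s hx, oddsVar]
  simp_rw [sub_mul, Finset.sum_sub_distrib, ← Finset.mul_sum]
  ring

theorem consPerm_self {n : ℕ} (u : Fin (n + 1)) (σ : Equiv.Perm (Fin n)) :
    consPerm u σ u = 0 := by
  simp [consPerm]

theorem consPerm_succAbove {n : ℕ} (u : Fin (n + 1)) (σ : Equiv.Perm (Fin n)) (v : Fin n) :
    consPerm u σ (u.succAbove v) = (σ v).succ := by
  simp [consPerm]

/-- The other items move back by one position while the center moves by `1/2`, a net gain of `1/2`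
each; item `u` gets `-n/2`. -/
theorem symVec_consPerm_dotProduct {n : ℕ} (u : Fin (n + 1)) (σ : Equiv.Perm (Fin n))
    (s : Fin (n + 1) → ℝ) :
    symVec (consPerm u σ) ⬝ᵥ s =
      symVec σ ⬝ᵥ (fun v => s (u.succAbove v)) + 1 / 2 * ∑ v, (s v - s u) := by
  simp only [dotProduct]
  rw [Fin.sum_univ_succAbove _ u, Fin.sum_univ_succAbove (fun v => s v - s u) u]
  simp only [symVec, consPerm_self, Fin.val_zero, consPerm_succAbove, Fin.val_succ,
    Finset.sum_sub_distrib,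
    Finset.sum_const, Finset.card_univ, Fintype.card_fin, nsmul_eq_mul, add_mul, sub_mul,
    Finset.sum_add_distrib]
  push_cast
  simp only [add_mul, Finset.sum_add_distrib, one_mul, ← Finset.mul_sum]
  ring

theorem expect_softmax {n : ℕ} (w : Fin (n + 1) → ℝ) (f : Fin (n + 1) → ℝ) :
    expect (softmax w) f = (∑ u, Real.exp (w u) * f u) / ∑ v, Real.exp (w v) := by
  have h : (0 : ℝ) < ∑ v, Real.exp (w v) :=
    Finset.sum_pos (fun v _ => Real.exp_pos _) Finset.univ_nonempty
  rw [expect, Finset.sum_div]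
  refine Finset.sum_congr rfl fun u _ => ?_
  rw [softmax, PMF.ofFintype_apply, ENNReal.toReal_ofReal (by positivity)]
  ring

/-- By induction the mean given that `u` is first is `oddsMean + oddsShift u`, and the shifts
average to zero. -/
theorem expect_plackettLuce {n : ℕ} (w s : Fin n → ℝ) :
    expect (plackettLuce n w) (fun σ => symVec σ ⬝ᵥ s) = oddsMean (fun v => Real.exp (w v)) s := by
  induction n with
  | zero => simp [plackettLuce, expect_pure, oddsMean, dotProduct]
  | succ n ih =>
    have hS : (0 : ℝ) < ∑ v, Real.exp (w v) :=
      Finset.sum_pos (fun v _ => Real.exp_pos _) Finset.univ_nonempty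
    rw [plackettLuce, expect_bind]
    have step : ∀ u, expect (plackettLuce n fun v => w (u.succAbove v))
          (fun σ => symVec σ ⬝ᵥ (fun v => s (u.succAbove v)) + 1 / 2 * ∑ v, (s v - s u)) =
        oddsMean (fun v => Real.exp (w v)) s + oddsShift (fun v => Real.exp (w v)) s u := by
      intro u
      rw [expect_add, expect_const, ih]
      exact oddsMean_succAbove (fun v => Real.exp (w v)) s (fun v => Real.exp_pos _) u
    simp_rw [expect_map, symVec_consPerm_dotProduct, step]
    rw [expect_add, expect_const, expect_softmax]
    rw [sum_mul_oddsShift (fun v => Real.exp (w v)) s]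
    simp

theorem expect_plackettLuce_sq {n : ℕ} (w s : Fin n → ℝ) :
    expect (plackettLuce n w) (fun σ => (symVec σ ⬝ᵥ s) ^ 2) =
      oddsMean (fun v => Real.exp (w v)) s ^ 2 + oddsVar (fun v => Real.exp (w v)) s := by
  induction n with
  | zero => simp [plackettLuce, expect_pure, oddsMean, oddsVar, dotProduct]
  | succ n ih =>
    have hS : (0 : ℝ) < ∑ v, Real.exp (w v) :=
      Finset.sum_pos (fun v _ => Real.exp_pos _) Finset.univ_nonempty
    -- The conditional second moment is the conditional variance plus the square of the conditional
    -- mean `oddsMean + oddsShift u`.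
    have step : ∀ u, expect (plackettLuce n fun v => w (u.succAbove v))
        (fun σ => (symVec σ ⬝ᵥ (fun v => s (u.succAbove v)) + 1 / 2 * ∑ v, (s v - s u)) ^ 2) =
        (oddsVar (fun v => Real.exp (w (u.succAbove v))) (fun v => s (u.succAbove v)) +
          oddsShift (fun v => Real.exp (w v)) s u ^ 2) +
        (2 * oddsMean (fun v => Real.exp (w v)) s) * oddsShift (fun v => Real.exp (w v)) s u +
        oddsMean (fun v => Real.exp (w v)) s ^ 2 := by
      intro u
      simp_rw [add_sq, expect_add, mul_assoc (2 : ℝ), expect_const_mul, expect_const,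
        mul_comm (_ ⬝ᵥ _), expect_const_mul, ih, expect_plackettLuce]
      have := oddsMean_succAbove (fun v => Real.exp (w v)) s (fun v => Real.exp_pos _) u
      have h' := congrArg (fun z => z ^ 2) this
      linear_combination h'
    rw [plackettLuce, expect_bind]
    simp_rw [expect_map, symVec_consPerm_dotProduct, step]
    rw [expect_softmax]
    have k1 := oddsVar_succAbove (fun v => Real.exp (w v)) s fun v => Real.exp_pos _
    have k2 := sum_mul_oddsShift (fun v => Real.exp (w v)) s
    rw [div_eq_iff hS.ne']
    simp_rw [mul_add _ _ (oddsMean _ _ ^ 2), Finset.sum_add_distrib]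
    rw [← Finset.sum_mul]
    have e : ∀ u, Real.exp (w u) * (oddsVar (fun v => Real.exp (w (u.succAbove v)))
          (fun v => s (u.succAbove v)) + oddsShift (fun v => Real.exp (w v)) s u ^ 2 +
          2 * oddsMean (fun v => Real.exp (w v)) s * oddsShift (fun v => Real.exp (w v)) s u) =
        Real.exp (w u) * (oddsVar (fun v => Real.exp (w (u.succAbove v)))
          (fun v => s (u.succAbove v)) + oddsShift (fun v => Real.exp (w v)) s u ^ 2) +
        2 * oddsMean (fun v => Real.exp (w v)) s *
          (Real.exp (w u) * oddsShift (fun v => Real.exp (w v)) s u) := fun u => by ring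
    simp_rw [e, Finset.sum_add_distrib]
    rw [k1, ← Finset.mul_sum, k2]
    ring

/-- This makes the uniform part of the mixture a case of the moment formulas, and lets one sampler
serve both parts. Each ranking arises from exactly one pair `(u, σ)` under `consPerm`. -/
theorem plackettLuce_zero (n : ℕ) :
    plackettLuce n (fun _ => 0) = PMF.uniformOfFintype (Equiv.Perm (Fin n)) := by
  induction n with
  | zero =>
    ext σ
    have : σ = 1 := Subsingleton.elim _ _
    simp [plackettLuce, this]
  | succ n ih =>
    have hs : softmax (fun _ : Fin (n + 1) => (0 : ℝ)) = PMF.uniformOfFintype (Fin (n + 1)) := by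
      ext u
      rw [softmax, PMF.ofFintype_apply, PMF.uniformOfFintype_apply]
      simp only [Real.exp_zero, Finset.sum_const, Finset.card_univ, Fintype.card_fin, nsmul_eq_mul,
        mul_one, one_div]
      rw [ENNReal.ofReal_inv_of_pos (by positivity), ENNReal.ofReal_natCast]
    ext π
    rw [plackettLuce, ih, hs, PMF.bind_apply, tsum_fintype]
    simp only [PMF.map_apply, PMF.uniformOfFintype_apply, tsum_fintype]
    have hbij : Function.Bijective fun z : Fin (n + 1) × Equiv.Perm (Fin n) => consPerm z.1 z.2 := by
      rw [Fintype.bijective_iff_injective_and_card]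
      constructor
      · rintro ⟨u, σ⟩ ⟨u', σ'⟩ h
        simp only at h
        have hu : u = u' := by
          apply (consPerm u σ).injective
          rw [consPerm_self, h, consPerm_self]
        subst hu
        congr 1
        ext v
        have := DFunLike.congr_fun h (u.succAbove v)
        rw [consPerm_succAbove, consPerm_succAbove] at this
        rw [Fin.succ_injective _ this]
      · simp [Fintype.card_perm, Nat.factorial_succ]
    obtain ⟨⟨u, σ⟩, rfl, huniq⟩ := hbij.existsUnique π
    rw [Finset.sum_eq_single u, Finset.sum_eq_single σ]
    · simp only [if_true, Fintype.card_perm, Fintype.card_fin, Nat.factorial_succ]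
      rw [Nat.cast_mul, ENNReal.mul_inv (by simp) (by simp)]
    · intro σ' _ hne
      rw [if_neg]
      intro h
      exact hne (Prod.ext_iff.1 (huniq (u, σ') h.symm)).2
    · simp
    · intro u' _ hne
      rw [Finset.sum_eq_zero, mul_zero]
      intro σ' _
      rw [if_neg]
      intro h
      exact hne (Prod.ext_iff.1 (huniq (u', σ') h.symm)).1
    · simp

/-! ### The covariance of the Plackett–Luce distribution as a graph Laplacian -/

/-- The mean position vector of the Plackett–Luce distribution with the odds `x`. -/
def meanVec {n : ℕ} (x : Fin n → ℝ) (u : Fin n) : ℝ :=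
  1 / 2 * ∑ v, (x v - x u) / (x u + x v)

/-- The edge weights of the graph whose Laplacian is the covariance matrix. -/
def edgeWeight {n : ℕ} (x : Fin n → ℝ) (u v : Fin n) : ℝ :=
  x u * x v / (x u + x v) ^ 2 + ∑ c, if c = u ∨ c = v then 0 else
    2 * (x u * x v * x c ^ 2 / ((x u + x v + x c) * (x u + x v) * (x v + x c) * (x u + x c)))

theorem oddsMean_eq {n : ℕ} (x s : Fin n → ℝ) : oddsMean x s = meanVec x ⬝ᵥ s := by
  have h : ∑ u, ∑ v, s v * ((x v - x u) / (x u + x v)) =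
      -∑ u, ∑ v, s u * ((x v - x u) / (x u + x v)) := by
    rw [Finset.sum_comm, ← Finset.sum_neg_distrib]
    refine Finset.sum_congr rfl fun u _ => ?_
    rw [← Finset.sum_neg_distrib]
    refine Finset.sum_congr rfl fun v _ => ?_
    rw [add_comm (x v), ← mul_neg, ← neg_div, neg_sub]
  simp_rw [oddsMean, sub_mul, Finset.sum_sub_distrib, h, dotProduct, meanVec]
  simp_rw [Finset.mul_sum, Finset.sum_mul]
  rw [sub_neg_eq_add, ← Finset.sum_add_distrib, Finset.mul_sum]
  refine Finset.sum_congr rfl fun u _ => ?_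
  rw [← Finset.sum_add_distrib, Finset.mul_sum]
  exact Finset.sum_congr rfl fun v _ => by ring

/-- Collecting the triple terms over the third item `c` leaves one weight per pair, so the variance
is a Laplacian form. The 2 in `edgeWeight` offsets the outer `1 / 2`. -/
theorem oddsVar_eq {n : ℕ} (x s : Fin n → ℝ) :
    oddsVar x s = 1 / 2 * ∑ u, ∑ v, edgeWeight x u v * (s u - s v) ^ 2 := by
  rw [oddsVar, Finset.mul_sum, Finset.mul_sum, ← Finset.sum_add_distrib]
  refine Finset.sum_congr rfl fun u _ => ?_
  rw [Finset.mul_sum, Finset.mul_sum, ← Finset.sum_add_distrib]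
  refine Finset.sum_congr rfl fun v _ => ?_
  by_cases huv : u = v
  · simp [huv, pairVar, tripleVar]
  · rw [edgeWeight, add_mul, mul_add, pairVar, Finset.sum_mul, Finset.mul_sum]
    congr 1
    refine Finset.sum_congr rfl fun c _ => ?_
    by_cases h : c = u ∨ c = v
    · simp [tripleVar, h]
    · simp only [tripleVar, huv, h, or_false, if_false]
      ring

theorem edgeWeight_comm {n : ℕ} (x : Fin n → ℝ) (u v : Fin n) :
    edgeWeight x u v = edgeWeight x v u := by
  rw [edgeWeight, edgeWeight]
  congr 1
  · rw [mul_comm (x u), add_comm (x u)]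
  · refine Finset.sum_congr rfl fun c _ => ?_
    by_cases h : c = u ∨ c = v
    · rw [if_pos h, if_pos h.symm]
    · rw [if_neg h, if_neg (mt Or.symm h)]
      ring

/-- The pair contributes `1/4` and each of the `n - 2` third items `2/24`. -/
theorem edgeWeight_one {n : ℕ} {u v : Fin n} (huv : u ≠ v) :
    edgeWeight (fun _ => 1) u v = ((n : ℝ) + 1) / 12 := by
  have h : ∀ c : Fin n, (if c = u ∨ c = v then (0 : ℝ) else
      2 * (1 * 1 * 1 ^ 2 / ((1 + 1 + 1) * (1 + 1) * (1 + 1) * (1 + 1)))) =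
      1 / 12 - (if c = u then 1 / 12 else 0) - (if c = v then 1 / 12 else 0) := by
    intro c
    by_cases h1 : c = u
    · have : c ≠ v := fun h => huv (h1.symm.trans h)
      simp [h1, huv]
    · by_cases h2 : c = v
      · simp [h2, huv.symm]
      · norm_num [h1, h2]
  simp_rw [edgeWeight, h, Finset.sum_sub_distrib, Finset.sum_ite_eq', Finset.mem_univ, if_true]
  simp
  ring

theorem oddsVar_one {n : ℕ} (s : Fin n → ℝ) :
    oddsVar (fun _ => 1) s = ((n : ℝ) + 1) / 12 * (1 / 2 * ∑ u, ∑ v, (s u - s v) ^ 2) := by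
  rw [oddsVar_eq, mul_left_comm, Finset.mul_sum (a := ((n : ℝ) + 1) / 12)]
  congr 1
  refine Finset.sum_congr rfl fun u _ => ?_
  rw [Finset.mul_sum]
  refine Finset.sum_congr rfl fun v _ => ?_
  by_cases huv : u = v
  · simp [huv]
  · rw [edgeWeight_one huv]

/-- The triple terms are nonnegative. This is what lets the covariance dominate the Hessian of the
potential, which only sees pairs. -/
theorem pairWeight_le_edgeWeight {n : ℕ} {x : Fin n → ℝ} (hx : ∀ v, 0 < x v) (u v : Fin n) :
    x u * x v / (x u + x v) ^ 2 ≤ edgeWeight x u v := by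
  refine le_add_of_nonneg_right (Finset.sum_nonneg fun c _ => ?_)
  have := hx u
  have := hx v
  have := hx c
  split_ifs <;> positivity

/-- The sum of the variances of the single comparisons is at most the variance of `σ̂'s`. -/
theorem sum_pairVar_le {n : ℕ} {x : Fin n → ℝ} (hx : ∀ v, 0 < x v) (s : Fin n → ℝ) :
    1 / 2 * ∑ u, ∑ v, pairVar x s u v ≤ oddsVar x s := by
  rw [oddsVar_eq]
  refine mul_le_mul_of_nonneg_left (Finset.sum_le_sum fun u _ => Finset.sum_le_sum fun v _ => ?_)
    (by norm_num)
  exact mul_le_mul_of_nonneg_right (pairWeight_le_edgeWeight hx u v) (sq_nonneg _)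

theorem oddsVar_nonneg {n : ℕ} {x : Fin n → ℝ} (hx : ∀ v, 0 < x v) (s : Fin n → ℝ) :
    0 ≤ oddsVar x s := by
  refine le_trans ?_ (sum_pairVar_le hx s)
  refine mul_nonneg (by norm_num) (Finset.sum_nonneg fun u _ => Finset.sum_nonneg fun v _ => ?_)
  have := hx u
  have := hx v
  rw [pairVar]
  positivity

theorem sum_meanVec {n : ℕ} (x : Fin n → ℝ) : ∑ u, meanVec x u = 0 := by
  have := oddsMean_eq x fun _ => 1
  simpa [oddsMean, dotProduct] using this.symm

/-! ### The mixture -/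

theorem coin_toReal (p : ℝ) (b : Bool) :
    (coin p b).toReal = if b then max 0 (min p 1) else 1 - max 0 (min p 1) := by
  rw [coin, PMF.ofFintype_apply, ENNReal.toReal_ofReal]
  split_ifs <;> simp

theorem coin_toReal_of_mem {p : ℝ} (h0 : 0 ≤ p) (h1 : p ≤ 1) (b : Bool) :
    (coin p b).toReal = if b then p else 1 - p := by
  rw [coin_toReal, min_eq_left h1, max_eq_right h0]

theorem expect_mixture {n : ℕ} {γ : ℝ} (h0 : 0 ≤ γ) (h1 : γ ≤ 1) (w : Fin n → ℝ)
    (f : Equiv.Perm (Fin n) → ℝ) :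
    expect (mixture γ w) f = γ * expect (plackettLuce n fun _ => 0) f +
      (1 - γ) * expect (plackettLuce n w) f := by
  rw [mixture, expect_bind, plackettLuce_zero]
  simp [expect, coin_toReal_of_mem h0 h1]

/-- The odds that belong to the weights `w`. -/
abbrev odds {n : ℕ} (w : Fin n → ℝ) : Fin n → ℝ := fun v => Real.exp (w v)

theorem odds_pos {n : ℕ} (w : Fin n → ℝ) (v : Fin n) : 0 < odds w v := Real.exp_pos _

theorem expect_mixture_linear {n : ℕ} {γ : ℝ} (h0 : 0 ≤ γ) (h1 : γ ≤ 1) (w s : Fin n → ℝ) :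
    expect (mixture γ w) (fun σ => symVec σ ⬝ᵥ s) = (1 - γ) * (meanVec (odds w) ⬝ᵥ s) := by
  rw [expect_mixture h0 h1, expect_plackettLuce, expect_plackettLuce, oddsMean_eq (odds w)]
  simp [oddsMean]

theorem expect_mixture_sq {n : ℕ} {γ : ℝ} (h0 : 0 ≤ γ) (h1 : γ ≤ 1) (w s : Fin n → ℝ) :
    expect (mixture γ w) (fun σ => (symVec σ ⬝ᵥ s) ^ 2) =
      γ * (((n : ℝ) + 1) / 12 * (1 / 2 * ∑ u, ∑ v, (s u - s v) ^ 2)) +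
      (1 - γ) * ((meanVec (odds w) ⬝ᵥ s) ^ 2 + oddsVar (odds w) s) := by
  rw [expect_mixture h0 h1, expect_plackettLuce_sq, expect_plackettLuce_sq, oddsMean_eq (odds w)]
  have : oddsMean (fun _ : Fin n => Real.exp 0) s = 0 := by simp [oddsMean]
  rw [this]
  simp only [Real.exp_zero]
  rw [oddsVar_one]
  ring

/-! ### The Gram matrix of the estimator -/

/-- The edge weights for the mixture. -/
def mixWeight {n : ℕ} (γ : ℝ) (x : Fin n → ℝ) (u v : Fin n) : ℝ :=
  γ * (((n : ℝ) + 1) / 12) + (1 - γ) * edgeWeight x u v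

/-- The second moment matrix of `σ̂ - θ E[σ̂]`, for `θ = 0` or `θ = 1`, plus the all-ones matrix. -/
def gram {n : ℕ} (θ γ : ℝ) (x : Fin n → ℝ) : Matrix (Fin n) (Fin n) ℝ :=
  Matrix.of fun u v => (if u = v then ∑ c, mixWeight γ x u c else 0) - mixWeight γ x u v +
    (1 - γ) * (1 - θ * (1 - γ)) * (meanVec x u * meanVec x v) + 1

/-- The vector `σ̂ - θ E[σ̂]`. -/
def centered {n : ℕ} (θ γ : ℝ) (x : Fin n → ℝ) (σ : Equiv.Perm (Fin n)) : Fin n → ℝ :=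
  fun v => symVec σ v - θ * (1 - γ) * meanVec x v

/-- The solution of `gram y = σ̂ - θ E[σ̂]`. -/
def estimate {n : ℕ} (θ γ : ℝ) (x : Fin n → ℝ) (σ : Equiv.Perm (Fin n)) : Fin n → ℝ :=
  (gram θ γ x)⁻¹ *ᵥ centered θ γ x σ

theorem mixWeight_comm {n : ℕ} (γ : ℝ) (x : Fin n → ℝ) (u v : Fin n) :
    mixWeight γ x u v = mixWeight γ x v u := by
  rw [mixWeight, mixWeight, edgeWeight_comm]

theorem gram_transpose {n : ℕ} (θ γ : ℝ) (x : Fin n → ℝ) : (gram θ γ x)ᵀ = gram θ γ x := by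
  ext u v
  simp only [gram, Matrix.transpose_apply, Matrix.of_apply]
  rw [mixWeight_comm γ x v u, mul_comm (meanVec x v)]
  congr 3
  by_cases h : u = v
  · rw [if_pos h, if_pos h.symm, h]
  · rw [if_neg h, if_neg (Ne.symm h)]

theorem laplacian_form {n : ℕ} (k : Fin n → Fin n → ℝ) (hk : ∀ u v, k u v = k v u)
    (z : Fin n → ℝ) :
    ∑ u, ∑ v, z u * (((if u = v then ∑ c, k u c else 0) - k u v) * z v) =
      1 / 2 * ∑ u, ∑ v, k u v * (z u - z v) ^ 2 := by
  have h1 : ∑ u, ∑ v, k u v * z v ^ 2 = ∑ u, ∑ v, k u v * z u ^ 2 := by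
    rw [Finset.sum_comm]
    exact Finset.sum_congr rfl fun u _ => Finset.sum_congr rfl fun v _ => by rw [hk]
  have h2 : ∀ u v, k u v * (z u - z v) ^ 2 =
      k u v * z u ^ 2 + k u v * z v ^ 2 - 2 * (z u * (k u v * z v)) := fun u v => by ring
  have h3 : ∀ u v, z u * (((if u = v then ∑ c, k u c else 0) - k u v) * z v) =
      (if u = v then z u * (∑ c, k u c) * z v else 0) - z u * (k u v * z v) := by
    intro u v
    split_ifs <;> ring
  simp_rw [h2, h3, Finset.sum_sub_distrib, Finset.sum_add_distrib, h1, Finset.sum_ite_eq,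
    Finset.mem_univ, if_true, ← Finset.mul_sum]
  have h4 : ∑ u, z u * (∑ c, k u c) * z u = ∑ u, ∑ v, k u v * z u ^ 2 := by
    refine Finset.sum_congr rfl fun u _ => ?_
    rw [← Finset.sum_mul]
    ring
  rw [h4]
  ring

theorem gram_form {n : ℕ} (θ γ : ℝ) (x z : Fin n → ℝ) :
    z ⬝ᵥ gram θ γ x *ᵥ z =
      γ * (((n : ℝ) + 1) / 12 * (1 / 2 * ∑ u, ∑ v, (z u - z v) ^ 2)) + (1 - γ) * oddsVar x z +
      (1 - γ) * (1 - θ * (1 - γ)) * (meanVec x ⬝ᵥ z) ^ 2 + (∑ v, z v) ^ 2 := by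
  have h1 : z ⬝ᵥ gram θ γ x *ᵥ z =
      ∑ u, ∑ v, z u * (((if u = v then ∑ c, mixWeight γ x u c else 0) - mixWeight γ x u v) * z v) +
      (1 - γ) * (1 - θ * (1 - γ)) * (meanVec x ⬝ᵥ z) ^ 2 + (∑ v, z v) ^ 2 := by
    have e1 : (meanVec x ⬝ᵥ z) ^ 2 = ∑ u, ∑ v, meanVec x u * z u * (meanVec x v * z v) := by
      rw [sq, dotProduct, Finset.sum_mul_sum]
    rw [e1, sq, Finset.sum_mul_sum]
    simp only [dotProduct, Matrix.mulVec, Finset.mul_sum]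
    rw [← Finset.sum_add_distrib, ← Finset.sum_add_distrib]
    refine Finset.sum_congr rfl fun u _ => ?_
    rw [← Finset.sum_add_distrib, ← Finset.sum_add_distrib]
    refine Finset.sum_congr rfl fun v _ => ?_
    simp only [gram, Matrix.of_apply]
    ring
  rw [h1, laplacian_form _ (mixWeight_comm γ x), oddsVar_eq]
  simp_rw [mixWeight, add_mul, Finset.sum_add_distrib, mul_assoc, ← Finset.mul_sum]
  ring

theorem sum_symVec {n : ℕ} (σ : Equiv.Perm (Fin n)) : ∑ v, symVec σ v = 0 := by
  have : ∑ v, symVec σ v = ∑ v, symVec (1 : Equiv.Perm (Fin n)) v :=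
    Fintype.sum_equiv σ _ _ fun v => rfl
  rw [this]
  have h := Finset.sum_range_id_mul_two n
  have h' : (∑ i ∈ Finset.range n, (i : ℝ)) * 2 = n * (n - 1) := by
    rcases n with _ | n
    · simp
    · have := congrArg (Nat.cast : ℕ → ℝ) h
      push_cast at this
      simpa using this
  rw [Finset.sum_range] at h'
  simp only [symVec, Equiv.Perm.coe_one, id_eq, Finset.sum_sub_distrib, Finset.sum_add_distrib,
    Finset.sum_const, Finset.card_univ, Fintype.card_fin, nsmul_eq_mul]
  linarith

theorem sum_centered {n : ℕ} (θ γ : ℝ) (x : Fin n → ℝ) (σ : Equiv.Perm (Fin n)) :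
    ∑ v, centered θ γ x σ v = 0 := by
  simp only [centered]
  rw [Finset.sum_sub_distrib, ← Finset.mul_sum, sum_meanVec, sum_symVec]
  simp

/-- Laplacian rows and `meanVec` sum to zero, so only the all-ones matrix acts. Hence the Gram
matrix and, when it exists, its inverse preserve the zero-sum vectors. -/
theorem gram_mulVec_one {n : ℕ} (θ γ : ℝ) (x : Fin n → ℝ) :
    gram θ γ x *ᵥ (fun _ => 1) = fun _ => (n : ℝ) := by
  ext u
  simp only [Matrix.mulVec, dotProduct, gram, Matrix.of_apply, mul_one, Finset.sum_add_distrib,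
    Finset.sum_sub_distrib, Finset.sum_ite_eq, Finset.mem_univ, if_true, ← Finset.mul_sum,
    sum_meanVec]
  simp

theorem centered_dotProduct {n : ℕ} (θ γ : ℝ) (x z : Fin n → ℝ) (σ : Equiv.Perm (Fin n)) :
    centered θ γ x σ ⬝ᵥ z = symVec σ ⬝ᵥ z - θ * (1 - γ) * (meanVec x ⬝ᵥ z) := by
  simp only [dotProduct, centered, sub_mul, Finset.sum_sub_distrib, Finset.mul_sum]
  congr 1
  exact Finset.sum_congr rfl fun v _ => by ring

theorem sum_sub_sq {n : ℕ} (z : Fin n → ℝ) :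
    ∑ u, ∑ v, (z u - z v) ^ 2 = 2 * (n * ∑ v, z v ^ 2) - 2 * (∑ v, z v) ^ 2 := by
  simp_rw [sub_sq, Finset.sum_add_distrib, Finset.sum_sub_distrib, mul_assoc, ← Finset.mul_sum,
    ← Finset.sum_mul]
  simp only [Finset.sum_const, Finset.card_univ, Fintype.card_fin, nsmul_eq_mul, ← Finset.mul_sum]
  ring

theorem sum_gram_mulVec {n : ℕ} (θ γ : ℝ) (x z : Fin n → ℝ) :
    ∑ v, (gram θ γ x *ᵥ z) v = n * ∑ v, z v := by
  have : (fun _ => (1 : ℝ)) ⬝ᵥ (gram θ γ x *ᵥ z) = (fun _ => (n : ℝ)) ⬝ᵥ z := by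
    rw [Matrix.dotProduct_mulVec, ← Matrix.mulVec_transpose, gram_transpose, gram_mulVec_one]
  simpa [dotProduct, ← Finset.mul_sum] using this

theorem dotProduct_estimate {n : ℕ} (θ γ : ℝ) (x z : Fin n → ℝ) (σ : Equiv.Perm (Fin n)) :
    z ⬝ᵥ estimate θ γ x σ =
      centered θ γ x σ ⬝ᵥ ((gram θ γ x)⁻¹ *ᵥ z) := by
  rw [estimate, Matrix.dotProduct_mulVec, ← Matrix.mulVec_transpose,
    Matrix.transpose_nonsing_inv, gram_transpose, dotProduct_comm]

/-- The estimate is unbiased on the vectors with zero sum. -/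
theorem abs_symVec_le {n : ℕ} (σ : Equiv.Perm (Fin n)) (v : Fin n) : |symVec σ v| ≤ n / 2 := by
  have a1 : ((σ v : ℕ) : ℝ) + 1 ≤ n := by exact_mod_cast (σ v).2
  have a2 : (0 : ℝ) ≤ ((σ v : ℕ) : ℝ) := by positivity
  rw [symVec, abs_le]
  constructor <;> linarith

theorem abs_meanVec_le {n : ℕ} (w : Fin n → ℝ) (v : Fin n) : |meanVec (odds w) v| ≤ n / 2 := by
  have := abs_expect_le (plackettLuce n w) (f := fun σ => symVec σ ⬝ᵥ Pi.single v 1) (k := n / 2)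
    (by
      intro σ
      simp only [dotProduct_single, mul_one]
      exact abs_symVec_le σ v)
  rwa [expect_plackettLuce, oddsMean_eq, dotProduct_single, mul_one] at this

section Estimator

variable {n : ℕ} {θ γ : ℝ} (hθ : θ = 0 ∨ θ = 1) (h0 : 0 < γ) (h1 : γ ≤ 1) (w : Fin n → ℝ)

include hθ h0 h1

/-- The mixture has mean `(1 - γ) meanVec`, since the uniform part is centered. The coefficient of
the squared mean in `gram` is correct because `θ² = θ`. -/
theorem expect_centered_sq (z : Fin n → ℝ) :
    expect (mixture γ w) (fun σ => (centered θ γ (odds w) σ ⬝ᵥ z) ^ 2) =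
      z ⬝ᵥ gram θ γ (odds w) *ᵥ z - (∑ v, z v) ^ 2 := by
  simp_rw [centered_dotProduct, sub_sq, expect_add, expect_sub, expect_const, mul_assoc (2 : ℝ),
    expect_const_mul, mul_comm (symVec _ ⬝ᵥ z) _, expect_const_mul,
    expect_mixture_sq h0.le h1, expect_mixture_linear h0.le h1, gram_form]
  rcases hθ with rfl | rfl <;> ring

/-- Polarization of `expect_centered_sq`. -/
theorem expect_centered_mul (y z : Fin n → ℝ) :
    expect (mixture γ w) (fun σ => (centered θ γ (odds w) σ ⬝ᵥ y) *
        (centered θ γ (odds w) σ ⬝ᵥ z)) =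
      y ⬝ᵥ gram θ γ (odds w) *ᵥ z - (∑ v, y v) * (∑ v, z v) := by
  have e : ∀ σ, (centered θ γ (odds w) σ ⬝ᵥ y) * (centered θ γ (odds w) σ ⬝ᵥ z) =
      1 / 2 * ((centered θ γ (odds w) σ ⬝ᵥ (y + z)) ^ 2 - (centered θ γ (odds w) σ ⬝ᵥ y) ^ 2 -
        (centered θ γ (odds w) σ ⬝ᵥ z) ^ 2) := by
    intro σ
    rw [dotProduct_add]
    ring
  have sw : z ⬝ᵥ gram θ γ (odds w) *ᵥ y = y ⬝ᵥ gram θ γ (odds w) *ᵥ z := by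
    rw [Matrix.dotProduct_mulVec, ← Matrix.mulVec_transpose, gram_transpose, dotProduct_comm]
  simp_rw [e, expect_const_mul, expect_sub, expect_centered_sq hθ h0 h1]
  simp only [Matrix.mulVec_add, dotProduct_add, add_dotProduct, sw, Pi.add_apply,
    Finset.sum_add_distrib]
  ring

theorem gram_form_lower (z : Fin n → ℝ) :
    γ * ((n : ℝ) / 24 * ∑ u, ∑ v, (z u - z v) ^ 2) + (1 - γ) * oddsVar (odds w) z +
      (∑ v, z v) ^ 2 ≤ z ⬝ᵥ gram θ γ (odds w) *ᵥ z := by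
  rw [gram_form]
  have a1 : 0 ≤ ∑ u, ∑ v, (z u - z v) ^ 2 :=
    Finset.sum_nonneg fun _ _ => Finset.sum_nonneg fun _ _ => sq_nonneg _
  have a2 : 0 ≤ (1 - γ) * (1 - θ * (1 - γ)) * (meanVec (odds w) ⬝ᵥ z) ^ 2 := by
    refine mul_nonneg (mul_nonneg (by linarith) ?_) (sq_nonneg _)
    rcases hθ with rfl | rfl <;> linarith
  have a3 : 0 ≤ γ * ∑ u, ∑ v, (z u - z v) ^ 2 := mul_nonneg h0.le a1
  nlinarith

/-- On zero-sum vectors the uniform exploration gives positivity; off them the all-ones matrix does.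
-/
theorem gram_pos {z : Fin n → ℝ} (hz : z ≠ 0) : 0 < z ⬝ᵥ gram θ γ (odds w) *ᵥ z := by
  obtain ⟨i, hi⟩ : ∃ i, z i ≠ 0 := by
    by_contra! h
    exact hz (funext h)
  have hn : (0 : ℝ) < n := by exact_mod_cast i.pos
  refine lt_of_lt_of_le ?_ (gram_form_lower hθ h0 h1 w z)
  have b1 : 0 ≤ (1 - γ) * oddsVar (odds w) z :=
    mul_nonneg (by linarith) (oddsVar_nonneg (odds_pos w) z)
  have a1 : 0 ≤ ∑ u, ∑ v, (z u - z v) ^ 2 :=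
    Finset.sum_nonneg fun _ _ => Finset.sum_nonneg fun _ _ => sq_nonneg _
  by_cases hs : ∑ v, z v = 0
  · rw [sum_sub_sq, hs]
    have : 0 < ∑ v, z v ^ 2 :=
      Finset.sum_pos' (fun _ _ => sq_nonneg _) ⟨i, Finset.mem_univ i, by positivity⟩
    have : 0 < γ * ((n : ℝ) / 24 * (2 * (n * ∑ v, z v ^ 2) - 2 * 0 ^ 2)) := by
      norm_num
      positivity
    linarith [sq_nonneg (0 : ℝ)]
  · have : 0 < (∑ v, z v) ^ 2 := by positivity
    have : 0 ≤ γ * ((n : ℝ) / 24 * ∑ u, ∑ v, (z u - z v) ^ 2) := by positivity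
    linarith

theorem isUnit_det_gram : IsUnit (gram θ γ (odds w)).det := by
  rw [← Matrix.isUnit_iff_isUnit_det, ← Matrix.mulVec_injective_iff_isUnit]
  intro a b hab
  by_contra hne
  have h : a - b ≠ 0 := sub_ne_zero.2 hne
  have := gram_pos hθ h0 h1 w h
  rw [Matrix.mulVec_sub, show gram θ γ (odds w) *ᵥ a = gram θ γ (odds w) *ᵥ b from hab, sub_self, dotProduct_zero] at this
  exact lt_irrefl _ this

theorem gram_mulVec_inv (z : Fin n → ℝ) :
    gram θ γ (odds w) *ᵥ ((gram θ γ (odds w))⁻¹ *ᵥ z) = z := by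
  rw [Matrix.mulVec_mulVec, Matrix.mul_nonsing_inv _ (isUnit_det_gram hθ h0 h1 w),
    Matrix.one_mulVec]

theorem sum_gram_inv_mulVec {z : Fin n → ℝ} (hz : ∑ v, z v = 0) :
    ∑ v, ((gram θ γ (odds w))⁻¹ *ᵥ z) v = 0 := by
  have := sum_gram_mulVec θ γ (odds w) ((gram θ γ (odds w))⁻¹ *ᵥ z)
  rw [gram_mulVec_inv hθ h0 h1, hz] at this
  rcases mul_eq_zero.1 this.symm with h | h
  · have : n = 0 := by exact_mod_cast h
    subst this
    simp
  · exact h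

theorem gram_mulVec_estimate (σ : Equiv.Perm (Fin n)) :
    gram θ γ (odds w) *ᵥ estimate θ γ (odds w) σ = centered θ γ (odds w) σ :=
  gram_mulVec_inv hθ h0 h1 w _

theorem sum_estimate (σ : Equiv.Perm (Fin n)) : ∑ v, estimate θ γ (odds w) σ v = 0 :=
  sum_gram_inv_mulVec hθ h0 h1 w (sum_centered _ _ _ _)

/-- The observed loss is the centered vector applied to `s`, plus a constant. For `θ = 1` the
constant is multiplied by a variable of mean zero; for `θ = 0` it vanishes because `m = 0`. What
remains is `s' G G⁻¹ z`, where the all-ones correction drops out because `G⁻¹ z` has zero sum. -/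
theorem expect_loss_mul_estimate (s z : Fin n → ℝ) (hz : ∑ v, z v = 0) (m : ℝ)
    (hm : θ = 1 ∨ m = 0) :
    expect (mixture γ w) (fun σ => (symVec σ ⬝ᵥ s + m) * (z ⬝ᵥ estimate θ γ (odds w) σ)) =
      z ⬝ᵥ s := by
  set y := (gram θ γ (odds w))⁻¹ *ᵥ z with hy
  have hy0 : ∑ v, y v = 0 := sum_gram_inv_mulVec hθ h0 h1 w hz
  have e : ∀ σ, (symVec σ ⬝ᵥ s + m) * (z ⬝ᵥ estimate θ γ (odds w) σ) =
      (centered θ γ (odds w) σ ⬝ᵥ s) * (centered θ γ (odds w) σ ⬝ᵥ y) +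
        (θ * (1 - γ) * (meanVec (odds w) ⬝ᵥ s) + m) * (centered θ γ (odds w) σ ⬝ᵥ y) := by
    intro σ
    rw [dotProduct_estimate, centered_dotProduct _ _ _ s]
    ring
  simp_rw [e, expect_add, expect_const_mul, expect_centered_mul hθ h0 h1, hy0,
    centered_dotProduct, expect_sub, expect_const, expect_mixture_linear h0.le h1]
  rw [hy, gram_mulVec_inv hθ h0 h1, dotProduct_comm s]
  rcases hθ with rfl | rfl
  · rcases hm with h | rfl
    · norm_num at h
    · ring
  · ring

/-- The form equals `c' G⁻¹ c` for the centered vector `c`, and `E[c c'] = G - 11'`. Its expectation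
is `tr (G⁻¹ (G - 11')) = n - 1' G⁻¹ 1`. -/
theorem expect_estimate_form :
    expect (mixture γ w) (fun σ => estimate θ γ (odds w) σ ⬝ᵥ
      gram θ γ (odds w) *ᵥ estimate θ γ (odds w) σ) ≤ n := by
  set H := (gram θ γ (odds w))⁻¹ with hH
  have e : ∀ σ, estimate θ γ (odds w) σ ⬝ᵥ gram θ γ (odds w) *ᵥ estimate θ γ (odds w) σ =
      ∑ i, (centered θ γ (odds w) σ ⬝ᵥ (Pi.single i 1)) *
        (centered θ γ (odds w) σ ⬝ᵥ fun j => H i j) := by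
    intro σ
    rw [gram_mulVec_estimate hθ h0 h1, dotProduct_comm]
    simp only [dotProduct_single, mul_one]
    simp only [dotProduct, estimate, Matrix.mulVec]
    refine Finset.sum_congr rfl fun i _ => ?_
    congr 1
    exact Finset.sum_congr rfl fun j _ => mul_comm _ _
  simp_rw [e, expect_sum, expect_centered_mul hθ h0 h1, Finset.sum_sub_distrib]
  have t1 : ∑ i, (Pi.single i 1 : Fin n → ℝ) ⬝ᵥ gram θ γ (odds w) *ᵥ (fun j => H i j) = n := by
    have : ∀ i, (Pi.single i 1 : Fin n → ℝ) ⬝ᵥ gram θ γ (odds w) *ᵥ (fun j => H i j) =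
        (H * gram θ γ (odds w)) i i := by
      intro i
      rw [single_one_dotProduct, Matrix.mul_apply, Matrix.mulVec, dotProduct]
      refine Finset.sum_congr rfl fun j _ => ?_
      rw [mul_comm, ← Matrix.transpose_apply (gram θ γ (odds w)) j i, gram_transpose]
    simp_rw [this, hH, Matrix.nonsing_inv_mul _ (isUnit_det_gram hθ h0 h1 w), Matrix.one_apply_eq]
    simp
  -- This is `1' G⁻¹ 1 = y' G y` for `y = G⁻¹ 1`.
  have t2 : 0 ≤ ∑ i, (∑ v, (Pi.single i 1 : Fin n → ℝ) v) * ∑ v, H i v := by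
    simp only [Finset.sum_pi_single', Finset.mem_univ, if_true, one_mul]
    set y := H *ᵥ fun _ => (1 : ℝ) with hy
    have k1 : ∑ i, ∑ v, H i v = y ⬝ᵥ gram θ γ (odds w) *ᵥ y := by
      rw [hy, hH, gram_mulVec_inv hθ h0 h1]
      simp [dotProduct, Matrix.mulVec]
    rw [k1]
    by_cases hz : y = 0
    · simp [hz]
    · exact (gram_pos hθ h0 h1 w hz).le
  linarith

theorem abs_centered_le (σ : Equiv.Perm (Fin n)) (v : Fin n) :
    |centered θ γ (odds w) σ v| ≤ n := by
  have a1 := abs_symVec_le σ v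
  have a2 := abs_meanVec_le w v
  have a3 : |θ * (1 - γ) * meanVec (odds w) v| ≤ |meanVec (odds w) v| := by
    rw [abs_mul]
    refine mul_le_of_le_one_left (abs_nonneg _) ?_
    rw [abs_le]
    rcases hθ with rfl | rfl <;> constructor <;> linarith
  rw [centered]
  linarith [abs_sub (symVec σ v) (θ * (1 - γ) * meanVec (odds w) v)]

/-- With `N = |y|²`, exploration gives `γ n² N / 12 ≤ y'G y = y'c`, and Cauchy–Schwarz gives `(y'c)²
≤ N n³`. So `γ² n N ≤ 144`, and squared differences are at most `2N ≤ 288 / γ²`. The constant `18² =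
324` rounds this up, and the factor `n` is generous. -/
theorem estimate_sub_sq_le (σ : Equiv.Perm (Fin n)) (u v : Fin n) :
    (estimate θ γ (odds w) σ u - estimate θ γ (odds w) σ v) ^ 2 ≤ (18 * n / γ) ^ 2 := by
  have hn : (1 : ℝ) ≤ n := by exact_mod_cast u.pos
  set y := estimate θ γ (odds w) σ with hy
  set N := ∑ v, y v ^ 2 with hN
  have hsum : ∑ v, y v = 0 := sum_estimate hθ h0 h1 w σ
  have b1 : 0 ≤ (1 - γ) * oddsVar (odds w) y :=
    mul_nonneg (by linarith) (oddsVar_nonneg (odds_pos w) y)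
  have low := gram_form_lower hθ h0 h1 w y
  rw [gram_mulVec_estimate hθ h0 h1, sum_sub_sq, hsum, ← hN] at low
  have hN0 : 0 ≤ N := Finset.sum_nonneg fun _ _ => sq_nonneg _
  have cs : (y ⬝ᵥ centered θ γ (odds w) σ) ^ 2 ≤ N * (n * n ^ 2) := by
    refine (Finset.sum_mul_sq_le_sq_mul_sq _ _ _).trans ?_
    refine mul_le_mul_of_nonneg_left ?_ hN0
    have : ∀ i ∈ Finset.univ, centered θ γ (odds w) σ i ^ 2 ≤ (n : ℝ) ^ 2 := fun i _ =>
      sq_le_sq.2 ((abs_centered_le hθ h0 h1 w σ i).trans (le_abs_self _))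
    simpa using Finset.sum_le_sum this
  have low2 : γ * (n ^ 2 / 12 * N) ≤ y ⬝ᵥ centered θ γ (odds w) σ := by nlinarith
  have k0 : 0 ≤ γ * (n ^ 2 / 12 * N) := by positivity
  have k1 : (γ * (n ^ 2 / 12 * N)) ^ 2 ≤ N * (n * n ^ 2) :=
    (pow_le_pow_left₀ k0 low2 2).trans cs
  have k2 : N * (γ ^ 2 * n) ≤ 144 := by
    rcases hN0.eq_or_lt with h | h
    · rw [← h]
      norm_num
    · have hp : 0 < N * n ^ 3 := by positivity
      have : (N * (γ ^ 2 * n)) * (N * n ^ 3) ≤ 144 * (N * n ^ 3) := by nlinarith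
      exact le_of_mul_le_mul_right this hp
  have k3 : (y u - y v) ^ 2 ≤ 2 * N := by
    have : y u ^ 2 + y v ^ 2 ≤ 2 * N ∧ (u ≠ v → y u ^ 2 + y v ^ 2 ≤ N) := by
      have e1 : ∀ i, y i ^ 2 ≤ N := fun i =>
        Finset.single_le_sum (f := fun i => y i ^ 2) (fun _ _ => sq_nonneg _) (Finset.mem_univ i)
      refine ⟨by linarith [e1 u, e1 v], fun huv => ?_⟩
      rw [hN, ← Finset.sum_pair (f := fun i => y i ^ 2) huv]
      exact Finset.sum_le_sum_of_subset_of_nonneg (Finset.subset_univ _) fun _ _ _ => sq_nonneg _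
    by_cases huv : u = v
    · rw [huv]
      simpa using hN0
    · nlinarith [this.2 huv, sq_nonneg (y u + y v)]
  rw [div_pow, le_div_iff₀ (by positivity)]
  have : N * γ ^ 2 ≤ 144 := by
    refine le_trans ?_ k2
    rw [← mul_assoc]
    exact le_mul_of_one_le_right (by positivity) hn
  nlinarith [mul_le_mul_of_nonneg_right k3 (sq_nonneg γ)]

end Estimator

/-! ### The pseudo-inverse in terms of the Gram matrix -/

theorem secondMoment_form {n : ℕ} (D : PMF (Equiv.Perm (Fin n))) (u v : Fin n) :
    secondMoment D u v = expect D fun σ => symVec σ u * symVec σ v := by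
  simp [secondMoment, Matrix.sum_apply, expect, Matrix.vecMulVec_apply]

theorem secondMoment_mixture {n : ℕ} {γ : ℝ} (h0 : 0 < γ) (h1 : γ ≤ 1) (w : Fin n → ℝ)
    (u v : Fin n) : secondMoment (mixture γ w) u v = gram 0 γ (odds w) u v - 1 := by
  have := expect_centered_mul (Or.inl rfl : (0 : ℝ) = 0 ∨ (0 : ℝ) = 1) h0 h1 w
    (Pi.single u 1) (Pi.single v 1)
  simp only [dotProduct_single, mul_one, centered, zero_mul, sub_zero, Finset.sum_pi_single',
    Finset.mem_univ, if_true, single_one_dotProduct, Matrix.mulVec_single_one] at this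
  rw [secondMoment_form]
  simpa using this

theorem isPseudoInverse_pinv {n : ℕ} {A : Matrix (Fin n) (Fin n) ℝ} (hA : A.IsHermitian) :
    IsPseudoInverse A (pinv A) := by
  rw [pinv, dif_pos (exists_isPseudoInverse hA)]
  exact (exists_isPseudoInverse hA).choose_spec

/-- The second moment is `P = G - 11'`, which agrees with `G` on zero-sum vectors and kills the
constants. The zero-sum solution of `P y = σ̂` is unique, and `P⁺σ̂` is one: `P⁺P` is symmetric and
kills the constants, so its range has zero sum. -/
theorem pinv_mulVec_symVec {n : ℕ} {γ : ℝ} (h0 : 0 < γ) (h1 : γ ≤ 1) (w : Fin n → ℝ)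
    (σ : Equiv.Perm (Fin n)) :
    pinv (secondMoment (mixture γ w)) *ᵥ symVec σ = estimate 0 γ (odds w) σ := by
  have hθ : (0 : ℝ) = 0 ∨ (0 : ℝ) = 1 := Or.inl rfl
  set P := secondMoment (mixture γ w) with hP
  set y := estimate 0 γ (odds w) σ with hy
  have hPe : ∀ u v, P u v = gram 0 γ (odds w) u v - 1 := secondMoment_mixture h0 h1 w
  have hPt : Pᵀ = P := by
    ext u v
    rw [Matrix.transpose_apply, hPe, hPe, ← Matrix.transpose_apply (gram _ _ _), gram_transpose]
  have hPv : ∀ z, P *ᵥ z = gram 0 γ (odds w) *ᵥ z - fun _ => ∑ v, z v := by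
    intro z
    ext u
    simp [Matrix.mulVec, dotProduct, hPe, sub_mul, Finset.sum_sub_distrib]
  have hP1 : P *ᵥ (fun _ => 1) = 0 := by
    rw [hPv, gram_mulVec_one]
    ext
    simp
  have hker : ∀ z, P *ᵥ z = 0 → ∑ v, z v = 0 → z = 0 := by
    intro z hz hs
    by_contra hne
    have := gram_pos hθ h0 h1 w hne
    rw [hPv, hs, sub_eq_zero] at hz
    rw [hz] at this
    simp [dotProduct] at this
  have hy0 : ∑ v, y v = 0 := sum_estimate hθ h0 h1 w σ
  have hPy : P *ᵥ y = symVec σ := by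
    rw [hPv, hy0, gram_mulVec_estimate hθ h0 h1]
    ext v
    simp [centered]
  have hZ := isPseudoInverse_pinv (A := P) (by
    rw [Matrix.IsHermitian, Matrix.conjTranspose_eq_transpose_of_trivial, hPt])
  set Z := pinv P with hZdef
  rw [← sub_eq_zero, ← hPy]
  apply hker
  · rw [Matrix.mulVec_sub, Matrix.mulVec_mulVec, Matrix.mulVec_mulVec,
      hZ.mul_mul_left, sub_self]
  · simp only [Pi.sub_apply, Finset.sum_sub_distrib, hy0, sub_zero]
    have : (fun _ => (1 : ℝ)) ⬝ᵥ ((Z * P) *ᵥ y) = 0 := by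
      rw [Matrix.dotProduct_mulVec, ← Matrix.mulVec_transpose, hZ.symm_right,
        ← Matrix.mulVec_mulVec, hP1]
      simp
    rw [Matrix.mulVec_mulVec]
    simpa [dotProduct] using this

/-! ### The potential of the pairwise comparisons -/

/-- The potential whose negative gradient is the mean position vector. -/
def potential {n : ℕ} (w : Fin n → ℝ) : ℝ :=
  1 / 2 * ∑ u, ∑ v, (Real.log (odds w u + odds w v) - (w u + w v) / 2)

/-- Factor out `(X + Y) exp b`, then use `log t ≤ t - 1` and `exp D ≤ 1 + D + D²` for `|D| ≤ 1`. -/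
theorem log_add_exp_le_of_abs_le {X Y a b : ℝ} (hX : 0 < X) (hY : 0 < Y) (h : |a - b| ≤ 1) :
    Real.log (X * Real.exp a + Y * Real.exp b) ≤
      Real.log (X + Y) + b + X / (X + Y) * (a - b) + X / (X + Y) * (a - b) ^ 2 := by
  have hXY : 0 < X + Y := add_pos hX hY
  have e1 : X * Real.exp a + Y * Real.exp b =
      (X + Y) * (Real.exp b * ((X * Real.exp (a - b) + Y) / (X + Y))) := by
    rw [Real.exp_sub]
    have := (Real.exp_pos b).ne'
    field_simp
  have hpos : 0 < (X * Real.exp (a - b) + Y) / (X + Y) := by positivity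
  rw [e1, Real.log_mul hXY.ne' (by positivity), Real.log_mul (Real.exp_pos b).ne' hpos.ne',
    Real.log_exp]
  have l1 := Real.log_le_sub_one_of_pos hpos
  have l2 : (X * Real.exp (a - b) + Y) / (X + Y) - 1 = X / (X + Y) * (Real.exp (a - b) - 1) := by
    field_simp
    ring
  have l3 := (abs_le.1 (Real.abs_exp_sub_one_sub_id_le h)).2
  have l4 : X / (X + Y) * (Real.exp (a - b) - 1) ≤ X / (X + Y) * ((a - b) + (a - b) ^ 2) :=
    mul_le_mul_of_nonneg_left (by linarith) (by positivity)
  linarith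

/-- The previous bound has the quadratic coefficient `p = X / (X + Y)`, or `q = 1 - p` after
exchanging the roles. The smaller of the two is at most `2pq`, which brings in the variance of the
comparison. -/
theorem log_add_exp_le {X Y a b : ℝ} (hX : 0 < X) (hY : 0 < Y) (h : |a - b| ≤ 1) :
    Real.log (X * Real.exp a + Y * Real.exp b) - (a + b) / 2 ≤
      Real.log (X + Y) - 1 / 2 * ((a - b) * ((Y - X) / (X + Y))) +
        2 * (X * Y / (X + Y) ^ 2 * (a - b) ^ 2) := by
  have hXY : 0 < X + Y := add_pos hX hY
  have h1 := log_add_exp_le_of_abs_le hX hY h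
  have h2 := log_add_exp_le_of_abs_le hY hX (abs_sub_comm a b ▸ h)
  rw [add_comm (Y * _), add_comm Y X] at h2
  have e1 : X / (X + Y) = 1 - Y / (X + Y) := by
    field_simp
    ring
  have e2 : (Y - X) / (X + Y) = Y / (X + Y) - X / (X + Y) := sub_div _ _ _
  have e3 : X * Y / (X + Y) ^ 2 = X / (X + Y) * (Y / (X + Y)) := by
    field_simp
  have hp : 0 ≤ X / (X + Y) := by positivity
  have hq : 0 ≤ Y / (X + Y) := by positivity
  rw [e2, e3]
  generalize X / (X + Y) = p at *
  generalize Y / (X + Y) = q at *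
  have hD := sq_nonneg (a - b)
  subst e1
  rcases le_total q (1 / 2) with hq2 | hq2
  · have : q * (a - b) ^ 2 ≤ 2 * ((1 - q) * q * (a - b) ^ 2) := by
      have : 0 ≤ q * (1 - 2 * q) * (a - b) ^ 2 :=
        mul_nonneg (mul_nonneg hq (by linarith)) hD
      linarith
    nlinarith
  · have : (1 - q) * (a - b) ^ 2 ≤ 2 * ((1 - q) * q * (a - b) ^ 2) := by
      have : 0 ≤ (1 - q) * (2 * q - 1) * (a - b) ^ 2 :=
        mul_nonneg (mul_nonneg hp (by linarith)) hD
      linarith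
    nlinarith

/-- A second-order expansion whose error is measured by the Hessian at `w` alone rather than along
the segment; the spread of at most 1 makes this possible. -/
theorem potential_add_le {n : ℕ} (w δ : Fin n → ℝ) (h : ∀ u v, |δ u - δ v| ≤ 1) :
    potential (w + δ) ≤ potential w - meanVec (odds w) ⬝ᵥ δ +
      2 * (1 / 2 * ∑ u, ∑ v, pairVar (odds w) δ u v) := by
  have key : ∀ u v, Real.log (odds (w + δ) u + odds (w + δ) v) - ((w + δ) u + (w + δ) v) / 2 ≤
      (Real.log (odds w u + odds w v) - (w u + w v) / 2) -
        1 / 2 * ((δ u - δ v) * ((odds w v - odds w u) / (odds w u + odds w v))) +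
        2 * pairVar (odds w) δ u v := by
    intro u v
    have := log_add_exp_le (odds_pos w u) (odds_pos w v) (h u v)
    simp only [odds, Pi.add_apply, Real.exp_add, pairVar] at *
    linarith
  have hsum := Finset.sum_le_sum fun u (_ : u ∈ Finset.univ) =>
    Finset.sum_le_sum fun v (_ : v ∈ Finset.univ) => key u v
  simp only [Finset.sum_add_distrib, Finset.sum_sub_distrib, ← Finset.mul_sum] at hsum
  rw [← oddsMean_eq, oddsMean, potential, potential]
  simp only [Finset.sum_sub_distrib]
  linarith

theorem potential_zero_le (n : ℕ) : potential (0 : Fin n → ℝ) ≤ n ^ 2 / 2 := by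
  have : Real.log (1 + 1) ≤ 1 := by
    have := Real.log_le_sub_one_of_pos (show (0 : ℝ) < 1 + 1 by norm_num)
    linarith
  simp only [potential, odds, Pi.zero_apply, Real.exp_zero, add_zero, zero_div, sub_zero,
    Finset.sum_const, Finset.card_univ, Fintype.card_fin, nsmul_eq_mul]
  generalize Real.log (1 + 1) = L at *
  nlinarith [mul_le_mul_of_nonneg_left this (sq_nonneg (n : ℝ))]

theorem sum_sign_eq {n : ℕ} (π : Equiv.Perm (Fin n)) (u : Fin n) :
    ∑ v, ((if π v < π u then (1 : ℝ) else 0) - (if π u < π v then 1 else 0)) = 2 * symVec π u := by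
  have h : ∑ v, ((if π v < π u then (1 : ℝ) else 0) - (if π u < π v then 1 else 0)) =
      ∑ j, ((if j < π u then (1 : ℝ) else 0) - (if π u < j then 1 else 0)) :=
    Fintype.sum_equiv π _ _ fun v => rfl
  rw [h, Finset.sum_sub_distrib, Finset.sum_boole, Finset.sum_boole]
  have c1 : (Finset.univ.filter fun j => j < π u) = Finset.Iio (π u) := by ext; simp
  have c2 : (Finset.univ.filter fun j => π u < j) = Finset.Ioi (π u) := by ext; simp
  rw [c1, c2, Fin.card_Iio, Fin.card_Ioi, symVec, Nat.sub_sub, Nat.cast_sub (by omega)]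
  push_cast
  ring

/-- Writing `π̂` as half a sum of comparison signs splits the expression over pairs. Each term is
nonnegative since `log (exp a + exp b) ≥ max a b`. -/
theorem potential_add_symVec_dotProduct_nonneg {n : ℕ} (π : Equiv.Perm (Fin n)) (w : Fin n → ℝ) :
    0 ≤ potential w + symVec π ⬝ᵥ w := by
  set g : Fin n → Fin n → ℝ := fun u v =>
    (if π v < π u then (1 : ℝ) else 0) - (if π u < π v then 1 else 0) with hg
  have hanti : ∀ u v, g v u = -g u v := fun u v => by simp [hg]
  have e : symVec π ⬝ᵥ w = 1 / 2 * ∑ u, ∑ v, 1 / 2 * (g u v * (w u - w v)) := by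
    have e1 : ∀ u, ∑ v, g u v = 2 * symVec π u := sum_sign_eq π
    have e2 : ∑ u, ∑ v, g u v * w v = -∑ u, ∑ v, g u v * w u := by
      rw [Finset.sum_comm, ← Finset.sum_neg_distrib]
      refine Finset.sum_congr rfl fun u _ => ?_
      rw [← Finset.sum_neg_distrib]
      exact Finset.sum_congr rfl fun v _ => by rw [hanti, neg_mul]
    simp_rw [← Finset.mul_sum, mul_sub, Finset.sum_sub_distrib, e2, ← Finset.sum_mul, e1,
      mul_assoc, ← Finset.mul_sum]
    rw [dotProduct]
    ring
  rw [e, potential, ← mul_add, ← Finset.sum_add_distrib]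
  refine mul_nonneg (by norm_num) (Finset.sum_nonneg fun u _ => ?_)
  rw [← Finset.sum_add_distrib]
  refine Finset.sum_nonneg fun v _ => ?_
  have l1 : w u ≤ Real.log (odds w u + odds w v) :=
    (Real.le_log_iff_exp_le (add_pos (odds_pos w u) (odds_pos w v))).2
      (le_add_of_nonneg_right (odds_pos w v).le)
  have l2 : w v ≤ Real.log (odds w u + odds w v) :=
    (Real.le_log_iff_exp_le (add_pos (odds_pos w u) (odds_pos w v))).2
      (le_add_of_nonneg_left (odds_pos w u).le)
  simp only [hg]
  split_ifs <;> linarith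

/-! ### The player with a centered estimator -/

/-- The generalization of `banditRank` whose estimator is based on the vectors `σ̂ - θ E[σ̂]`. -/
def estPlayer (θ : ℝ) (n : ℕ) (γ η : ℝ) : Player n where
  Mem := Fin n → ℝ
  start := 0
  act w := (mixture γ w).map fun π => (π, w)
  learn w π ℓ := PMF.pure (w + η • (ℓ • estimate θ γ (odds w) π))

theorem banditRank_eq_estPlayer (n : ℕ) {γ : ℝ} (η : ℝ) (h0 : 0 < γ) (h1 : γ ≤ 1) :
    banditRank n γ η = estPlayer 0 n γ η := by
  unfold banditRank estPlayer
  congr 1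
  funext w π ℓ
  rw [pinv_mulVec_symVec h0 h1]

/-- The weights after a given history. -/
def historyWeights {n : ℕ} (θ γ η : ℝ) (x : Equiv.Perm (Fin n) → Fin n → ℝ) (s : ℕ → Fin n → ℝ) :
    (T : ℕ) → (Fin T → Equiv.Perm (Fin n)) → Fin n → ℝ
  | 0, _ => 0
  | T + 1, h =>
    historyWeights θ γ η x s T (Fin.init h) + η • ((x (h (Fin.last T)) ⬝ᵥ s T) •
      estimate θ γ (odds (historyWeights θ γ η x s T (Fin.init h))) (h (Fin.last T)))

section History

variable {n : ℕ} (θ γ η : ℝ) (x : Equiv.Perm (Fin n) → Fin n → ℝ) (s : ℕ → Fin n → ℝ)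

theorem historyWeights_snoc (T : ℕ) (h : Fin T → Equiv.Perm (Fin n)) (π : Equiv.Perm (Fin n)) :
    historyWeights θ γ η x s (T + 1) (Fin.snoc (α := fun _ => Equiv.Perm (Fin n)) h π) =
      historyWeights θ γ η x s T h + η • ((x π ⬝ᵥ s T) •
        estimate θ γ (odds (historyWeights θ γ η x s T h)) π) := by
  rw [historyWeights, Fin.init_snoc, Fin.snoc_last]

/-- The weights are a function of the past rankings, so expectations can be taken over the finite
type of histories although the memory is continuous. -/
theorem estPlayer_run (T : ℕ) :
    (estPlayer θ n γ η).run x s T =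
      ((estPlayer θ n γ η).plays x s T).map fun h => (historyWeights θ γ η x s T h, h) := by
  induction T with
  | zero => simp [Player.plays, Player.run, PMF.pure_map, historyWeights, estPlayer]
  | succ T ih =>
    rw [Player.plays, PMF.map_comp]
    conv_rhs => rw [Player.run]
    rw [Player.run, ih]
    simp only [estPlayer, PMF.bind_map, PMF.map_bind, PMF.pure_map, Function.comp_def,
      historyWeights_snoc]

theorem expect_plays_succ (T : ℕ) (f : (Fin (T + 1) → Equiv.Perm (Fin n)) → ℝ) :
    expect ((estPlayer θ n γ η).plays x s (T + 1)) f =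
      expect ((estPlayer θ n γ η).plays x s T) fun h =>
        expect (mixture γ (historyWeights θ γ η x s T h)) fun π =>
          f (Fin.snoc (α := fun _ => Equiv.Perm (Fin n)) h π) := by
  have : (estPlayer θ n γ η).plays x s (T + 1) =
      ((estPlayer θ n γ η).plays x s T).bind fun h =>
        (mixture γ (historyWeights θ γ η x s T h)).map fun π =>
          Fin.snoc (α := fun _ => Equiv.Perm (Fin n)) h π := by
    rw [Player.plays, Player.run, estPlayer_run]
    simp only [estPlayer, PMF.bind_map, PMF.map_bind, PMF.pure_map, Function.comp_def]
    rfl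
  rw [this, expect_bind]
  simp_rw [expect_map]

end History

/-! ### Regret bounds from the potential -/

theorem pairVar_smul {n : ℕ} (x : Fin n → ℝ) (k : ℝ) (y : Fin n → ℝ) (u v : Fin n) :
    pairVar x (k • y) u v = k ^ 2 * pairVar x y u v := by
  simp only [pairVar, Pi.smul_apply, smul_eq_mul]
  ring

/-- One step of the regret analysis. -/
theorem expect_potential_step_le {n : ℕ} {θ γ η : ℝ} (hθ : θ = 0 ∨ θ = 1) (hn : 1 ≤ n) (h0 : 0 < γ)
    (h1 : γ ≤ 1 / 2) (hη : 0 < η) (hηγ : η ≤ 1 / 18 * (γ / n)) (w s : Fin n → ℝ)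
    (x : Equiv.Perm (Fin n) → Fin n → ℝ) (m : ℝ) (hm : θ = 1 ∨ m = 0)
    (hx : ∀ π, x π ⬝ᵥ s = symVec π ⬝ᵥ s + m) (hx1 : ∀ π, |x π ⬝ᵥ s| ≤ 1)
    (hs1 : ∀ π : Equiv.Perm (Fin n), |symVec π ⬝ᵥ s| ≤ 1) (ρ : Equiv.Perm (Fin n)) :
    expect (mixture γ w) (fun π => η * (x π ⬝ᵥ s - x ρ ⬝ᵥ s) +
        (potential (w + η • ((x π ⬝ᵥ s) • estimate θ γ (odds w) π)) +
          symVec ρ ⬝ᵥ (w + η • ((x π ⬝ᵥ s) • estimate θ γ (odds w) π)))) ≤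
      potential w + symVec ρ ⬝ᵥ w + η * (γ + 4 * η * n) := by
  have h1' : γ ≤ 1 := by linarith
  have hn0 : (0 : ℝ) < n := by exact_mod_cast hn
  set y := estimate θ γ (odds w) with hy
  -- The Gram form contains `(1 - γ)` times the Plackett–Luce variance, and `1 - γ ≥ 1/2` accounts
  -- for the factor 2.
  have hVar : ∀ π, 1 / 2 * ∑ u, ∑ v, pairVar (odds w) (y π) u v ≤
      2 * (y π ⬝ᵥ gram θ γ (odds w) *ᵥ y π) := by
    intro π
    refine (sum_pairVar_le (odds_pos w) _).trans ?_
    have l1 := gram_form_lower hθ h0 h1' w (y π)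
    have l2 : 0 ≤ γ * ((n : ℝ) / 24 * ∑ u, ∑ v, (y π u - y π v) ^ 2) :=
      mul_nonneg h0.le (mul_nonneg (by positivity)
        (Finset.sum_nonneg fun _ _ => Finset.sum_nonneg fun _ _ => sq_nonneg _))
    have l3 := oddsVar_nonneg (odds_pos w) (y π)
    nlinarith [sq_nonneg (∑ v, y π v)]
  have hbound : ∀ π, η * (x π ⬝ᵥ s - x ρ ⬝ᵥ s) + (potential (w + η • ((x π ⬝ᵥ s) • y π)) +
        symVec ρ ⬝ᵥ (w + η • ((x π ⬝ᵥ s) • y π))) ≤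
      η * (symVec π ⬝ᵥ s) + (potential w + symVec ρ ⬝ᵥ w - η * (symVec ρ ⬝ᵥ s)) -
        η * ((symVec π ⬝ᵥ s + m) * (meanVec (odds w) ⬝ᵥ y π)) +
        η * ((symVec π ⬝ᵥ s + m) * (symVec ρ ⬝ᵥ y π)) +
        4 * η ^ 2 * (y π ⬝ᵥ gram θ γ (odds w) *ᵥ y π) := by
    intro π
    -- The upper bound on `η` is chosen for this: it offsets the range `18 n / γ` of the estimate,
    -- so the expansion of the potential applies.
    have hδ : ∀ u v, |(η • ((x π ⬝ᵥ s) • y π)) u - (η • ((x π ⬝ᵥ s) • y π)) v| ≤ 1 := by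
      intro u v
      have a1 : |y π u - y π v| ≤ 18 * n / γ :=
        abs_le_of_sq_le_sq (estimate_sub_sq_le hθ h0 h1' w π u v) (by positivity)
      simp only [Pi.smul_apply, smul_eq_mul]
      rw [← mul_sub, ← mul_sub, abs_mul, abs_mul, abs_of_pos hη]
      calc η * (|x π ⬝ᵥ s| * |y π u - y π v|) ≤ 1 / 18 * (γ / n) * (1 * (18 * n / γ)) := by
            gcongr
            exact hx1 π
        _ = 1 := by field_simp
    have p1 := potential_add_le w _ hδ
    have p2 : ∑ u, ∑ v, pairVar (odds w) (η • ((x π ⬝ᵥ s) • y π)) u v =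
        (η ^ 2 * (x π ⬝ᵥ s) ^ 2) * ∑ u, ∑ v, pairVar (odds w) (y π) u v := by
      simp_rw [pairVar_smul, Finset.mul_sum, mul_assoc]
    have p3 : (x π ⬝ᵥ s) ^ 2 ≤ 1 := (sq_le_one_iff_abs_le_one _).2 (hx1 π)
    have p4 : 0 ≤ y π ⬝ᵥ gram θ γ (odds w) *ᵥ y π := by
      by_cases hz : y π = 0
      · simp [hz]
      · exact (gram_pos hθ h0 h1' w hz).le
    have p5 : (η ^ 2 * (x π ⬝ᵥ s) ^ 2) * (1 / 2 * ∑ u, ∑ v, pairVar (odds w) (y π) u v) ≤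
        (η ^ 2 * 1) * (2 * (y π ⬝ᵥ gram θ γ (odds w) *ᵥ y π)) :=
      (mul_le_mul_of_nonneg_left (hVar π) (by positivity)).trans
        (mul_le_mul_of_nonneg_right (by gcongr) (by positivity))
    rw [p2] at p1
    simp only [dotProduct_smul, dotProduct_add, smul_eq_mul] at p1 ⊢
    rw [← hx π]
    linarith [hx π, hx ρ, congrArg (fun z => η * z) (hx π), congrArg (fun z => η * z) (hx ρ)]
  refine (expect_mono _ hbound).trans ?_
  simp_rw [expect_add, expect_sub, expect_add, expect_const_mul, expect_const]
  rw [expect_loss_mul_estimate hθ h0 h1' w s _ (sum_meanVec _) m hm,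
    expect_loss_mul_estimate hθ h0 h1' w s _ (sum_symVec ρ) m hm,
    expect_mixture_linear h0.le h1']
  have q1 := expect_estimate_form hθ h0 h1' w
  have q2 : |meanVec (odds w) ⬝ᵥ s| ≤ 1 := by
    rw [← oddsMean_eq, ← expect_plackettLuce]
    exact abs_expect_le _ hs1
  -- The player's mean loss is `(1 - γ) meanVec's`, whereas the potential pays back the whole
  -- `meanVec's`. The difference is the price of exploration.
  have q3 : -(γ * (meanVec (odds w) ⬝ᵥ s)) ≤ γ := by nlinarith [(abs_le.1 q2).1]
  have q4 : 4 * η ^ 2 * expect (mixture γ w) (fun σ => y σ ⬝ᵥ gram θ γ (odds w) *ᵥ y σ) ≤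
      4 * η ^ 2 * n := mul_le_mul_of_nonneg_left q1 (by positivity)
  nlinarith [mul_le_mul_of_nonneg_left q3 hη.le]

/-- Induction telescopes the one-step bound; the term `n ^ 2 / 2` is the initial potential. -/
theorem estPlayer_potential_le {n : ℕ} {θ γ η : ℝ} (hθ : θ = 0 ∨ θ = 1) (hn : 1 ≤ n) (h0 : 0 < γ)
    (h1 : γ ≤ 1 / 2) (hη : 0 < η) (hηγ : η ≤ 1 / 18 * (γ / n)) (s : ℕ → Fin n → ℝ)
    (x : Equiv.Perm (Fin n) → Fin n → ℝ) (T : ℕ)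
    (hx : ∀ t < T, ∃ m : ℝ, (θ = 1 ∨ m = 0) ∧ ∀ π, x π ⬝ᵥ s t = symVec π ⬝ᵥ s t + m)
    (hx1 : ∀ t < T, ∀ π, |x π ⬝ᵥ s t| ≤ 1)
    (hs1 : ∀ t < T, ∀ π : Equiv.Perm (Fin n), |symVec π ⬝ᵥ s t| ≤ 1) (ρ : Equiv.Perm (Fin n)) :
    expect ((estPlayer θ n γ η).plays x s T) (fun h =>
        η * ∑ t : Fin T, (x (h t) ⬝ᵥ s t - x ρ ⬝ᵥ s t) +
        (potential (historyWeights θ γ η x s T h) +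
          symVec ρ ⬝ᵥ historyWeights θ γ η x s T h)) ≤
      n ^ 2 / 2 + η * (T * (γ + 4 * η * n)) := by
  induction T with
  | zero =>
    refine (expect_mono (g := fun _ => (n : ℝ) ^ 2 / 2) _ fun h => ?_).trans ?_
    · simpa [historyWeights] using potential_zero_le n
    · rw [expect_const]
      simp
  | succ T ih =>
    specialize ih (fun t ht => hx t (ht.trans T.lt_succ_self))
      (fun t ht => hx1 t (ht.trans T.lt_succ_self)) (fun t ht => hs1 t (ht.trans T.lt_succ_self))
    rw [expect_plays_succ]
    simp_rw [Fin.sum_univ_castSucc, Fin.snoc_castSucc, Fin.snoc_last, Fin.val_castSucc,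
      Fin.val_last, historyWeights_snoc, mul_add η, add_assoc, expect_add, expect_const]
    obtain ⟨m, hm, hxm⟩ := hx T T.lt_succ_self
    have step := fun h => expect_potential_step_le hθ hn h0 h1 hη hηγ
      (historyWeights θ γ η x s T h) (s T) x m hm hxm (hx1 T T.lt_succ_self)
      (hs1 T T.lt_succ_self) ρ
    simp_rw [expect_add] at step ih
    have := expect_mono ((estPlayer θ n γ η).plays x s T) step
    simp_rw [expect_add, expect_const] at this
    push_cast
    linarith

/-- The final value of `Φ + ρ̂'w` is nonnegative, so it can be dropped for the best ranking `ρ`;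
then divide by `η`. -/
theorem estPlayer_expectedRegret_le {n : ℕ} {θ γ η : ℝ} (hθ : θ = 0 ∨ θ = 1) (hn : 1 ≤ n)
    (h0 : 0 < γ) (h1 : γ ≤ 1 / 2) (hη : 0 < η) (hηγ : η ≤ 1 / 18 * (γ / n)) (s : ℕ → Fin n → ℝ)
    (x : Equiv.Perm (Fin n) → Fin n → ℝ) (T : ℕ)
    (hx : ∀ t < T, ∃ m : ℝ, (θ = 1 ∨ m = 0) ∧ ∀ π, x π ⬝ᵥ s t = symVec π ⬝ᵥ s t + m)
    (hx1 : ∀ t < T, ∀ π, |x π ⬝ᵥ s t| ≤ 1)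
    (hs1 : ∀ t < T, ∀ π : Equiv.Perm (Fin n), |symVec π ⬝ᵥ s t| ≤ 1) :
    (estPlayer θ n γ η).expectedRegret x s T ≤ n ^ 2 / (2 * η) + T * (γ + 4 * η * n) := by
  obtain ⟨ρ, -, hρ⟩ := Finset.exists_mem_eq_inf' (Finset.univ_nonempty (α := Equiv.Perm (Fin n)))
    fun π : Equiv.Perm (Fin n) => ∑ t ∈ Finset.range T, x π ⬝ᵥ s t
  have hbest : bestLoss x s T = ∑ t : Fin T, x ρ ⬝ᵥ s t := by
    rw [bestLoss, hρ, Finset.sum_range]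
  have key := estPlayer_potential_le hθ hn h0 h1 hη hηγ s x T hx hx1 hs1 ρ
  have low : η * (estPlayer θ n γ η).expectedRegret x s T ≤
      expect ((estPlayer θ n γ η).plays x s T) (fun h =>
        η * ∑ t : Fin T, (x (h t) ⬝ᵥ s t - x ρ ⬝ᵥ s t) +
        (potential (historyWeights θ γ η x s T h) +
          symVec ρ ⬝ᵥ historyWeights θ γ η x s T h)) := by
    have : (estPlayer θ n γ η).expectedRegret x s T =
        expect ((estPlayer θ n γ η).plays x s T) (fun h =>
          ∑ t : Fin T, (x (h t) ⬝ᵥ s t - x ρ ⬝ᵥ s t)) := by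
      simp_rw [Finset.sum_sub_distrib, expect_sub, expect_const]
      rw [Player.expectedRegret, hbest]
      rfl
    rw [this, ← expect_const_mul]
    exact expect_mono _ fun h =>
      le_add_of_nonneg_right (potential_add_symVec_dotProduct_nonneg ρ _)
  have := low.trans key
  have e : (n : ℝ) ^ 2 / 2 + η * (T * (γ + 4 * η * n)) =
      η * (n ^ 2 / (2 * η) + T * (γ + 4 * η * n)) := by
    field_simp
  rw [e] at this
  exact le_of_mul_le_mul_left this hη

theorem expectedRegret_le_two_mul {n : ℕ} (A : Player n) (x : Equiv.Perm (Fin n) → Fin n → ℝ)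
    (s : ℕ → Fin n → ℝ) (T : ℕ) (hx1 : ∀ t < T, ∀ π, |x π ⬝ᵥ s t| ≤ 1) :
    A.expectedRegret x s T ≤ 2 * T := by
  have h1 : A.expectedLoss x s T ≤ T := by
    have : ∀ h : Fin T → Equiv.Perm (Fin n), ∑ t : Fin T, x (h t) ⬝ᵥ s t ≤ T := by
      intro h
      have := Finset.sum_le_sum fun (t : Fin T) (_ : t ∈ Finset.univ) =>
        (abs_le.1 (hx1 t t.2 (h t))).2
      simpa using this
    have := expect_mono (A.plays x s T) this
    rwa [expect_const] at this
  have h2 : -(T : ℝ) ≤ bestLoss x s T := by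
    refine Finset.le_inf' _ _ fun π _ => ?_
    have := Finset.sum_le_sum fun t (ht : t ∈ Finset.range T) =>
      (abs_le.1 (hx1 t (Finset.mem_range.1 ht) π)).1
    simpa using this
  rw [Player.expectedRegret]
  linarith

theorem regretBound_of_plays {A : (n : ℕ) → (γ η : ℝ) → Player n}
    {x : (n : ℕ) → Equiv.Perm (Fin n) → Fin n → ℝ} {θ : ℝ} (hθ : θ = 0 ∨ θ = 1)
    (hA : ∀ n, 1 ≤ n → ∀ γ η : ℝ, 0 < γ → γ ≤ 1 → 0 < η → ∀ s T,
      (A n γ η).plays (x n) s T = (estPlayer θ n γ η).plays (x n) s T)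
    (hx : ∀ n s, (∀ π, |x n π ⬝ᵥ s| ≤ 1) → (∀ π, |symVec π ⬝ᵥ s| ≤ 1) ∧
      ∃ m : ℝ, (θ = 1 ∨ m = 0) ∧ ∀ π, x n π ⬝ᵥ s = symVec π ⬝ᵥ s + m) :
    RegretBound A x := by
  -- The summands of the constant serve three regimes: `2` for short horizons, `4 b` for `γ > 1/2`,
  -- and `1 / (2 a d)` together with `2 b` for the potential bound.
  refine ⟨1 / 18, by norm_num, fun a b d ha hb hd =>
    ⟨1 / (2 * a * d) + 4 * b + 2, by positivity, ?_⟩⟩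
  intro n T hn hT γ η hγa hγ1 hγb hηd hηc s hs
  have hn0 : (0 : ℝ) < n := by exact_mod_cast hn
  have hT0 : (0 : ℝ) < T := by exact_mod_cast hT
  set N := (n : ℝ) ^ (3 / 2 : ℝ) with hN
  set R := √(T : ℝ) with hR
  have hN0 : 0 < N := Real.rpow_pos_of_pos hn0 _
  have hR0 : 0 < R := Real.sqrt_pos.2 hT0
  have hRR : R * R = T := Real.mul_self_sqrt hT0.le
  have hNN : N * N = n ^ 3 := by
    rw [hN, ← Real.rpow_add hn0, ← Real.rpow_natCast]
    norm_num
  have hγ0 : 0 < γ := lt_of_lt_of_le (mul_pos ha (lt_min one_pos (by positivity))) hγa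
  have hη0 : 0 < η := lt_of_lt_of_le (by positivity) hηd
  have hNR : 0 < N * R := by positivity
  have had : 0 < 1 / (2 * a * d) := by positivity
  have htriv := expectedRegret_le_two_mul (A n γ η) (x n) s T hs
  have hγb' : γ * R ≤ b * N := by
    rw [mul_div_assoc', le_div_iff₀ hR0] at hγb
    exact hγb
  -- If `√T ≤ n^(3/2)`, the trivial bound `2T` suffices.
  rcases le_or_gt R N with hcase | hcase
  · have : (T : ℝ) ≤ N * R := by rw [← hRR]; gcongr
    nlinarith [mul_pos had hNR, mul_pos hb hNR]
  -- If `γ > 1/2`, the upper bound on `γ` forces `√T ≤ 2 b n^(3/2)`, and `2T` suffices again.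
  rcases lt_or_ge (1 / 2) γ with hcase2 | hcase2
  · have : R ≤ 2 * (b * N) := by nlinarith
    have : (T : ℝ) ≤ 2 * (b * (N * R)) := by rw [← hRR]; nlinarith
    nlinarith [mul_pos had hNR, mul_pos hb hNR]
  have hreg : (A n γ η).expectedRegret (x n) s T = (estPlayer θ n γ η).expectedRegret (x n) s T := by
    rw [Player.expectedRegret, Player.expectedRegret, Player.expectedLoss, Player.expectedLoss,
      hA n hn γ η hγ0 hγ1 hη0]
  have main := estPlayer_expectedRegret_le hθ hn hγ0 hcase2 hη0 hηc s (x n) T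
    (fun t ht => (hx n (s t) (hs t ht)).2) hs (fun t ht => (hx n (s t) (hs t ht)).1)
  rw [hreg]
  refine main.trans ?_
  have hmin : min 1 (N / R) = N / R := min_eq_right ((div_le_one hR0).2 hcase.le)
  rw [hmin, mul_div_assoc', div_le_iff₀ hR0] at hγa
  have b1 : (n : ℝ) ^ 2 / (2 * η) ≤ 1 / (2 * a * d) * (N * R) := by
    have hη' : d * γ ≤ η * n := by
      rw [mul_div_assoc', div_le_iff₀ hn0] at hηd
      exact hηd
    rw [div_mul_eq_mul_div, one_mul, div_le_div_iff₀ (by positivity) (by positivity)]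
    -- The extra factor `n` turns `n²` into `n³ = N * N`.
    have e1 : n * ((n : ℝ) ^ 2 * (2 * a * d)) ≤ n * (N * R * (2 * η)) := by
      calc n * ((n : ℝ) ^ 2 * (2 * a * d)) = 2 * N * d * (a * N) := by
            linear_combination (-2 * a * d) * hNN
        _ ≤ 2 * N * d * (γ * R) := by gcongr
        _ = 2 * N * R * (d * γ) := by ring
        _ ≤ 2 * N * R * (η * n) := by gcongr
        _ = n * (N * R * (2 * η)) := by ring
    exact le_of_mul_le_mul_left e1 hn0
  have b2 : (T : ℝ) * (γ + 4 * η * n) ≤ 2 * b * (N * R) := by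
    have c1 : 4 * η * n ≤ γ := by
      rw [mul_div_assoc', le_div_iff₀ hn0] at hηc
      nlinarith
    calc (T : ℝ) * (γ + 4 * η * n) ≤ T * (γ + γ) := by gcongr
      _ = 2 * (γ * R) * R := by rw [← hRR]; ring
      _ ≤ 2 * (b * N) * R := by gcongr
      _ = 2 * b * (N * R) := by ring
  nlinarith [mul_pos hb hNR]

/-! ### The standard game -/

theorem stdVec_dotProduct {n : ℕ} (π : Equiv.Perm (Fin n)) (s : Fin n → ℝ) :
    stdVec π ⬝ᵥ s = symVec π ⬝ᵥ s + ((n : ℝ) + 1) / 2 * ∑ v, s v := by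
  simp only [dotProduct, stdVec, symVec, Finset.mul_sum]
  rw [← Finset.sum_add_distrib]
  exact Finset.sum_congr rfl fun v _ => by ring

theorem symVec_reverse {n : ℕ} (π : Equiv.Perm (Fin n)) :
    symVec (π.trans Fin.revPerm) = -symVec π := by
  ext v
  simp only [symVec, Equiv.trans_apply, Fin.revPerm_apply, Fin.val_rev, Pi.neg_apply]
  rw [Nat.cast_sub (by omega)]
  push_cast
  ring

/-- Reversing a ranking negates the symmetric part of its loss and keeps the constant part. Half the
difference of the two standard losses is the symmetric loss. -/
theorem abs_symVec_dotProduct_le {n : ℕ} {s : Fin n → ℝ}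
    (h : ∀ π : Equiv.Perm (Fin n), |stdVec π ⬝ᵥ s| ≤ 1) (π : Equiv.Perm (Fin n)) :
    |symVec π ⬝ᵥ s| ≤ 1 := by
  have h1 := abs_le.1 (h π)
  have h2 := abs_le.1 (h (π.trans Fin.revPerm))
  rw [stdVec_dotProduct] at h1 h2
  rw [symVec_reverse, neg_dotProduct] at h2
  rw [abs_le]
  constructor <;> linarith

theorem regretBound_banditRank : RegretBound banditRank fun _ => symVec :=
  regretBound_of_plays (θ := 0) (Or.inl rfl)
    (fun n _ γ η h0 h1 _ s T => by rw [banditRank_eq_estPlayer n η h0 h1])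
    fun _ _ h => ⟨h, 0, Or.inr rfl, fun _ => (add_zero _).symm⟩

theorem regretBound_stdVec_of_plays {A : (n : ℕ) → (γ η : ℝ) → Player n}
    (hA : ∀ n, 1 ≤ n → ∀ γ η : ℝ, 0 < γ → γ ≤ 1 → 0 < η → ∀ s T,
      (A n γ η).plays stdVec s T = (estPlayer 1 n γ η).plays stdVec s T) :
    RegretBound A fun _ => stdVec :=
  regretBound_of_plays (Or.inr rfl) hA fun _ s h =>
    ⟨abs_symVec_dotProduct_le h, _, Or.inl rfl, fun π => stdVec_dotProduct π s⟩

/-! ### Couplings -/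

/-- Two distributions have a coupling that is concentrated on the relation `R`. -/
def Coupled {α β : Type} (R : α → β → Prop) (p : PMF α) (q : PMF β) : Prop :=
  ∃ c : PMF (α × β), c.map Prod.fst = p ∧ c.map Prod.snd = q ∧ ∀ z ∈ c.support, R z.1 z.2

namespace Coupled

variable {α β α' β' : Type} {R : α → β → Prop} {R' : α' → β' → Prop}

theorem pure {a : α} {b : β} (h : R a b) : Coupled R (PMF.pure a) (PMF.pure b) := by
  refine ⟨PMF.pure (a, b), PMF.pure_map _ _, PMF.pure_map _ _, ?_⟩
  intro z hz
  rw [PMF.mem_support_pure_iff] at hz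
  rwa [hz]

theorem of_support {a : α} {q : PMF β} (h : ∀ b ∈ q.support, R a b) :
    Coupled R (PMF.pure a) q := by
  refine ⟨q.map fun b => (a, b), ?_, ?_, ?_⟩
  · rw [PMF.map_comp]
    exact PMF.map_const _ _
  · rw [PMF.map_comp]
    exact PMF.map_id _
  · intro z hz
    obtain ⟨b, hb, rfl⟩ := (PMF.mem_support_map_iff _ _ _).1 hz
    exact h b hb

theorem mono {S : α → β → Prop} {p : PMF α} {q : PMF β} (h : Coupled R p q)
    (hRS : ∀ a b, a ∈ p.support → b ∈ q.support → R a b → S a b) : Coupled S p q := by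
  obtain ⟨c, h1, h2, h3⟩ := h
  refine ⟨c, h1, h2, fun z hz => hRS _ _ ?_ ?_ (h3 z hz)⟩
  · rw [← h1, PMF.mem_support_map_iff]
    exact ⟨z, hz, rfl⟩
  · rw [← h2, PMF.mem_support_map_iff]
    exact ⟨z, hz, rfl⟩

/-- Used to pass from the index of a sampled item back to its number among the remaining items. -/
theorem of_map_left {S : α' → β → Prop} {p : PMF α} {q : PMF β} {f : α → α'}
    (hf : Function.Injective f) (h : Coupled S (p.map f) q) :
    Coupled (fun a b => S (f a) b) p q := by
  obtain ⟨c, h1, h2, h3⟩ := h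
  obtain ⟨a₀, -⟩ := p.support_nonempty
  have : Nonempty α := ⟨a₀⟩
  have hinv : Function.LeftInverse (Function.invFun f) f := Function.leftInverse_invFun hf
  refine ⟨c.map fun z => (Function.invFun f z.1, z.2), ?_, ?_, ?_⟩
  · have : p = (p.map f).map (Function.invFun f) := by
      rw [PMF.map_comp, hinv.comp_eq_id, PMF.map_id]
    rw [this, ← h1, PMF.map_comp, PMF.map_comp]
    rfl
  · rw [← h2, PMF.map_comp]
    rfl
  · intro z hz
    obtain ⟨y, hy, rfl⟩ := (PMF.mem_support_map_iff _ _ _).1 hz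
    have hy1 : y.1 ∈ (p.map f).support := by
      rw [← h1, PMF.mem_support_map_iff]
      exact ⟨y, hy, rfl⟩
    obtain ⟨a, -, ha⟩ := (PMF.mem_support_map_iff _ _ _).1 hy1
    have := h3 y hy
    simp only [← ha, hinv a] at this ⊢
    exact this

theorem bind {p : PMF α} {q : PMF β} {f : α → PMF α'} {g : β → PMF β'} (h : Coupled R p q)
    (hfg : ∀ a b, R a b → Coupled R' (f a) (g b)) : Coupled R' (p.bind f) (q.bind g) := by
  classical
  obtain ⟨c, h1, h2, h3⟩ := h
  choose k k1 k2 k3 using fun a b (hab : R a b) => hfg a b hab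
  -- Off the relation an independent pair is used, only so that both marginals are right everywhere;
  -- the support of `c` never gets there.
  set κ : α × β → PMF (α' × β') := fun z => if hz : R z.1 z.2 then k z.1 z.2 hz else
    (f z.1).bind fun a => (g z.2).map fun b => (a, b) with hκ
  have e1 : ∀ z, (κ z).map Prod.fst = f z.1 := by
    intro z
    by_cases hz : R z.1 z.2
    · simp only [hκ, dif_pos hz, k1]
    · simp only [hκ, dif_neg hz, PMF.map_bind, PMF.map_comp]
      have : ∀ a : α', (g z.2).map (Prod.fst ∘ fun b => (a, b)) = PMF.pure a := fun a =>
        PMF.map_const _ _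
      simp_rw [this, PMF.bind_pure]
  have e2 : ∀ z, (κ z).map Prod.snd = g z.2 := by
    intro z
    by_cases hz : R z.1 z.2
    · simp only [hκ, dif_pos hz, k2]
    · simp only [hκ, dif_neg hz, PMF.map_bind, PMF.map_comp]
      have : ∀ a : α', (g z.2).map (Prod.snd ∘ fun b => (a, b)) = g z.2 := fun a =>
        PMF.map_id _
      simp_rw [this, PMF.bind_const]
  refine ⟨c.bind κ, ?_, ?_, ?_⟩
  · rw [PMF.map_bind]
    simp_rw [e1]
    rw [← h1, PMF.bind_map]
    rfl
  · rw [PMF.map_bind]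
    simp_rw [e2]
    rw [← h2, PMF.bind_map]
    rfl
  · intro z hz
    obtain ⟨y, hy, hzy⟩ := (PMF.mem_support_bind_iff _ _ _).1 hz
    have hR := h3 y hy
    simp only [hκ, dif_pos hR] at hzy
    exact k3 _ _ hR z hzy

theorem map {p : PMF α} {q : PMF β} {f : α → α'} {g : β → β'}
    (h : Coupled (fun a b => R' (f a) (g b)) p q) : Coupled R' (p.map f) (q.map g) :=
  h.bind fun _ _ hab => pure hab

theorem map_left {S : α' → β → Prop} {p : PMF α} {q : PMF β} {f : α → α'}
    (h : Coupled (fun a b => S (f a) b) p q) : Coupled S (p.map f) q := by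
  have := Coupled.map (R' := S) (f := f) (g := id) h
  rwa [PMF.map_id] at this

theorem map_right {S : α → β' → Prop} {p : PMF α} {q : PMF β} {g : β → β'}
    (h : Coupled (fun a b => S a (g b)) p q) : Coupled S p (q.map g) := by
  have := Coupled.map (R' := S) (f := id) (g := g) h
  rwa [PMF.map_id] at this

theorem bind_support {S : α → β' → Prop} {p : PMF α} {q : PMF β} {g : β → PMF β'}
    (h : Coupled R p q) (hg : ∀ a b, R a b → ∀ b' ∈ (g b).support, S a b') :
    Coupled S p (q.bind g) := by
  have := h.bind (R' := S) (f := PMF.pure) (g := g) fun a b hab => of_support (hg a b hab)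
  rwa [PMF.bind_pure] at this

theorem refl (p : PMF α) : Coupled (fun a b => a = b) p p := by
  refine ⟨p.map fun a => (a, a), ?_, ?_, ?_⟩
  · rw [PMF.map_comp]
    exact PMF.map_id _
  · rw [PMF.map_comp]
    exact PMF.map_id _
  · intro z hz
    obtain ⟨b, hb, rfl⟩ := (PMF.mem_support_map_iff _ _ _).1 hz
    rfl

/-- Couplings on which two observables agree yield equal laws; this is how the program is compared
with the player. -/
theorem map_eq {γ : Type} {p : PMF α} {q : PMF β} (f : α → γ) (g : β → γ)
    (h : Coupled (fun a b => f a = g b) p q) : p.map f = q.map g := by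
  obtain ⟨c, rfl, rfl, h3⟩ := h
  rw [PMF.map_comp, PMF.map_comp]
  ext x
  simp only [PMF.map_apply]
  refine tsum_congr fun z => ?_
  by_cases hz : z ∈ c.support
  · have := h3 z hz
    simp only at this
    by_cases hx : x = g z.2 <;> simp [this, hx]
  · rw [PMF.apply_eq_zero_iff _ _ |>.2 hz]
    simp

end Coupled

/-! ### The stores that a command can reach -/

/-- All stores that `c` can reach from `σ` satisfy `Q`. -/
def Ensures (c : Cmd) (σ : Store) (Q : Store → Prop) : Prop :=
  ∀ τ ∈ (c.exec σ).support, Q τ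

theorem Ensures.mono {c : Cmd} {σ : Store} {P Q : Store → Prop} (h : Ensures c σ P)
    (hPQ : ∀ τ, P τ → Q τ) : Ensures c σ Q := fun τ hτ => hPQ τ (h τ hτ)

theorem Ensures.and {c : Cmd} {σ : Store} {P Q : Store → Prop} (h : Ensures c σ P)
    (h' : Ensures c σ Q) : Ensures c σ fun τ => P τ ∧ Q τ := fun τ hτ => ⟨h τ hτ, h' τ hτ⟩

theorem ensures_seq {c₁ c₂ : Cmd} {σ : Store} {Q : Store → Prop}
    (h : Ensures c₁ σ fun τ => Ensures c₂ τ Q) : Ensures (.seq c₁ c₂) σ Q := by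
  intro τ hτ
  rw [Cmd.exec, PMF.mem_support_bind_iff] at hτ
  obtain ⟨ρ, hρ, hτ⟩ := hτ
  exact h ρ hρ τ hτ

theorem ensures_setMem {A : ℕ} {i j : NExp} {e : RExp} {σ : Store} {Q : Store → Prop}
    (h : Q ((σ.setMem A (i.eval σ) (j.eval σ) (e.eval σ)).tick (i.cost + j.cost + e.cost + 1))) :
    Ensures (.setMem A i j e) σ Q := by
  intro τ hτ
  rw [Cmd.exec, PMF.mem_support_pure_iff] at hτ
  rwa [hτ]

theorem iterate_support {r : ℕ} {body : Store → PMF Store} (I : ℕ → Store → Prop) {N : ℕ}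
    {σ : Store} (h0 : I 0 σ)
    (step : ∀ k < N, ∀ τ, I k τ → ∀ τ' ∈ (body ((τ.setReg r k).tick 1)).support, I (k + 1) τ') :
    ∀ τ ∈ (iterate r body N σ).support, I N τ := by
  induction N with
  | zero =>
    intro τ hτ
    rw [iterate, PMF.mem_support_pure_iff] at hτ
    rwa [hτ]
  | succ N ih =>
    intro τ hτ
    rw [iterate, PMF.mem_support_bind_iff] at hτ
    obtain ⟨ρ, hρ, hτ⟩ := hτ
    exact step N N.lt_succ_self ρ (ih (fun k hk => step k (hk.trans N.lt_succ_self)) ρ hρ) τ hτ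

/-- The arrays that a command may change. -/
def Cmd.memWrites : Cmd → List ℕ
  | skip => []
  | setReg _ _ => []
  | setMem A _ _ _ => [A]
  | flip _ _ => []
  | seq c₁ c₂ => c₁.memWrites ++ c₂.memWrites
  | ifNat _ _ c₁ c₂ => c₁.memWrites ++ c₂.memWrites
  | ifReal _ _ c₁ c₂ => c₁.memWrites ++ c₂.memWrites
  | loop _ _ c => c.memWrites

/-- The registers that a command may change. -/
def Cmd.regWrites : Cmd → List ℕ
  | skip => []
  | setReg r _ => [r]
  | setMem _ _ _ _ => []
  | flip r _ => [r]
  | seq c₁ c₂ => c₁.regWrites ++ c₂.regWrites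
  | ifNat _ _ c₁ c₂ => c₁.regWrites ++ c₂.regWrites
  | ifReal _ _ c₁ c₂ => c₁.regWrites ++ c₂.regWrites
  | loop r _ c => r :: c.regWrites

/-- A frame rule: syntactic write sets let every verification step carry over the arrays that it
does not touch. -/
theorem ensures_mem_eq (c : Cmd) (σ : Store) :
    Ensures c σ fun τ => ∀ A ∉ c.memWrites, τ.mem A = σ.mem A := by
  induction c generalizing σ with
  | skip =>
    intro τ hτ
    rw [Cmd.exec, PMF.mem_support_pure_iff] at hτ
    rw [hτ]
    exact fun _ _ => rfl
  | setReg r e =>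
    intro τ hτ
    rw [Cmd.exec, PMF.mem_support_pure_iff] at hτ
    rw [hτ]
    exact fun _ _ => rfl
  | setMem A i j e =>
    refine ensures_setMem fun B hB => ?_
    have : B ≠ A := by simpa [Cmd.memWrites] using hB
    funext i' j'
    simp [Store.setMem, Store.tick, this]
  | flip r p =>
    intro τ hτ
    rw [Cmd.exec, PMF.mem_support_map_iff] at hτ
    obtain ⟨b, -, rfl⟩ := hτ
    exact fun _ _ => rfl
  | seq c₁ c₂ ih₁ ih₂ =>
    refine ensures_seq ((ih₁ σ).mono fun ρ hρ => (ih₂ ρ).mono fun τ hτ A hA => ?_)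
    simp only [Cmd.memWrites, List.mem_append, not_or] at hA
    rw [hτ A hA.2, hρ A hA.1]
  | ifNat e f c₁ c₂ ih₁ ih₂ =>
    intro τ hτ A hA
    simp only [Cmd.memWrites, List.mem_append, not_or] at hA
    rw [Cmd.exec] at hτ
    split_ifs at hτ
    · exact ih₁ _ τ hτ A hA.1
    · exact ih₂ _ τ hτ A hA.2
  | ifReal e f c₁ c₂ ih₁ ih₂ =>
    intro τ hτ A hA
    simp only [Cmd.memWrites, List.mem_append, not_or] at hA
    rw [Cmd.exec] at hτ
    split_ifs at hτ
    · exact ih₁ _ τ hτ A hA.1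
    · exact ih₂ _ τ hτ A hA.2
  | loop r e c ih =>
    intro τ hτ
    rw [Cmd.exec] at hτ
    refine iterate_support (fun _ τ => ∀ A ∉ c.memWrites, τ.mem A = σ.mem A)
      (σ := σ.tick (e.cost + 1)) (fun _ _ => rfl)
      (fun k _ ρ hρ τ' hτ' A hA => ?_) τ hτ
    rw [ih _ τ' hτ' A hA]
    exact hρ A hA

theorem ensures_reg_eq (c : Cmd) (σ : Store) :
    Ensures c σ fun τ => ∀ r ∉ c.regWrites, τ.reg r = σ.reg r := by
  induction c generalizing σ with
  | skip =>
    intro τ hτ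
    rw [Cmd.exec, PMF.mem_support_pure_iff] at hτ
    rw [hτ]
    exact fun _ _ => rfl
  | setReg r e =>
    intro τ hτ s hs
    rw [Cmd.exec, PMF.mem_support_pure_iff] at hτ
    have : s ≠ r := by simpa [Cmd.regWrites] using hs
    rw [hτ]
    exact Function.update_of_ne this _ _
  | setMem A i j e => exact ensures_setMem fun r hr => rfl
  | flip r p =>
    intro τ hτ s hs
    rw [Cmd.exec, PMF.mem_support_map_iff] at hτ
    obtain ⟨b, -, rfl⟩ := hτ
    have : s ≠ r := by simpa [Cmd.regWrites] using hs
    exact Function.update_of_ne this _ _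
  | seq c₁ c₂ ih₁ ih₂ =>
    refine ensures_seq ((ih₁ σ).mono fun ρ hρ => (ih₂ ρ).mono fun τ hτ A hA => ?_)
    simp only [Cmd.regWrites, List.mem_append, not_or] at hA
    rw [hτ A hA.2, hρ A hA.1]
  | ifNat e f c₁ c₂ ih₁ ih₂ =>
    intro τ hτ A hA
    simp only [Cmd.regWrites, List.mem_append, not_or] at hA
    rw [Cmd.exec] at hτ
    split_ifs at hτ
    · exact ih₁ _ τ hτ A hA.1
    · exact ih₂ _ τ hτ A hA.2
  | ifReal e f c₁ c₂ ih₁ ih₂ =>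
    intro τ hτ A hA
    simp only [Cmd.regWrites, List.mem_append, not_or] at hA
    rw [Cmd.exec] at hτ
    split_ifs at hτ
    · exact ih₁ _ τ hτ A hA.1
    · exact ih₂ _ τ hτ A hA.2
  | loop r e c ih =>
    intro τ hτ
    rw [Cmd.exec] at hτ
    refine iterate_support (fun _ τ => ∀ s ∉ (Cmd.loop r e c).regWrites, τ.reg s = σ.reg s)
      (σ := σ.tick (e.cost + 1)) (fun _ _ => rfl) (fun k _ ρ hρ τ' hτ' s hs => ?_) τ hτ
    have hs' := hs
    simp only [Cmd.regWrites, List.mem_cons, not_or] at hs'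
    rw [ih _ τ' hτ' s hs'.2, ← hρ s hs]
    exact Function.update_of_ne hs'.1 _ _

/-! ### Running time -/

/-- The register `0` is never written, and it is the number of passes of every loop. -/
def Cmd.Bounded : Cmd → Prop
  | skip => True
  | setReg r _ => r ≠ 0
  | setMem _ _ _ _ => True
  | flip r _ => r ≠ 0
  | seq c₁ c₂ => c₁.Bounded ∧ c₂.Bounded
  | ifNat _ _ c₁ c₂ => c₁.Bounded ∧ c₂.Bounded
  | ifReal _ _ c₁ c₂ => c₁.Bounded ∧ c₂.Bounded
  | loop r e c => r ≠ 0 ∧ e = .reg 0 ∧ c.Bounded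

/-- The nesting depth of the loops. -/
def Cmd.depth : Cmd → ℕ
  | skip => 0
  | setReg _ _ => 0
  | setMem _ _ _ _ => 0
  | flip _ _ => 0
  | seq c₁ c₂ => max c₁.depth c₂.depth
  | ifNat _ _ c₁ c₂ => max c₁.depth c₂.depth
  | ifReal _ _ c₁ c₂ => max c₁.depth c₂.depth
  | loop _ _ c => c.depth + 1

/-- The number of operations in a command. -/
def Cmd.size : Cmd → ℕ
  | skip => 1
  | setReg _ e => e.cost + 1
  | setMem _ i j e => i.cost + j.cost + e.cost + 1
  | flip _ p => p.cost + 1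
  | seq c₁ c₂ => c₁.size + c₂.size
  | ifNat e f c₁ c₂ => e.cost + f.cost + 1 + c₁.size + c₂.size
  | ifReal e f c₁ c₂ => e.cost + f.cost + 1 + c₁.size + c₂.size
  | loop _ e c => e.cost + 2 + c.size

theorem Cmd.Bounded.zero_notMem_regWrites {c : Cmd} (h : c.Bounded) : 0 ∉ c.regWrites := by
  induction c with
  | skip => simp [regWrites]
  | setReg r e => simpa [regWrites, Bounded, eq_comm] using h
  | setMem A i j e => simp [regWrites]
  | flip r p => simpa [regWrites, Bounded, eq_comm] using h
  | seq c₁ c₂ ih₁ ih₂ => simpa [regWrites] using ⟨ih₁ h.1, ih₂ h.2⟩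
  | ifNat e f c₁ c₂ ih₁ ih₂ => simpa [regWrites] using ⟨ih₁ h.1, ih₂ h.2⟩
  | ifReal e f c₁ c₂ ih₁ ih₂ => simpa [regWrites] using ⟨ih₁ h.1, ih₂ h.2⟩
  | loop r e c ih => simpa [regWrites] using ⟨h.1.symm, ih h.2.2⟩

theorem Cmd.Bounded.reg_zero_eq {c : Cmd} (h : c.Bounded) (σ : Store) :
    Ensures c σ fun τ => τ.reg 0 = σ.reg 0 :=
  (ensures_reg_eq c σ).mono fun _ hτ => hτ 0 h.zero_notMem_regWrites

/-- Every loop has exactly `n` passes, so nesting of depth `k` multiplies the cost by at most `n ^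
k`. Both branches of a conditional are counted in `size`. -/
theorem Cmd.Bounded.clock_le {c : Cmd} (h : c.Bounded) {σ : Store} {n : ℕ} (hn : 1 ≤ n)
    (hσ : σ.reg 0 = n) :
    Ensures c σ fun τ => τ.clock ≤ σ.clock + c.size * n ^ c.depth := by
  induction c generalizing σ with
  | skip =>
    intro τ hτ
    rw [Cmd.exec, PMF.mem_support_pure_iff] at hτ
    simp [hτ, Store.tick, size, depth]
  | setReg r e =>
    intro τ hτ
    rw [Cmd.exec, PMF.mem_support_pure_iff] at hτ
    simp [hτ, Store.tick, Store.setReg, size, depth]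
  | setMem A i j e =>
    refine ensures_setMem ?_
    simp [Store.tick, Store.setMem, size, depth]
  | flip r p =>
    intro τ hτ
    rw [Cmd.exec, PMF.mem_support_map_iff] at hτ
    obtain ⟨b, -, rfl⟩ := hτ
    simp [Store.tick, Store.setReg, size, depth]
  | seq c₁ c₂ ih₁ ih₂ =>
    refine ensures_seq (((ih₁ h.1 hσ).and (h.1.reg_zero_eq σ)).mono fun ρ hρ =>
      (ih₂ h.2 (hρ.2.trans hσ)).mono fun τ hτ => ?_)
    have e1 : n ^ c₁.depth ≤ n ^ (max c₁.depth c₂.depth) := Nat.pow_le_pow_right hn (le_max_left _ _)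
    have e2 : n ^ c₂.depth ≤ n ^ (max c₁.depth c₂.depth) := Nat.pow_le_pow_right hn (le_max_right _ _)
    have f1 := Nat.mul_le_mul_left c₁.size e1
    have f2 := Nat.mul_le_mul_left c₂.size e2
    rw [size, depth, add_mul]
    omega
  | ifNat e f c₁ c₂ ih₁ ih₂ =>
    have e1 : n ^ c₁.depth ≤ n ^ (max c₁.depth c₂.depth) := Nat.pow_le_pow_right hn (le_max_left _ _)
    have e2 : n ^ c₂.depth ≤ n ^ (max c₁.depth c₂.depth) := Nat.pow_le_pow_right hn (le_max_right _ _)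
    have f1 := Nat.mul_le_mul_left c₁.size e1
    have f2 := Nat.mul_le_mul_left c₂.size e2
    have f3 := Nat.le_mul_of_pos_right (e.cost + f.cost + 1)
      (Nat.pow_pos (n := max c₁.depth c₂.depth) (Nat.lt_of_lt_of_le Nat.zero_lt_one hn))
    intro τ hτ
    rw [Cmd.exec] at hτ
    rw [size, depth, add_mul, add_mul]
    split_ifs at hτ
    · have := ih₁ h.1 (σ := σ.tick (e.cost + f.cost + 1)) hσ τ hτ
      simp only [Store.tick] at this
      omega
    · have := ih₂ h.2 (σ := σ.tick (e.cost + f.cost + 1)) hσ τ hτ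
      simp only [Store.tick] at this
      omega
  | ifReal e f c₁ c₂ ih₁ ih₂ =>
    have e1 : n ^ c₁.depth ≤ n ^ (max c₁.depth c₂.depth) := Nat.pow_le_pow_right hn (le_max_left _ _)
    have e2 : n ^ c₂.depth ≤ n ^ (max c₁.depth c₂.depth) := Nat.pow_le_pow_right hn (le_max_right _ _)
    have f1 := Nat.mul_le_mul_left c₁.size e1
    have f2 := Nat.mul_le_mul_left c₂.size e2
    have f3 := Nat.le_mul_of_pos_right (e.cost + f.cost + 1)
      (Nat.pow_pos (n := max c₁.depth c₂.depth) (Nat.lt_of_lt_of_le Nat.zero_lt_one hn))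
    intro τ hτ
    rw [Cmd.exec] at hτ
    rw [size, depth, add_mul, add_mul]
    split_ifs at hτ
    · have := ih₁ h.1 (σ := σ.tick (e.cost + f.cost + 1)) hσ τ hτ
      simp only [Store.tick] at this
      omega
    · have := ih₂ h.2 (σ := σ.tick (e.cost + f.cost + 1)) hσ τ hτ
      simp only [Store.tick] at this
      omega
  | loop r e c ih =>
    obtain ⟨hr, rfl, hc⟩ := h
    intro τ hτ
    rw [Cmd.exec] at hτ
    have key := iterate_support (fun k τ => τ.reg 0 = n ∧
      τ.clock ≤ σ.clock + ((NExp.reg 0).cost + 1) + k * (1 + c.size * n ^ c.depth))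
      (N := (NExp.reg 0).eval σ) (σ := σ.tick ((NExp.reg 0).cost + 1)) ⟨hσ, by simp [Store.tick]⟩
      (fun k _ ρ hρ τ' hτ' => by
        have hreg : ((ρ.setReg r k).tick 1).reg 0 = n := by
          rw [← hρ.1]
          exact Function.update_of_ne hr.symm _ _
        refine ⟨(hc.reg_zero_eq _ τ' hτ').trans hreg, ?_⟩
        have := ih hc hreg τ' hτ'
        simp only [Store.tick, Store.setReg] at this
        have := hρ.2
        rw [add_mul]
        omega) τ hτ
    have h2 := key.2
    simp only [NExp.eval, hσ, NExp.cost] at h2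
    simp only [size, depth, NExp.cost]
    have e1 : 1 ≤ n ^ c.depth := Nat.one_le_pow _ _ hn
    have e2 : n * 1 ≤ n * n ^ c.depth := Nat.mul_le_mul_left _ e1
    have e3 : n * (1 + c.size * n ^ c.depth) ≤ n * n ^ c.depth + c.size * (n * n ^ c.depth) := by
      rw [mul_add, mul_left_comm]
      omega
    rw [pow_succ', add_mul]
    have e4 : 2 ≤ 2 * (n * n ^ c.depth) := by nlinarith
    omega

/-! ### Loops that fill arrays -/

/-- The invariant `J` only concerns the arrays; the frame facts about unwritten arrays and registers
come for free in each pass. -/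
theorem ensures_loop {r : ℕ} {c : Cmd} {σ : Store} {n : ℕ} (hσ : σ.reg 0 = n)
    (J : ℕ → (ℕ → ℕ → ℕ → ℝ) → Prop) (h0 : J 0 σ.mem)
    (step : ∀ k < n, ∀ ρ : Store, J k ρ.mem → (∀ A ∉ c.memWrites, ρ.mem A = σ.mem A) →
      ρ.reg r = k → (∀ s, s ≠ r → s ∉ c.regWrites → ρ.reg s = σ.reg s) →
      Ensures c ρ fun τ => J (k + 1) τ.mem) :
    Ensures (.loop r (.reg 0) c) σ fun τ => J n τ.mem := by
  intro τ hτ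
  rw [Cmd.exec] at hτ
  have key := iterate_support (fun k τ => J k τ.mem ∧ (∀ A ∉ c.memWrites, τ.mem A = σ.mem A) ∧
    ∀ s, s ≠ r → s ∉ c.regWrites → τ.reg s = σ.reg s)
    (N := (NExp.reg 0).eval σ) (σ := σ.tick ((NExp.reg 0).cost + 1))
    ⟨h0, fun _ _ => rfl, fun _ _ _ => rfl⟩
    (fun k hk ρ hρ τ' hτ' => by
      have hreg : ∀ s, s ≠ r → s ∉ c.regWrites → ((ρ.setReg r k).tick 1).reg s = σ.reg s := by
        intro s hs hs'
        rw [← hρ.2.2 s hs hs']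
        exact Function.update_of_ne hs _ _
      refine ⟨step k (by rwa [NExp.eval, hσ] at hk) ((ρ.setReg r k).tick 1) hρ.1 hρ.2.1
        (by simp [Store.tick, Store.setReg])
        hreg τ' hτ', fun A hA => ?_, fun s hs hs' => ?_⟩
      · rw [ensures_mem_eq c _ τ' hτ' A hA]
        exact hρ.2.1 A hA
      · rw [ensures_reg_eq c _ τ' hτ' s hs']
        exact hreg s hs hs') τ hτ
  have := key.1
  rwa [NExp.eval, hσ] at this

/-- `τ` arises from `σ` by writing the value `y` to the entry `(i, j)` of the array `A`, as far as
this array is concerned. -/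
def SetsCell (A i j : ℕ) (y : ℝ) (σ τ : Store) : Prop :=
  τ.mem A i j = y ∧ ∀ i' j', i' ≠ i ∨ j' ≠ j → τ.mem A i' j' = σ.mem A i' j'

theorem ensures_setMem_cell (A : ℕ) (i j : NExp) (e : RExp) (σ : Store) :
    Ensures (.setMem A i j e) σ (SetsCell A (i.eval σ) (j.eval σ) (e.eval σ) σ) := by
  refine ensures_setMem ⟨?_, fun i' j' h => ?_⟩
  · simp [Store.tick, Store.setMem]
  · have : ¬ (i' = i.eval σ ∧ j' = j.eval σ) := by tauto
    simp [Store.tick, Store.setMem, this]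

/-- Write the sum of `b` and of the values of `e` for all values of the register `r` to the entry
`(i, j)` of the array `A`. -/
def sumCmd (A : ℕ) (i j : NExp) (b : RExp) (r : ℕ) (e : RExp) : Cmd :=
  .seq (.setMem A i j b) (.loop r (.reg 0) (.setMem A i j (.add (.mem A i j) e)))

/-- The store `ρ` is arbitrary on the array `A`, so the value of the summand must not depend on the
accumulator. -/
theorem ensures_sumCmd {A : ℕ} {i j : NExp} {b : RExp} {r : ℕ} {e : RExp} {σ : Store} {n I J : ℕ}
    {f : Fin n → ℝ} (hσ : σ.reg 0 = n) (hI : i.eval σ = I) (hJ : j.eval σ = J)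
    (h : ∀ k : Fin n, ∀ ρ : Store, (∀ B, B ≠ A → ρ.mem B = σ.mem B) → ρ.reg r = k →
      (∀ s, s ≠ r → ρ.reg s = σ.reg s) → i.eval ρ = I ∧ j.eval ρ = J ∧ e.eval ρ = f k) :
    Ensures (sumCmd A i j b r e) σ (SetsCell A I J (b.eval σ + ∑ k, f k) σ) := by
  refine ensures_seq (((ensures_setMem_cell A i j b σ).and ((ensures_mem_eq _ σ).and
    (ensures_reg_eq _ σ))).mono ?_)
  rintro ρ₀ ⟨hρ₀, hmem₀, hreg₀⟩
  rw [hI, hJ] at hρ₀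
  have hf : ∑ k, f k = ∑ k ∈ Finset.range n, if hk : k < n then f ⟨k, hk⟩ else 0 := by
    rw [Finset.sum_range]
    exact Finset.sum_congr rfl fun k _ => by rw [dif_pos k.2]
  rw [hf]
  refine ensures_loop (n := n) ((hreg₀ 0 (by simp [Cmd.regWrites])).trans hσ)
    (fun m μ => μ A I J = b.eval σ + ∑ k ∈ Finset.range m, (if hk : k < n then f ⟨k, hk⟩ else 0) ∧
      ∀ i' j', i' ≠ I ∨ j' ≠ J → μ A i' j' = σ.mem A i' j') ?_ ?_
  · rw [Finset.sum_range_zero, add_zero]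
    exact hρ₀
  · intro k hk ρ hJk hmem hr hreg
    obtain ⟨e1, e2, e3⟩ := h ⟨k, hk⟩ ρ (fun B hB => by
      rw [hmem B (by simpa [Cmd.memWrites] using hB),
        hmem₀ B (by simpa [Cmd.memWrites] using hB)]) hr (fun s hs => by
      rw [hreg s hs (by simp [Cmd.regWrites]), hreg₀ s (by simp [Cmd.regWrites])])
    refine (ensures_setMem_cell A i j _ ρ).mono fun τ hτ => ?_
    rw [e1, e2] at hτ
    refine ⟨?_, fun i' j' h' => (hτ.2 i' j' h').trans (hJk.2 i' j' h')⟩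
    rw [hτ.1, RExp.eval, RExp.eval, e1, e2, e3, hJk.1, Finset.sum_range_succ, dif_pos hk, add_assoc]

/-- A loop that fills a vector. -/
theorem ensures_fillVec {A r : ℕ} {c : Cmd} {σ : Store} {n : ℕ} {f : Fin n → ℝ}
    (hσ : σ.reg 0 = n)
    (h : ∀ k : Fin n, ∀ ρ : Store, (∀ B, B ∉ c.memWrites → ρ.mem B = σ.mem B) → ρ.reg r = k →
      (∀ s, s ≠ r → s ∉ c.regWrites → ρ.reg s = σ.reg s) → ρ.mem A k 0 = σ.mem A k 0 →
      Ensures c ρ (SetsCell A k 0 (f k) ρ)) :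
    Ensures (.loop r (.reg 0) c) σ fun τ => ∀ k : Fin n, τ.mem A k 0 = f k := by
  refine (ensures_loop hσ (fun m μ => (∀ k : Fin n, (k : ℕ) < m → μ A k 0 = f k) ∧
    ∀ k : Fin n, m ≤ (k : ℕ) → μ A k 0 = σ.mem A k 0) ⟨by simp, fun _ _ => rfl⟩ ?_).mono
    fun τ hτ k => hτ.1 k k.2
  intro k hk ρ hJ hmem hr hreg
  refine (h ⟨k, hk⟩ ρ hmem hr hreg (hJ.2 _ le_rfl)).mono fun τ hτ => ⟨fun i hi => ?_, fun i hi => ?_⟩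
  · rcases Nat.lt_succ_iff_lt_or_eq.1 hi with hi | hi
    · rw [hτ.2 _ _ (Or.inl hi.ne), hJ.1 i hi]
    · have : i = ⟨k, hk⟩ := Fin.ext hi
      rw [this]
      exact hτ.1
  · rw [hτ.2 _ _ (Or.inl (by simp only; omega)), hJ.2 i (by omega)]

/-- A nested loop that fills a matrix. -/
theorem ensures_fillMat {A r₁ r₂ : ℕ} {c : Cmd} {σ : Store} {n : ℕ} {f : Fin n → Fin n → ℝ}
    (hσ : σ.reg 0 = n) (hr₁ : r₁ ≠ 0) (hr : r₁ ≠ r₂) (hc0 : 0 ∉ c.regWrites)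
    (hc1 : r₁ ∉ c.regWrites) (hr₂ : r₂ ≠ 0)
    (h : ∀ k l : Fin n, ∀ ρ : Store, (∀ B, B ∉ c.memWrites → ρ.mem B = σ.mem B) → ρ.reg r₁ = k →
      ρ.reg r₂ = l → (∀ s, s ≠ r₁ → s ≠ r₂ → s ∉ c.regWrites → ρ.reg s = σ.reg s) →
      ρ.mem A k l = σ.mem A k l → Ensures c ρ (SetsCell A k l (f k l) ρ)) :
    Ensures (.loop r₁ (.reg 0) (.loop r₂ (.reg 0) c)) σ
      fun τ => ∀ k l : Fin n, τ.mem A k l = f k l := by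
  refine (ensures_loop hσ (fun m μ => (∀ k l : Fin n, (k : ℕ) < m → μ A k l = f k l) ∧
    ∀ k l : Fin n, m ≤ (k : ℕ) → μ A k l = σ.mem A k l) ⟨by simp, fun _ _ _ => rfl⟩ ?_).mono
    fun τ hτ k l => hτ.1 k l k.2
  intro k hk ρ hJ hmem hrk hreg
  refine (ensures_loop (n := n) ((hreg 0 hr₁.symm (by
      simp only [Cmd.regWrites, List.mem_cons, not_or]; exact ⟨hr₂.symm, hc0⟩)).trans hσ)
    (fun m μ => (∀ l : Fin n, (l : ℕ) < m → μ A k l = f ⟨k, hk⟩ l) ∧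
      (∀ l : Fin n, m ≤ (l : ℕ) → μ A k l = σ.mem A k l) ∧
      ∀ i j, i ≠ k → μ A i j = ρ.mem A i j)
    ⟨by simp, fun l _ => hJ.2 ⟨k, hk⟩ l le_rfl, fun _ _ _ => rfl⟩ ?_).mono
    fun τ hτ => ⟨fun i l hi => ?_, fun i l hi => ?_⟩
  · intro l hl ρ' hJ' hmem' hrl hreg'
    refine (h ⟨k, hk⟩ ⟨l, hl⟩ ρ' (fun B hB => (hmem' B hB).trans (hmem B hB))
      ((hreg' _ hr hc1).trans hrk) hrl (fun s hs1 hs2 hs3 => ?_) (hJ'.2.1 ⟨l, hl⟩ le_rfl)).mono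
      fun τ hτ => ⟨fun j hj => ?_, fun j hj => ?_, fun i j hi => ?_⟩
    · rw [hreg' s hs2 hs3, hreg s hs1 (by
        simp only [Cmd.regWrites, List.mem_cons, not_or]; exact ⟨hs2, hs3⟩)]
    · rcases Nat.lt_succ_iff_lt_or_eq.1 hj with hj | hj
      · rw [← hJ'.1 j hj]
        exact hτ.2 _ _ (Or.inr hj.ne)
      · have : j = ⟨l, hl⟩ := Fin.ext hj
        rw [this]
        exact hτ.1
    · rw [← hJ'.2.1 j (by omega)]
      exact hτ.2 _ _ (Or.inr (by simp only; omega))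
    · rw [← hJ'.2.2 i j hi]
      exact hτ.2 _ _ (Or.inl hi)
  · rcases Nat.lt_succ_iff_lt_or_eq.1 hi with hi | hi
    · rw [hτ.2.2 _ _ hi.ne, hJ.1 i l hi]
    · have : i = ⟨k, hk⟩ := Fin.ext hi
      rw [this]
      exact hτ.1 l l.2
  · rw [hτ.2.2 _ _ (by omega), hJ.2 i l (by omega)]

/-! ### Loops and couplings -/

theorem Coupled.iterate {α : Type} {r : ℕ} {body : Store → PMF Store} (μ : ℕ → PMF α)
    (ν : ℕ → α → PMF α) (I : ℕ → α → Store → Prop) {N : ℕ} {σ : Store}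
    (h0 : Coupled (I 0) (μ 0) (PMF.pure σ)) (hμ : ∀ k, μ (k + 1) = (μ k).bind (ν k))
    (step : ∀ k < N, ∀ a τ, I k a τ → Coupled (I (k + 1)) (ν k a) (body ((τ.setReg r k).tick 1))) :
    Coupled (I N) (μ N) (iterate r body N σ) := by
  induction N with
  | zero => exact h0
  | succ N ih =>
    rw [hμ, PermBandit.iterate]
    exact (ih fun k hk => step k (hk.trans N.lt_succ_self)).bind fun a τ h =>
      step N N.lt_succ_self a τ h

/-- The passes of a loop for the counter values `j, j + 1, …, j + m - 1`. -/
def iterateFrom (r : ℕ) (body : Store → PMF Store) : ℕ → ℕ → Store → PMF Store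
  | _, 0, σ => PMF.pure σ
  | j, m + 1, σ => (body ((σ.setReg r j).tick 1)).bind (iterateFrom r body (j + 1) m)

theorem iterateFrom_succ (r : ℕ) (body : Store → PMF Store) (j m : ℕ) (σ : Store) :
    iterateFrom r body j (m + 1) σ =
      (iterateFrom r body j m σ).bind fun τ => body ((τ.setReg r (j + m)).tick 1) := by
  induction m generalizing j σ with
  | zero => simp only [iterateFrom, PMF.bind_pure, PMF.pure_bind, add_zero]
  | succ m ih =>
    conv_lhs => rw [iterateFrom]
    conv_rhs => rw [iterateFrom, PMF.bind_bind]
    congr 1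
    funext τ
    rw [ih, show j + 1 + m = j + (m + 1) by ring]

/-- `iterate` splits off the last pass, but the Plackett–Luce recursion splits off the first
position. -/
theorem iterate_eq_iterateFrom (r : ℕ) (body : Store → PMF Store) (N : ℕ) (σ : Store) :
    iterate r body N σ = iterateFrom r body 0 N σ := by
  induction N with
  | zero => rfl
  | succ N ih => rw [iterate, iterateFrom_succ, ih, zero_add]

/-! ### Reservoir sampling -/

/-- The item that is kept by reservoir sampling from the first `k` items with the weights `y`. -/
def reservoir (y : ℕ → ℝ) : ℕ → PMF ℕ
  | 0 => PMF.pure 0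
  | k + 1 => (reservoir y k).bind fun c =>
      (coin (y k / ∑ i ∈ Finset.range (k + 1), y i)).map fun b => if b then k else c

theorem reservoir_succ_toReal (y : ℕ → ℝ) (k v : ℕ) (h0 : 0 ≤ y k / ∑ i ∈ Finset.range (k + 1), y i)
    (h1 : y k / ∑ i ∈ Finset.range (k + 1), y i ≤ 1) :
    (reservoir y (k + 1) v).toReal =
      y k / (∑ i ∈ Finset.range (k + 1), y i) * (if v = k then 1 else 0) +
      (1 - y k / ∑ i ∈ Finset.range (k + 1), y i) * (reservoir y k v).toReal := by
  set p := y k / ∑ i ∈ Finset.range (k + 1), y i with hp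
  -- The coin is independent of the earlier choices and may be flipped first.
  have e : reservoir y (k + 1) =
      (coin p).bind fun b => if b then PMF.pure k else reservoir y k := by
    rw [reservoir, ← hp]
    simp_rw [PMF.map]
    rw [PMF.bind_comm]
    congr 1
    funext b
    cases b
    · simp [PMF.bind_pure]
    · simp [PMF.bind_const]
  rw [e, PMF.bind_apply, tsum_fintype, Fintype.sum_bool, ENNReal.toReal_add
    (ENNReal.mul_ne_top (PMF.apply_ne_top _ _) (PMF.apply_ne_top _ _))
    (ENNReal.mul_ne_top (PMF.apply_ne_top _ _) (PMF.apply_ne_top _ _)),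
    ENNReal.toReal_mul, ENNReal.toReal_mul, coin_toReal_of_mem h0 h1, coin_toReal_of_mem h0 h1]
  by_cases h : v = k <;> simp [h]

/-- The kept item has law `y v / ∑ y`. The form without division stays valid while all weights so
far are zero, which happens when leading items are already removed. -/
theorem sum_mul_reservoir (y : ℕ → ℝ) (k v : ℕ) (hy : ∀ i < k, 0 ≤ y i) :
    (∑ i ∈ Finset.range k, y i) * (reservoir y k v).toReal = if v < k then y v else 0 := by
  induction k with
  | zero => simp
  | succ k ih =>
    specialize ih fun i hi => hy i (hi.trans k.lt_succ_self)
    have hS : 0 ≤ ∑ i ∈ Finset.range k, y i :=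
      Finset.sum_nonneg fun i hi => hy i ((Finset.mem_range.1 hi).trans k.lt_succ_self)
    have hyk := hy k k.lt_succ_self
    have hS' : 0 ≤ ∑ i ∈ Finset.range (k + 1), y i := by
      rw [Finset.sum_range_succ]
      exact add_nonneg hS hyk
    rw [reservoir_succ_toReal y k v (div_nonneg hyk hS') (div_le_one_of_le₀ (by
      rw [Finset.sum_range_succ]; linarith) hS')]
    have hif : (if v < k + 1 then y v else 0) =
        y k * (if v = k then 1 else 0) + if v < k then y v else 0 := by
      rcases lt_trichotomy v k with h | h | h
      · simp [h, h.ne, h.trans k.lt_succ_self]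
      · simp [h]
      · simp [h.not_gt, h.ne', show ¬ v < k + 1 by omega]
    rw [hif]
    rcases hS'.eq_or_lt with h | h
    · rw [Finset.sum_range_succ] at h
      have hk0 : y k = 0 := by linarith
      have hs0 : ∑ i ∈ Finset.range k, y i = 0 := by linarith
      rw [hs0, zero_mul] at ih
      rw [← ih, Finset.sum_range_succ, hs0, hk0]
      ring
    · rw [← ih]
      have : y k / (∑ i ∈ Finset.range (k + 1), y i) * (∑ i ∈ Finset.range (k + 1), y i) = y k :=
        div_mul_cancel₀ _ h.ne'
      have e2 := Finset.sum_range_succ y k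
      linear_combination ((if v = k then 1 else 0) - (reservoir y k v).toReal) * this +
        (reservoir y k v).toReal * e2

/-- Here `e` lists the remaining items. Removed items keep their cell with weight zero, so each
round can scan all `n` cells. -/
theorem reservoir_eq_softmax {n m : ℕ} (y : ℕ → ℝ) (w : Fin (m + 1) → ℝ) (e : Fin (m + 1) → Fin n)
    (he : Function.Injective e) (h1 : ∀ u, y (e u) = Real.exp (w u))
    (h2 : ∀ v : Fin n, v ∉ Set.range e → y v = 0) :
    reservoir y n = (softmax w).map fun u => ((e u : Fin n) : ℕ) := by
  have hinj : Function.Injective fun u => ((e u : Fin n) : ℕ) := fun a b h => he (Fin.ext h)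
  have hsum : ∑ i ∈ Finset.range n, y i = ∑ u, Real.exp (w u) := by
    rw [Finset.sum_range]
    exact (Fintype.sum_of_injective e he _ _ h2 fun u => (h1 u).symm).symm
  have hpos : (0 : ℝ) < ∑ v, Real.exp (w v) :=
    Finset.sum_pos (fun v _ => Real.exp_pos _) Finset.univ_nonempty
  have hy : ∀ i < n, 0 ≤ y i := by
    intro i hi
    by_cases h : (⟨i, hi⟩ : Fin n) ∈ Set.range e
    · obtain ⟨u, hu⟩ := h
      have := h1 u
      rw [hu] at this
      exact this ▸ (Real.exp_pos _).le
    · exact (h2 ⟨i, hi⟩ h).ge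
  ext v
  rw [← ENNReal.toReal_eq_toReal_iff' (PMF.apply_ne_top _ _) (PMF.apply_ne_top _ _)]
  have key := sum_mul_reservoir y n v hy
  rw [hsum] at key
  apply mul_left_cancel₀ hpos.ne'
  rw [key]
  by_cases h : ∃ u, ((e u : Fin n) : ℕ) = v
  · obtain ⟨u, rfl⟩ := h
    rw [if_pos (e u).2, h1, PMF.map_apply, tsum_eq_single u]
    · rw [if_pos rfl, softmax, PMF.ofFintype_apply, ENNReal.toReal_ofReal (by positivity)]
      field_simp
    · intro u' hu'
      rw [if_neg fun h => hu' (hinj h).symm]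
  · have hz : (softmax w).map (fun u => ((e u : Fin n) : ℕ)) v = 0 := by
      rw [PMF.apply_eq_zero_iff, PMF.mem_support_map_iff]
      rintro ⟨u, -, hu⟩
      exact h ⟨u, hu⟩
    rw [hz, ENNReal.toReal_zero, mul_zero]
    split_ifs with hv
    · refine h2 ⟨v, hv⟩ ?_
      rintro ⟨u, hu⟩
      exact h ⟨u, congrArg Fin.val hu⟩
    · rfl

/-- Offer the item in register `2` to the reservoir in register `4`. The total weight is in the
array `4`, the weights are in the array `3`. -/
def reservoirCmd : Cmd :=
  .seq (.setMem 4 (.const 0) (.const 0)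
    (.add (.mem 4 (.const 0) (.const 0)) (.mem 3 (.reg 2) (.const 0)))) <|
  .seq (.flip 5 (.div (.mem 3 (.reg 2) (.const 0)) (.mem 4 (.const 0) (.const 0))))
  (.ifNat (.const 1) (.reg 5) (.setReg 4 (.reg 2)) .skip)

/-- Draw an item with the weights in the array `3`, give it the position in register `1`, and remove
it. -/
def roundCmd : Cmd :=
  .seq (.setMem 4 (.const 0) (.const 0) (.ofNat (.const 0))) <|
  .seq (.setReg 4 (.const 0)) <|
  .seq (.loop 2 (.reg 0) reservoirCmd) <|
  .seq (.setMem 1 (.reg 4) (.const 0) (.ofNat (.add (.reg 1) (.const 1))))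
  (.setMem 3 (.reg 4) (.const 0) (.ofNat (.const 0)))

theorem coupled_reservoirCmd {y : ℕ → ℝ} {k c : ℕ} {ρ : Store} (hk : ρ.reg 2 = k)
    (hc : ρ.reg 4 = c) (htot : ρ.mem 4 0 0 = ∑ i ∈ Finset.range k, y i) (hy : ρ.mem 3 k 0 = y k) :
    Coupled (fun c' τ => τ.reg 4 = c' ∧ τ.mem 4 0 0 = ∑ i ∈ Finset.range (k + 1), y i)
      ((coin (y k / ∑ i ∈ Finset.range (k + 1), y i)).map fun b => if b then k else c)
      (reservoirCmd.exec ρ) := by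
  rw [reservoirCmd, Cmd.exec, Cmd.exec, PMF.pure_bind, Cmd.exec, Cmd.exec]
  set p := y k / ∑ i ∈ Finset.range (k + 1), y i with hp
  set ρ' := (ρ.setMem 4 ((NExp.const 0).eval ρ) ((NExp.const 0).eval ρ)
    (((RExp.mem 4 (.const 0) (.const 0)).add (.mem 3 (.reg 2) (.const 0))).eval ρ)).tick
      ((NExp.const 0).cost + (NExp.const 0).cost +
        ((RExp.mem 4 (.const 0) (.const 0)).add (.mem 3 (.reg 2) (.const 0))).cost + 1) with hρ'
  have hm : ρ'.mem 4 0 0 = ∑ i ∈ Finset.range (k + 1), y i := by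
    rw [Finset.sum_range_succ, ← htot, ← hy]
    simp [hρ', Store.tick, Store.setMem, NExp.eval, RExp.eval, hk]
  have hpe : ((RExp.mem 3 (.reg 2) (.const 0)).div (.mem 4 (.const 0) (.const 0))).eval ρ' = p := by
    rw [hp, ← hm, ← hy]
    simp [hρ', Store.tick, Store.setMem, NExp.eval, RExp.eval, hk]
  rw [hpe]
  refine Coupled.bind_support (R := fun c' τ => ∃ b : Bool, c' = (if b then k else c) ∧
    τ.reg 5 = (if b then 1 else 0) ∧ τ.reg 2 = k ∧ τ.reg 4 = c ∧ τ.mem = ρ'.mem)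
    (Coupled.map ((Coupled.refl _).mono fun b b' _ _ hb => ?_)) ?_
  · refine ⟨b, rfl, ?_, ?_, ?_, rfl⟩
    · simp [Store.tick, Store.setReg, hb]
    · simp [Store.tick, Store.setReg, hρ', Store.setMem, hk]
    · simp [Store.tick, Store.setReg, hρ', Store.setMem, hc]
  · rintro c' τ ⟨b, rfl, h5, h2, h4, hmem⟩ τ' hτ'
    rw [Cmd.exec] at hτ'
    cases b
    · rw [if_neg (by simp [NExp.eval, h5]), Cmd.exec, PMF.mem_support_pure_iff] at hτ'
      subst hτ'
      exact ⟨by simpa [Store.tick] using h4, by rw [← hm, ← hmem]; rfl⟩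
    · rw [if_pos (by simp [NExp.eval, h5]), Cmd.exec, PMF.mem_support_pure_iff] at hτ'
      subst hτ'
      exact ⟨by simpa [Store.tick, Store.setReg, NExp.eval] using h2, by rw [← hm, ← hmem]; rfl⟩

theorem coupled_roundCmd {n m : ℕ} {σ : Store} (hσ : σ.reg 0 = n) (w : Fin (m + 1) → ℝ)
    (e : Fin (m + 1) → Fin n) (he : Function.Injective e)
    (h1 : ∀ u, σ.mem 3 (e u) 0 = Real.exp (w u))
    (h2 : ∀ v : Fin n, v ∉ Set.range e → σ.mem 3 v 0 = 0) :
    Coupled (fun u τ => SetsCell 1 (e u) 0 (σ.reg 1 + 1) σ τ ∧ SetsCell 3 (e u) 0 0 σ τ)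
      (softmax w) (roundCmd.exec σ) := by
  set y : ℕ → ℝ := fun i => σ.mem 3 i 0 with hy
  rw [roundCmd, Cmd.exec, Cmd.exec, PMF.pure_bind, Cmd.exec, Cmd.exec, PMF.pure_bind, Cmd.exec]
  set ρ := ((σ.setMem 4 ((NExp.const 0).eval σ) ((NExp.const 0).eval σ)
    ((RExp.ofNat (NExp.const 0)).eval σ)).tick ((NExp.const 0).cost + (NExp.const 0).cost +
      (RExp.ofNat (NExp.const 0)).cost + 1)) with hρ
  set ρ' := (ρ.setReg 4 ((NExp.const 0).eval ρ)).tick ((NExp.const 0).cost + 1) with hρ'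
  have hmem : ∀ A, A ≠ 4 → ρ'.mem A = σ.mem A := by
    intro A hA
    funext i j
    simp [hρ', hρ, Store.tick, Store.setReg, Store.setMem, hA]
  have hreg : ∀ r, r ≠ 4 → ρ'.reg r = σ.reg r := by
    intro r hr
    simp [hρ', hρ, Store.tick, Store.setReg, Store.setMem, hr]
  have hloop : Coupled (fun (u : Fin (m + 1)) τ => τ.reg 4 = (e u : ℕ) ∧ τ.reg 1 = σ.reg 1 ∧
      ∀ A, A ≠ 4 → τ.mem A = σ.mem A) (softmax w)
      ((Cmd.loop 2 (.reg 0) reservoirCmd).exec ρ') := by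
    have key : Coupled (fun c τ => τ.reg 4 = c ∧ τ.mem 4 0 0 = ∑ i ∈ Finset.range n, y i)
        (reservoir y n) ((Cmd.loop 2 (.reg 0) reservoirCmd).exec ρ') := by
      rw [Cmd.exec]
      have hN : (NExp.reg 0).eval ρ' = n := by rw [NExp.eval, hreg 0 (by norm_num), hσ]
      rw [hN]
      refine (Coupled.iterate (reservoir y) (fun k c =>
        (coin (y k / ∑ i ∈ Finset.range (k + 1), y i)).map fun b => if b then k else c)
        (fun k c τ => (τ.reg 4 = c ∧ τ.mem 4 0 0 = ∑ i ∈ Finset.range k, y i) ∧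
          τ.mem 3 = σ.mem 3) (Coupled.pure ⟨⟨?_, ?_⟩, ?_⟩) (fun k => rfl) ?_).mono
        fun _ _ _ _ h => h.1
      · simp [hρ', Store.tick, Store.setReg, NExp.eval]
      · simp [hρ', hρ, Store.tick, Store.setReg, Store.setMem, NExp.eval, RExp.eval]
      · exact hmem 3 (by norm_num)
      · intro k _ c τ ⟨⟨hc, ht⟩, h3⟩
        refine (coupled_reservoirCmd (y := y) (k := k) (c := c) (ρ := (τ.setReg 2 k).tick 1) ?_ ?_ ht ?_).mono
          fun c' τ' _ hτ' h => ⟨h, ?_⟩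
        · simp [Store.tick, Store.setReg]
        · simpa [Store.tick, Store.setReg] using hc
        · exact congrFun (congrFun h3 k) 0
        · rw [ensures_mem_eq _ _ τ' hτ' 3 (by simp [reservoirCmd, Cmd.memWrites])]
          exact h3
    rw [reservoir_eq_softmax y w e he h1 h2] at key
    refine (key.of_map_left fun a b h => he (Fin.ext h)).mono fun u τ _ hτ h => ⟨h.1, ?_, ?_⟩
    · rw [ensures_reg_eq _ _ τ hτ 1 (by simp [reservoirCmd, Cmd.regWrites])]
      exact hreg 1 (by norm_num)
    · intro A hA
      rw [ensures_mem_eq _ _ τ hτ A (by simpa [reservoirCmd, Cmd.memWrites] using hA)]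
      exact hmem A hA
  refine hloop.bind_support fun u τ ⟨h4, h1', hτm⟩ => ?_
  refine ensures_seq (ensures_setMem (ensures_setMem ⟨⟨?_, fun i j hij => ?_⟩,
    ⟨?_, fun i j hij => ?_⟩⟩))
  · simp [Store.tick, Store.setMem, NExp.eval, RExp.eval, h4, h1']
  · have : ¬ (i = (e u : ℕ) ∧ j = 0) := by tauto
    simp [Store.tick, Store.setMem, NExp.eval, h4, hτm 1, this]
  · simp [Store.tick, Store.setMem, NExp.eval, RExp.eval, h4]
  · have : ¬ (i = (e u : ℕ) ∧ j = 0) := by tauto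
    simp [Store.tick, Store.setMem, NExp.eval, h4, hτm 3, this]

/-- The offset `j` and the embedding `e` of the remaining items make the claim inductive: the round
with counter `j` writes the position `j + 1`, and the rest is the recursion with `u` removed. -/
theorem coupled_rounds {n : ℕ} (m : ℕ) (w : Fin m → ℝ) (e : Fin m → Fin n)
    (he : Function.Injective e) (j : ℕ) (σ : Store) (hσ : σ.reg 0 = n)
    (h1 : ∀ u, σ.mem 3 (e u) 0 = Real.exp (w u))
    (h2 : ∀ v : Fin n, v ∉ Set.range e → σ.mem 3 v 0 = 0) :
    Coupled (fun π τ => (∀ u, τ.mem 1 (e u) 0 = j + ((π u : ℕ) : ℝ) + 1) ∧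
      ∀ v : Fin n, v ∉ Set.range e → τ.mem 1 v 0 = σ.mem 1 v 0)
      (plackettLuce m w) (iterateFrom 1 roundCmd.exec j m σ) := by
  induction m generalizing j σ with
  | zero => exact Coupled.pure ⟨fun u => u.elim0, fun _ _ => rfl⟩
  | succ m ih =>
    rw [plackettLuce, iterateFrom]
    have hσ' : ((σ.setReg 1 j).tick 1).reg 0 = n := by
      simpa [Store.tick, Store.setReg] using hσ
    have hj : ((σ.setReg 1 j).tick 1).reg 1 = j := by simp [Store.tick, Store.setReg]
    refine Coupled.bind ((coupled_roundCmd hσ' w e he h1 h2).mono (S := fun u τ =>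
      (SetsCell 1 (e u) 0 (j + 1) σ τ ∧ SetsCell 3 (e u) 0 0 σ τ) ∧ τ.reg 0 = n) ?_) ?_
    · intro u τ _ hτ h
      rw [hj] at h
      refine ⟨h, ?_⟩
      rw [ensures_reg_eq _ _ τ hτ 0 (by simp [roundCmd, reservoirCmd, Cmd.regWrites])]
      exact hσ'
    · rintro u τ ⟨⟨hs1, hs3⟩, hτ0⟩
      have hne : ∀ v, v ≠ u → ((e v : Fin n) : ℕ) ≠ e u := fun v hv h => hv (he (Fin.ext h))
      have hrange : ∀ v : Fin n, v ∉ Set.range (fun i => e (u.succAbove i)) →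
          v = e u ∨ v ∉ Set.range e := by
        intro v hv
        by_contra! h
        obtain ⟨i, rfl⟩ := h.2
        obtain ⟨i', hi'⟩ := Fin.exists_succAbove_eq (fun h' => h.1 (congrArg e h') : i ≠ u)
        exact hv ⟨i', congrArg e hi'⟩
      refine Coupled.map_left ((ih (fun v => w (u.succAbove v)) (fun i => e (u.succAbove i))
        (he.comp Fin.succAbove_right_injective) (j + 1) τ hτ0 ?_ ?_).mono ?_)
      · intro i
        rw [hs3.2 _ _ (Or.inl (hne _ (Fin.succAbove_ne u i)))]
        exact h1 _
      · intro v hv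
        by_cases hvu : v = e u
        · rw [hvu]
          exact hs3.1
        · rw [hs3.2 _ _ (Or.inl fun h => hvu (Fin.ext h))]
          exact h2 v ((hrange v hv).resolve_left hvu)
      · rintro π τ' _ _ ⟨ha, hb⟩
        refine ⟨fun v => ?_, fun v hv => ?_⟩
        · rcases Fin.eq_self_or_eq_succAbove u v with rfl | ⟨i, rfl⟩
          · rw [hb (e v) ?_, hs1.1, consPerm_self]
            · simp
            · rintro ⟨i, hi⟩
              exact Fin.succAbove_ne v i (he hi)
          · rw [ha i, consPerm_succAbove, Fin.val_succ]
            push_cast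
            ring
        · have hvu : v ≠ e u := fun h => hv ⟨u, h.symm⟩
          rw [hb v (fun ⟨i, hi⟩ => hv ⟨_, hi⟩), hs1.2 _ _ (Or.inl fun h => hvu (Fin.ext h))]

/-- Draw a permutation from the mixture for the weights in the array `2`. -/
def drawCmd : Cmd :=
  .seq (.flip 5 (.mem 0 (.const 0) (.const 0))) <|
  .seq (.loop 1 (.reg 0) (.ifNat (.const 1) (.reg 5)
    (.setMem 3 (.reg 1) (.const 0) (.ofNat (.const 1)))
    (.setMem 3 (.reg 1) (.const 0) (.exp (.mem 2 (.reg 1) (.const 0))))))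
  (.loop 1 (.reg 0) roundCmd)

theorem coupled_drawCmd {n : ℕ} {γ : ℝ} {w : Fin n → ℝ} {σ : Store} (hσ : σ.reg 0 = n)
    (hγ : σ.mem 0 0 0 = γ) (hw : ∀ v : Fin n, σ.mem 2 v 0 = w v) :
    Coupled (fun π τ => ∀ v : Fin n, τ.mem 1 v 0 = ((π v : ℕ) : ℝ) + 1) (mixture γ w)
      (drawCmd.exec σ) := by
  rw [drawCmd, Cmd.exec, Cmd.exec, mixture]
  have hp : (RExp.mem 0 (.const 0) (.const 0)).eval σ = γ := by simp [RExp.eval, NExp.eval, hγ]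
  rw [hp]
  refine Coupled.bind (R := fun b τ => τ.reg 5 = (if b then 1 else 0) ∧ τ.reg 0 = n ∧
    τ.mem = σ.mem) (Coupled.map_right ((Coupled.refl _).mono fun b b' _ _ hb => ?_)) ?_
  · subst hb
    refine ⟨?_, ?_, rfl⟩
    · simp [Store.tick, Store.setReg]
    · simp [Store.tick, Store.setReg, hσ]
  · rintro b τ ⟨h5, h0, hmem⟩
    rw [Cmd.exec]
    -- The uniform part is sampled as Plackett–Luce with zero weights, that is, all odds equal to 1.
    set w' : Fin n → ℝ := if b then fun _ => 0 else w with hw'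
    have hmix : (if b = true then PMF.uniformOfFintype (Equiv.Perm (Fin n)) else
        plackettLuce n w) = plackettLuce n w' := by
      cases b
      · rfl
      · simp [hw', plackettLuce_zero]
    -- The dummy stage is the partner of the loop that fills in the odds.
    rw [hmix, ← PMF.pure_bind () fun _ => plackettLuce n w']
    refine Coupled.bind (R := fun _ τ' => τ'.reg 0 = n ∧
      ∀ v : Fin n, τ'.mem 3 v 0 = Real.exp (w' v)) (Coupled.of_support ?_) ?_
    · intro τ' hτ'
      refine ⟨?_, ensures_fillVec (A := 3) (f := fun v => Real.exp (w' v)) h0 ?_ τ' hτ'⟩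
      · rw [ensures_reg_eq _ _ τ' hτ' 0 (by simp [Cmd.regWrites])]
        exact h0
      · intro k ρ hmem' hr hreg _ ρ' hρ'
        have hr5 : ρ.reg 5 = if b then 1 else 0 :=
          (hreg 5 (by norm_num) (by simp [Cmd.regWrites])).trans h5
        have hm2 : ρ.mem 2 k 0 = w k := by
          rw [hmem' 2 (by simp [Cmd.memWrites]), hmem, hw]
        rw [Cmd.exec] at hρ'
        cases b
        · rw [if_neg (by simp [NExp.eval, hr5])] at hρ'
          have := ensures_setMem_cell _ _ _ _ _ ρ' hρ'
          simp [NExp.eval, RExp.eval, Store.tick, hr, hm2] at this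
          exact ⟨this.1, this.2⟩
        · rw [if_pos (by simp [NExp.eval, hr5])] at hρ'
          have := ensures_setMem_cell _ _ _ _ _ ρ' hρ'
          simp [NExp.eval, RExp.eval, Store.tick, hr] at this
          exact ⟨by simpa [hw'] using this.1, this.2⟩
    · rintro _ τ' ⟨hτ0, hτ3⟩
      rw [Cmd.exec, iterate_eq_iterateFrom, NExp.eval, hτ0]
      refine (coupled_rounds n w' id Function.injective_id 0 (σ := τ'.tick _) hτ0 hτ3
        (fun v hv => absurd ⟨v, rfl⟩ hv)).mono fun π ρ _ _ h v => ?_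
      simpa using h.1 v

/-! ### Inversion of a positive definite matrix by bordering -/

/-- `H` is the inverse of the upper left `k × k` block of `G`, padded with zeros. -/
structure IsBlockInverse {n : ℕ} (G H : Matrix (Fin n) (Fin n) ℝ) (k : ℕ) : Prop where
  symm : ∀ i j, H i j = H j i
  zero : ∀ i j : Fin n, k ≤ (j : ℕ) → H i j = 0
  mul : ∀ i j : Fin n, (j : ℕ) < k → (H * G) i j = (1 : Matrix (Fin n) (Fin n) ℝ) i j

theorem isBlockInverse_zero {n : ℕ} (G : Matrix (Fin n) (Fin n) ℝ) : IsBlockInverse G 0 0 :=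
  ⟨fun _ _ => rfl, fun _ _ _ => rfl, fun _ _ h => absurd h (Nat.not_lt_zero _)⟩

theorem IsBlockInverse.eq_inv {n : ℕ} {G H : Matrix (Fin n) (Fin n) ℝ}
    (h : IsBlockInverse G H n) : H = G⁻¹ := by
  refine (Matrix.inv_eq_left_inv ?_).symm
  ext i j
  exact h.mul i j j.2

/-- With `v = e_k - H G e_k`, the row `v'G` vanishes before `k`, and at `k` it is the Schur
complement `d`. So adding `v v' / d` leaves the finished columns of `H G` alone and corrects column
`k`. -/
theorem IsBlockInverse.border {n : ℕ} {G H : Matrix (Fin n) (Fin n) ℝ} {k : Fin n}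
    (h : IsBlockInverse G H k) (hG : Gᵀ = G) (hpos : ∀ z, z ≠ 0 → 0 < z ⬝ᵥ G *ᵥ z) {v : Fin n → ℝ}
    (hv : ∀ i, v i = (1 : Matrix (Fin n) (Fin n) ℝ) i k - (H * G) i k) {d : ℝ}
    (hd : d = ∑ i, v i * G i k) {H' : Matrix (Fin n) (Fin n) ℝ}
    (hH' : ∀ i j, H' i j = H i j + v i * v j / d) : IsBlockInverse G H' (k + 1) := by
  have hrow : ∀ i j : Fin n, (k : ℕ) ≤ i → (H * G) i j = 0 := by
    intro i j hi
    rw [Matrix.mul_apply]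
    exact Finset.sum_eq_zero fun l _ => by rw [h.symm, h.zero l i hi, zero_mul]
  have hvk : v k = 1 := by
    rw [hv, hrow k k le_rfl, Matrix.one_apply_eq, sub_zero]
  have hvG : ∀ j : Fin n, (v ᵥ* G) j = G k j - (G * H * G) k j := by
    intro j
    have hsw : ∀ i, (H * G) i k = (G * H) k i := by
      intro i
      have hHt : Hᵀ = H := by
        ext a b
        exact h.symm b a
      rw [← Matrix.transpose_apply (H * G), Matrix.transpose_mul, hG, hHt]
    have : v = fun i => (1 : Matrix (Fin n) (Fin n) ℝ) k i - (G * H) k i := by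
      funext i
      rw [hv, hsw, Matrix.one_apply, Matrix.one_apply]
      simp only [eq_comm]
    rw [this, Matrix.mul_apply]
    simp only [Matrix.vecMul, dotProduct, sub_mul, Finset.sum_sub_distrib]
    congr 1
    rw [← Matrix.mul_apply, Matrix.one_mul]
  have hvG0 : ∀ j : Fin n, (j : ℕ) < k → (v ᵥ* G) j = 0 := by
    intro j hj
    rw [hvG, Matrix.mul_assoc, Matrix.mul_apply]
    simp_rw [h.mul _ j hj]
    rw [← Matrix.mul_apply, Matrix.mul_one, sub_self]
  have hdG : d = (v ᵥ* G) k := hd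
  -- `v'G` vanishes before `k`, `v` vanishes after `k`, and `v k = 1`. Positive definiteness then
  -- gives `d ≠ 0`, so no pivoting is needed.
  have hdv : d = v ⬝ᵥ G *ᵥ v := by
    rw [Matrix.dotProduct_mulVec, dotProduct, Finset.sum_eq_single k, hvk, mul_one, hdG]
    · intro j _ hj
      rcases lt_or_gt_of_ne (fun e => hj (Fin.ext e) : (j : ℕ) ≠ k) with hlt | hgt
      · rw [hvG0 j hlt, zero_mul]
      · rw [hv, hrow j k hgt.le, Matrix.one_apply_ne hj, sub_zero, mul_zero]
    · simp
  have hd0 : d ≠ 0 := by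
    rw [hdv]
    refine (hpos v fun h0 => ?_).ne'
    rw [h0] at hvk
    exact zero_ne_one hvk
  have hmul : ∀ i j, (H' * G) i j = (H * G) i j + v i * (v ᵥ* G) j / d := by
    intro i j
    rw [Matrix.mul_apply, Matrix.mul_apply, Matrix.vecMul, dotProduct, Finset.mul_sum,
      Finset.sum_div, ← Finset.sum_add_distrib]
    exact Finset.sum_congr rfl fun l _ => by rw [hH']; ring
  refine ⟨fun i j => ?_, fun i j hj => ?_, fun i j hj => ?_⟩
  · rw [hH', hH', h.symm, mul_comm (v i)]
  · have hjk : j ≠ k := fun e => by subst e; omega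
    rw [hH', h.zero i j (by omega), hv j, hrow j k (by omega), Matrix.one_apply_ne hjk]
    simp
  · rw [hmul]
    rcases Nat.lt_succ_iff_lt_or_eq.1 hj with hj | hj
    · rw [hvG0 j hj, h.mul i j hj]
      simp
    · have : j = k := Fin.ext hj
      subst this
      rw [← hdG, mul_div_cancel_right₀ _ hd0, hv]
      ring

/-! ### The update -/

/-- The absolute value of the difference. -/
def distExp (e f : NExp) : NExp := .add (.sub e f) (.sub f e)

/-- The indicator of equality. -/
def eqExp (e f : NExp) : RExp := .ofNat (.sub (.const 1) (distExp e f))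

/-- Truncated subtraction turns `1 - |e - f|` into the indicator. -/
theorem eqExp_eval (e f : NExp) (σ : Store) :
    (eqExp e f).eval σ = if e.eval σ = f.eval σ then 1 else 0 := by
  simp only [eqExp, distExp, RExp.eval, NExp.eval]
  split_ifs with h
  · simp [h]
  · have : 1 - (e.eval σ - f.eval σ + (f.eval σ - e.eval σ)) = 0 := by omega
    rw [this, Nat.cast_zero]

/-- A natural number constant. -/
abbrev natExp (k : ℕ) : RExp := .ofNat (.const k)

/-- The entry of a vector. -/
abbrev vecExp (A r : ℕ) : RExp := .mem A (.reg r) (.const 0)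

/-- The entry of a matrix. -/
abbrev matExp (A r s : ℕ) : RExp := .mem A (.reg r) (.reg s)

abbrev gammaExp : RExp := .mem 0 (.const 0) (.const 0)

/-- Array `3`: the odds. -/
def oddsCmd : Cmd := .loop 1 (.reg 0) (.setMem 3 (.reg 1) (.const 0) (.exp (vecExp 2 1)))

/-- Array `5`: the mean position vector. -/
def meanCmd : Cmd :=
  .loop 1 (.reg 0) (sumCmd 5 (.reg 1) (.const 0) (natExp 0) 2
    (.div (.div (.sub (vecExp 3 2) (vecExp 3 1)) (.add (vecExp 3 1) (vecExp 3 2))) (natExp 2)))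

/-- Array `6`: the edge weights. -/
def weightCmd : Cmd :=
  .loop 1 (.reg 0) <| .loop 2 (.reg 0) <| sumCmd 6 (.reg 1) (.reg 2)
    (.add (.mul gammaExp (.div (.add (.ofNat (.reg 0)) (natExp 1)) (natExp 12)))
      (.mul (.sub (natExp 1) gammaExp) (.div (.mul (vecExp 3 1) (vecExp 3 2))
        (.mul (.add (vecExp 3 1) (vecExp 3 2)) (.add (vecExp 3 1) (vecExp 3 2)))))) 3
    (.mul (.sub (natExp 1) gammaExp) <| .mul (.sub (natExp 1) (eqExp (.reg 3) (.reg 1))) <|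
      .mul (.sub (natExp 1) (eqExp (.reg 3) (.reg 2))) <| .mul (natExp 2) <|
      .div (.mul (.mul (vecExp 3 1) (vecExp 3 2)) (.mul (vecExp 3 3) (vecExp 3 3)))
        (.mul (.mul (.mul (.add (.add (vecExp 3 1) (vecExp 3 2)) (vecExp 3 3))
          (.add (vecExp 3 1) (vecExp 3 2))) (.add (vecExp 3 2) (vecExp 3 3)))
          (.add (vecExp 3 1) (vecExp 3 3))))

/-- Array `7`: the weighted degrees. -/
def degreeCmd : Cmd :=
  .loop 1 (.reg 0) (sumCmd 7 (.reg 1) (.const 0) (natExp 0) 2 (matExp 6 1 2))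

/-- Array `8`: the Gram matrix. -/
def gramCmd (θ : ℕ) : Cmd :=
  .loop 1 (.reg 0) <| .loop 2 (.reg 0) <| .setMem 8 (.reg 1) (.reg 2) <|
    .add (.add (.sub (.mul (eqExp (.reg 1) (.reg 2)) (vecExp 7 1)) (matExp 6 1 2))
      (.mul (.mul (.sub (natExp 1) gammaExp)
        (.sub (natExp 1) (.mul (natExp θ) (.sub (natExp 1) gammaExp))))
        (.mul (vecExp 5 1) (vecExp 5 2)))) (natExp 1)

/-- One bordering step: array `10` is the new column, the array `11` its norm, and the array `9` the
inverse of the block. -/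
def borderCmd : Cmd :=
  .seq (.loop 1 (.reg 0) (sumCmd 10 (.reg 1) (.const 0) (eqExp (.reg 1) (.reg 3)) 2
    (.sub (natExp 0) (.mul (matExp 9 1 2) (matExp 8 2 3))))) <|
  .seq (sumCmd 11 (.const 0) (.const 0) (natExp 0) 1 (.mul (vecExp 10 1) (matExp 8 1 3)))
  (.loop 1 (.reg 0) <| .loop 2 (.reg 0) <| .setMem 9 (.reg 1) (.reg 2)
    (.add (matExp 9 1 2) (.div (.mul (vecExp 10 1) (vecExp 10 2)) (.mem 11 (.const 0) (.const 0)))))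

/-- Array `9`: the inverse of the Gram matrix. -/
def inverseCmd : Cmd :=
  .seq (.loop 1 (.reg 0) <| .loop 2 (.reg 0) <| .setMem 9 (.reg 1) (.reg 2) (natExp 0))
  (.loop 3 (.reg 0) borderCmd)

/-- Array `12`: the estimate. -/
def estimateCmd (θ : ℕ) : Cmd :=
  .loop 1 (.reg 0) (sumCmd 12 (.reg 1) (.const 0) (natExp 0) 2 <| .mul (matExp 9 1 2) <|
    .sub (.sub (vecExp 1 2) (.div (.add (.ofNat (.reg 0)) (natExp 1)) (natExp 2)))
      (.mul (.mul (natExp θ) (.sub (natExp 1) gammaExp)) (vecExp 5 2)))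

/-- Array `2`: the weights. -/
def addCmd : Cmd :=
  .loop 1 (.reg 0) (.setMem 2 (.reg 1) (.const 0) (.add (vecExp 2 1)
    (.mul (.mem 0 (.const 0) (.const 1)) (.mul (.mem 0 (.const 0) (.const 2)) (vecExp 12 1)))))

/-- The update of the weights. -/
def updateCmd (θ : ℕ) : Cmd :=
  .seq oddsCmd <| .seq meanCmd <| .seq weightCmd <| .seq degreeCmd <| .seq (gramCmd θ) <|
    .seq inverseCmd <| .seq (estimateCmd θ) addCmd

section Update

variable {n : ℕ} {σ : Store} (hσ : σ.reg 0 = n)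

include hσ

theorem ensures_oddsCmd {w : Fin n → ℝ} (hw : ∀ v : Fin n, σ.mem 2 v 0 = w v) :
    Ensures oddsCmd σ fun τ => ∀ v : Fin n, τ.mem 3 v 0 = odds w v := by
  refine ensures_fillVec hσ fun k ρ hm hr hreg _ => ?_
  have h2 := hm 2 (by simp [Cmd.memWrites])
  have := ensures_setMem_cell 3 (.reg 1) (.const 0) (.exp (vecExp 2 1)) ρ
  simpa only [NExp.eval, RExp.eval, hr, h2, hw] using this

theorem ensures_meanCmd {x : Fin n → ℝ} (hx : ∀ v : Fin n, σ.mem 3 v 0 = x v) :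
    Ensures meanCmd σ fun τ => ∀ v : Fin n, τ.mem 5 v 0 = meanVec x v := by
  refine ensures_fillVec hσ fun k ρ hm hr hreg _ => ?_
  have h3 := hm 3 (by simp [Cmd.memWrites, sumCmd])
  have h0 : ρ.reg 0 = n := (hreg 0 (by simp) (by simp [Cmd.regWrites, sumCmd])).trans hσ
  have := ensures_sumCmd (A := 5) (i := .reg 1) (j := .const 0) (b := natExp 0) (r := 2)
    (e := .div (.div (.sub (vecExp 3 2) (vecExp 3 1)) (.add (vecExp 3 1) (vecExp 3 2))) (natExp 2))
    (σ := ρ) (I := k) (J := 0) (f := fun v => (x v - x k) / (x k + x v) / 2) h0 hr rfl ?_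
  · convert this using 2
    simp [meanVec, RExp.eval, NExp.eval, div_eq_inv_mul, Finset.mul_sum]
  · intro l ρ' hm' hr' hreg'
    have h1 : ρ'.reg 1 = k := (hreg' 1 (by simp)).trans hr
    have h3' := hm' 3 (by simp)
    simp [RExp.eval, NExp.eval, h1, hr', h3', h3, hx]

theorem ensures_weightCmd {γ : ℝ} (hγ : σ.mem 0 0 0 = γ) {x : Fin n → ℝ}
    (hx : ∀ v : Fin n, σ.mem 3 v 0 = x v) :
    Ensures weightCmd σ fun τ => ∀ u v : Fin n, τ.mem 6 u v = mixWeight γ x u v := by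
  refine ensures_fillMat hσ (by simp) (by simp) (by simp [Cmd.regWrites, sumCmd])
    (by simp [Cmd.regWrites, sumCmd]) (by simp) fun u v ρ hm hr₁ hr₂ hreg _ => ?_
  have h3 := hm 3 (by simp [Cmd.memWrites, sumCmd])
  have hg := hm 0 (by simp [Cmd.memWrites, sumCmd])
  have h0 : ρ.reg 0 = n := (hreg 0 (by simp) (by simp) (by simp [Cmd.regWrites, sumCmd])).trans hσ
  have := ensures_sumCmd (A := 6) (i := .reg 1) (j := .reg 2)
    (b := .add (.mul gammaExp (.div (.add (.ofNat (.reg 0)) (natExp 1)) (natExp 12)))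
      (.mul (.sub (natExp 1) gammaExp) (.div (.mul (vecExp 3 1) (vecExp 3 2))
        (.mul (.add (vecExp 3 1) (vecExp 3 2)) (.add (vecExp 3 1) (vecExp 3 2)))))) (r := 3)
    (e := .mul (.sub (natExp 1) gammaExp) <| .mul (.sub (natExp 1) (eqExp (.reg 3) (.reg 1))) <|
      .mul (.sub (natExp 1) (eqExp (.reg 3) (.reg 2))) <| .mul (natExp 2) <|
      .div (.mul (.mul (vecExp 3 1) (vecExp 3 2)) (.mul (vecExp 3 3) (vecExp 3 3)))
        (.mul (.mul (.mul (.add (.add (vecExp 3 1) (vecExp 3 2)) (vecExp 3 3))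
          (.add (vecExp 3 1) (vecExp 3 2))) (.add (vecExp 3 2) (vecExp 3 3)))
          (.add (vecExp 3 1) (vecExp 3 3))))
    (σ := ρ) (I := u) (J := v) (f := fun c => (1 - γ) * (if c = u ∨ c = v then 0 else
      2 * (x u * x v * x c ^ 2 /
        ((x u + x v + x c) * (x u + x v) * (x v + x c) * (x u + x c))))) h0 hr₁ hr₂ ?_
  · convert this using 2
    simp only [mixWeight, edgeWeight, RExp.eval, NExp.eval, h0, hr₁, hr₂, hg, hγ, h3, hx,
      ← Finset.mul_sum]
    push_cast
    ring
  · intro c ρ' hm' hr' hreg'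
    have h1 : ρ'.reg 1 = u := (hreg' 1 (by simp)).trans hr₁
    have h2 : ρ'.reg 2 = v := (hreg' 2 (by simp)).trans hr₂
    have h3' := hm' 3 (by simp)
    have hg' := hm' 0 (by simp)
    refine ⟨h1, h2, ?_⟩
    simp only [RExp.eval, eqExp_eval, NExp.eval, h1, h2, hr', h3', h3, hx, hg', hg, hγ,
      Fin.val_inj]
    by_cases e1 : c = u
    · simp [e1]
    · by_cases e2 : c = v
      · simp [e2]
      · simp only [e1, e2, or_self, if_false]
        push_cast
        ring

theorem ensures_degreeCmd {k : Fin n → Fin n → ℝ} (hk : ∀ u v : Fin n, σ.mem 6 u v = k u v) :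
    Ensures degreeCmd σ fun τ => ∀ v : Fin n, τ.mem 7 v 0 = ∑ c, k v c := by
  refine ensures_fillVec hσ fun u ρ hm hr hreg _ => ?_
  have h6 := hm 6 (by simp [Cmd.memWrites, sumCmd])
  have h0 : ρ.reg 0 = n := (hreg 0 (by simp) (by simp [Cmd.regWrites, sumCmd])).trans hσ
  have := ensures_sumCmd (A := 7) (i := .reg 1) (j := .const 0) (b := natExp 0) (r := 2)
    (e := matExp 6 1 2) (σ := ρ) (I := u) (J := 0) (f := fun v => k u v) h0 hr rfl ?_
  · simpa [RExp.eval, NExp.eval] using this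
  · intro l ρ' hm' hr' hreg'
    have h1 : ρ'.reg 1 = u := (hreg' 1 (by simp)).trans hr
    have h6' := hm' 6 (by simp)
    simp [RExp.eval, NExp.eval, h1, hr', h6', h6, hk]

theorem ensures_gramCmd (θ : ℕ) {γ : ℝ} (hγ : σ.mem 0 0 0 = γ) {x : Fin n → ℝ}
    (hmean : ∀ v : Fin n, σ.mem 5 v 0 = meanVec x v)
    (hweight : ∀ u v : Fin n, σ.mem 6 u v = mixWeight γ x u v)
    (hdeg : ∀ v : Fin n, σ.mem 7 v 0 = ∑ c, mixWeight γ x v c) :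
    Ensures (gramCmd θ) σ fun τ => ∀ u v : Fin n, τ.mem 8 u v = gram θ γ x u v := by
  refine ensures_fillMat hσ (by simp) (by simp) (by simp [Cmd.regWrites])
    (by simp [Cmd.regWrites]) (by simp) fun u v ρ hm hr₁ hr₂ hreg _ => ?_
  have := ensures_setMem_cell 8 (.reg 1) (.reg 2)
    (.add (.add (.sub (.mul (eqExp (.reg 1) (.reg 2)) (vecExp 7 1)) (matExp 6 1 2))
      (.mul (.mul (.sub (natExp 1) gammaExp)
        (.sub (natExp 1) (.mul (natExp θ) (.sub (natExp 1) gammaExp))))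
        (.mul (vecExp 5 1) (vecExp 5 2)))) (natExp 1)) ρ
  have h0 := hm 0 (by simp [Cmd.memWrites])
  have h5 := hm 5 (by simp [Cmd.memWrites])
  have h6 := hm 6 (by simp [Cmd.memWrites])
  have h7 := hm 7 (by simp [Cmd.memWrites])
  simp only [NExp.eval, RExp.eval, eqExp_eval, hr₁, hr₂, h0, h5, h6, h7, hγ, hmean, hweight, hdeg,
    Fin.val_inj] at this
  convert this using 2
  simp [gram]

theorem ensures_borderCmd {G H : Matrix (Fin n) (Fin n) ℝ} {k : Fin n}
    (hk : σ.reg 3 = k) (hG : ∀ i j : Fin n, σ.mem 8 i j = G i j)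
    (hH : ∀ i j : Fin n, σ.mem 9 i j = H i j) (hGt : Gᵀ = G)
    (hpos : ∀ z, z ≠ 0 → 0 < z ⬝ᵥ G *ᵥ z) (h : IsBlockInverse G H k) :
    Ensures borderCmd σ fun τ => ∃ H', IsBlockInverse G H' (k + 1) ∧
      ∀ i j : Fin n, τ.mem 9 i j = H' i j := by
  set v : Fin n → ℝ := fun i => (1 : Matrix (Fin n) (Fin n) ℝ) i k - (H * G) i k with hv
  set d : ℝ := ∑ i, v i * G i k with hd
  refine ensures_seq (((ensures_fillVec (A := 10) (f := v) hσ fun i ρ hm hr hreg _ => ?_).and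
    ((ensures_mem_eq _ σ).and (ensures_reg_eq _ σ))).mono ?_)
  · have h9 := hm 9 (by simp [Cmd.memWrites, sumCmd])
    have h8 := hm 8 (by simp [Cmd.memWrites, sumCmd])
    have h0 : ρ.reg 0 = n := (hreg 0 (by simp) (by simp [Cmd.regWrites, sumCmd])).trans hσ
    have h3 : ρ.reg 3 = k := (hreg 3 (by simp) (by simp [Cmd.regWrites, sumCmd])).trans hk
    have := ensures_sumCmd (A := 10) (i := .reg 1) (j := .const 0) (b := eqExp (.reg 1) (.reg 3))
      (r := 2) (e := .sub (natExp 0) (.mul (matExp 9 1 2) (matExp 8 2 3)))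
      (σ := ρ) (I := i) (J := 0) (f := fun j => -(H i j * G j k)) h0 hr rfl ?_
    · convert this using 2
      simp [hv, eqExp_eval, NExp.eval, hr, h3, Fin.val_inj, Matrix.mul_apply, Matrix.one_apply,
        Finset.sum_neg_distrib, sub_eq_add_neg]
    · intro l ρ' hm' hr' hreg'
      have h1 : ρ'.reg 1 = i := (hreg' 1 (by simp)).trans hr
      have h3' : ρ'.reg 3 = k := (hreg' 3 (by simp)).trans h3
      have h9' := hm' 9 (by simp)
      have h8' := hm' 8 (by simp)
      simp [RExp.eval, NExp.eval, h1, hr', h3', h9', h9, h8', h8, hH, hG]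
  rintro τ₁ ⟨hv₁, hm₁, hr₁⟩
  have h8₁ := hm₁ 8 (by simp [Cmd.memWrites, sumCmd])
  have h9₁ := hm₁ 9 (by simp [Cmd.memWrites, sumCmd])
  have h0₁ : τ₁.reg 0 = n := (hr₁ 0 (by simp [Cmd.regWrites, sumCmd])).trans hσ
  have h3₁ : τ₁.reg 3 = k := (hr₁ 3 (by simp [Cmd.regWrites, sumCmd])).trans hk
  have hsum := ensures_sumCmd (A := 11) (i := .const 0) (j := .const 0) (b := natExp 0)
      (r := 1) (e := .mul (vecExp 10 1) (matExp 8 1 3))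
      (σ := τ₁) (I := 0) (J := 0) (f := fun i => v i * G i k) h0₁ rfl rfl (by
    intro l ρ' hm' hr' hreg'
    have h3' : ρ'.reg 3 = k := (hreg' 3 (by simp)).trans h3₁
    have h10' := hm' 10 (by simp)
    have h8' := hm' 8 (by simp)
    simp [RExp.eval, NExp.eval, hr', h3', h10', h8', h8₁, hv₁, hG])
  refine ensures_seq ((hsum.and ((ensures_mem_eq _ τ₁).and (ensures_reg_eq _ τ₁))).mono ?_)
  rintro τ₂ ⟨hd₂, hm₂, hr₂⟩
  have hd₂' : τ₂.mem 11 0 0 = d := by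
    rw [hd₂.1, hd]
    simp [RExp.eval, NExp.eval]
  have h10₂ := hm₂ 10 (by simp [Cmd.memWrites, sumCmd])
  have h9₂ := hm₂ 9 (by simp [Cmd.memWrites, sumCmd])
  have h0₂ : τ₂.reg 0 = n := (hr₂ 0 (by simp [Cmd.regWrites, sumCmd])).trans h0₁
  refine (ensures_fillMat (A := 9) (f := fun i j => H i j + v i * v j / d) h0₂ (by simp) (by simp)
    (by simp [Cmd.regWrites]) (by simp [Cmd.regWrites]) (by simp)
    fun i j ρ hm hri hrj hreg hown => ?_).mono fun τ hτ =>
      ⟨Matrix.of fun i j => H i j + v i * v j / d,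
        h.border hGt hpos (fun _ => rfl) hd fun _ _ => rfl, hτ⟩
  have := ensures_setMem_cell 9 (.reg 1) (.reg 2)
    (.add (matExp 9 1 2) (.div (.mul (vecExp 10 1) (vecExp 10 2))
      (.mem 11 (.const 0) (.const 0)))) ρ
  have h10 := hm 10 (by simp [Cmd.memWrites])
  have h11 := hm 11 (by simp [Cmd.memWrites])
  simpa only [NExp.eval, RExp.eval, hri, hrj, hown, h10, h11, hd₂', h10₂, h9₂, h9₁, hv₁,
    hH] using this

/-- Zero padding of the block inverses lets every bordering step loop over all indices, in `O(n²)`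
operations. -/
theorem ensures_inverseCmd {G : Matrix (Fin n) (Fin n) ℝ}
    (hG : ∀ i j : Fin n, σ.mem 8 i j = G i j) (hGt : Gᵀ = G)
    (hpos : ∀ z, z ≠ 0 → 0 < z ⬝ᵥ G *ᵥ z) :
    Ensures inverseCmd σ fun τ => ∀ i j : Fin n, τ.mem 9 i j = G⁻¹ i j := by
  refine ensures_seq (((ensures_fillMat (A := 9) (f := fun _ _ => 0) hσ (by simp) (by simp)
    (by simp [Cmd.regWrites]) (by simp [Cmd.regWrites]) (by simp)
    fun i j ρ hm hri hrj hreg _ => ?_).and ((ensures_mem_eq _ σ).and (ensures_reg_eq _ σ))).mono ?_)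
  · simpa [NExp.eval, RExp.eval, hri, hrj] using
      ensures_setMem_cell 9 (.reg 1) (.reg 2) (natExp 0) ρ
  rintro τ ⟨hz, hm, hr⟩
  have h8 := hm 8 (by simp [Cmd.memWrites])
  have h0 : τ.reg 0 = n := (hr 0 (by simp [Cmd.regWrites])).trans hσ
  refine (ensures_loop h0 (fun k μ => ∃ H, IsBlockInverse G H k ∧ ∀ i j : Fin n, μ 9 i j = H i j)
    ⟨0, isBlockInverse_zero G, hz⟩ ?_).mono fun τ' ⟨H, h1, h2⟩ i j => by rw [h2, h1.eq_inv]
  rintro k hk ρ ⟨H, h1, h2⟩ hm' hrk hreg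
  refine ensures_borderCmd (k := ⟨k, hk⟩) ?_ hrk (fun i j => ?_) h2 hGt hpos h1
  · rw [hreg 0 (by simp) (by simp [borderCmd, sumCmd, Cmd.regWrites]), h0]
  · rw [hm' 8 (by simp [borderCmd, sumCmd, Cmd.memWrites]), h8, hG]

theorem ensures_estimateCmd (θ : ℕ) {γ : ℝ} (hγ : σ.mem 0 0 0 = γ) {x : Fin n → ℝ}
    {π : Equiv.Perm (Fin n)} (hπ : ∀ v : Fin n, σ.mem 1 v 0 = ((π v : ℕ) : ℝ) + 1)
    (hmean : ∀ v : Fin n, σ.mem 5 v 0 = meanVec x v)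
    (hinv : ∀ u v : Fin n, σ.mem 9 u v = (gram θ γ x)⁻¹ u v) :
    Ensures (estimateCmd θ) σ fun τ => ∀ v : Fin n, τ.mem 12 v 0 = estimate θ γ x π v := by
  refine ensures_fillVec hσ fun u ρ hm hr hreg _ => ?_
  have h0 : ρ.reg 0 = n := (hreg 0 (by simp) (by simp [Cmd.regWrites, sumCmd])).trans hσ
  have := ensures_sumCmd (A := 12) (i := .reg 1) (j := .const 0) (b := natExp 0) (r := 2)
    (e := .mul (matExp 9 1 2) <|
      .sub (.sub (vecExp 1 2) (.div (.add (.ofNat (.reg 0)) (natExp 1)) (natExp 2)))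
        (.mul (.mul (natExp θ) (.sub (natExp 1) gammaExp)) (vecExp 5 2)))
    (σ := ρ) (I := u) (J := 0) (f := fun v => (gram θ γ x)⁻¹ u v * centered θ γ x π v) h0 hr rfl ?_
  · simpa [RExp.eval, NExp.eval, estimate, Matrix.mulVec, dotProduct] using this
  · intro l ρ' hm' hr' hreg'
    have h1 : ρ'.reg 1 = u := (hreg' 1 (by simp)).trans hr
    have h0' : ρ'.reg 0 = n := (hreg' 0 (by simp)).trans h0
    have e : ∀ B, B ≠ 12 → ρ'.mem B = σ.mem B := fun B hB =>
      (hm' B hB).trans (hm B (by simpa [Cmd.memWrites, sumCmd] using hB))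
    simp [RExp.eval, NExp.eval, h1, hr', h0', e 0, e 1, e 5, e 9, hγ, hπ, hmean, hinv, centered,
      symVec]

theorem ensures_addCmd {η ℓ : ℝ} (hη : σ.mem 0 0 1 = η) (hℓ : σ.mem 0 0 2 = ℓ) {w y : Fin n → ℝ}
    (hw : ∀ v : Fin n, σ.mem 2 v 0 = w v) (hy : ∀ v : Fin n, σ.mem 12 v 0 = y v) :
    Ensures addCmd σ fun τ => ∀ v : Fin n, τ.mem 2 v 0 = (w + η • (ℓ • y)) v := by
  refine ensures_fillVec hσ fun k ρ hm hr hreg hown => ?_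
  have h0 := hm 0 (by simp [Cmd.memWrites])
  have h12 := hm 12 (by simp [Cmd.memWrites])
  have := ensures_setMem_cell 2 (.reg 1) (.const 0) (.add (vecExp 2 1)
    (.mul (.mem 0 (.const 0) (.const 1)) (.mul (.mem 0 (.const 0) (.const 2)) (vecExp 12 1)))) ρ
  simpa only [NExp.eval, RExp.eval, hr, h0, h12, hown, hw, hy, hη, hℓ, Pi.add_apply,
    Pi.smul_apply, smul_eq_mul] using this

theorem ensures_updateCmd {θ : ℕ} (hθ : (θ : ℝ) = 0 ∨ (θ : ℝ) = 1) {γ η ℓ : ℝ} (h0 : 0 < γ)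
    (h1 : γ ≤ 1) (hγ : σ.mem 0 0 0 = γ) (hη : σ.mem 0 0 1 = η) (hℓ : σ.mem 0 0 2 = ℓ)
    {w : Fin n → ℝ} (hw : ∀ v : Fin n, σ.mem 2 v 0 = w v) {π : Equiv.Perm (Fin n)}
    (hπ : ∀ v : Fin n, σ.mem 1 v 0 = ((π v : ℕ) : ℝ) + 1) :
    Ensures (updateCmd θ) σ fun τ =>
      ∀ v : Fin n, τ.mem 2 v 0 = (w + η • (ℓ • estimate θ γ (odds w) π)) v := by
  refine ensures_seq (((ensures_oddsCmd hσ hw).and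
    ((ensures_mem_eq _ σ).and (ensures_reg_eq _ σ))).mono ?_)
  rintro σ₁ ⟨hx, m₁, r₁⟩
  have R₁ : σ₁.reg 0 = n := (r₁ 0 (by simp [oddsCmd, Cmd.regWrites])).trans hσ
  refine ensures_seq (((ensures_meanCmd R₁ hx).and
    ((ensures_mem_eq _ σ₁).and (ensures_reg_eq _ σ₁))).mono ?_)
  rintro σ₂ ⟨hmean, m₂, r₂⟩
  have R₂ : σ₂.reg 0 = n := (r₂ 0 (by simp [meanCmd, sumCmd, Cmd.regWrites])).trans R₁
  have M₂ : ∀ A, A ≠ 3 → A ≠ 5 → σ₂.mem A = σ.mem A := fun A h3 h5 =>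
    (m₂ A (by simpa [meanCmd, sumCmd, Cmd.memWrites] using h5)).trans
      (m₁ A (by simpa [oddsCmd, Cmd.memWrites] using h3))
  have hx₂ : ∀ v : Fin n, σ₂.mem 3 v 0 = odds w v := by
    rw [m₂ 3 (by simp [meanCmd, sumCmd, Cmd.memWrites])]
    exact hx
  have hγ₂ : σ₂.mem 0 0 0 = γ := by rw [M₂ 0 (by simp) (by simp), hγ]
  refine ensures_seq (((ensures_weightCmd R₂ hγ₂ hx₂).and
    ((ensures_mem_eq _ σ₂).and (ensures_reg_eq _ σ₂))).mono ?_)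
  rintro σ₃ ⟨hweight, m₃, r₃⟩
  have R₃ : σ₃.reg 0 = n := (r₃ 0 (by simp [weightCmd, sumCmd, Cmd.regWrites])).trans R₂
  refine ensures_seq (((ensures_degreeCmd R₃ hweight).and
    ((ensures_mem_eq _ σ₃).and (ensures_reg_eq _ σ₃))).mono ?_)
  rintro σ₄ ⟨hdeg, m₄, r₄⟩
  have R₄ : σ₄.reg 0 = n := (r₄ 0 (by simp [degreeCmd, sumCmd, Cmd.regWrites])).trans R₃
  have M₄ : ∀ A, A ≠ 6 → A ≠ 7 → σ₄.mem A = σ₂.mem A := fun A h6 h7 =>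
    (m₄ A (by simpa [degreeCmd, sumCmd, Cmd.memWrites] using h7)).trans
      (m₃ A (by simpa [weightCmd, sumCmd, Cmd.memWrites] using h6))
  have hγ₄ : σ₄.mem 0 0 0 = γ := by rw [M₄ 0 (by simp) (by simp), hγ₂]
  have hmean₄ : ∀ v : Fin n, σ₄.mem 5 v 0 = meanVec (odds w) v := by
    rw [M₄ 5 (by simp) (by simp)]
    exact hmean
  have hweight₄ : ∀ u v : Fin n, σ₄.mem 6 u v = mixWeight γ (odds w) u v := by
    rw [m₄ 6 (by simp [degreeCmd, sumCmd, Cmd.memWrites])]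
    exact hweight
  refine ensures_seq (((ensures_gramCmd R₄ θ hγ₄ hmean₄ hweight₄ hdeg).and
    ((ensures_mem_eq _ σ₄).and (ensures_reg_eq _ σ₄))).mono ?_)
  rintro σ₅ ⟨hgram, m₅, r₅⟩
  have R₅ : σ₅.reg 0 = n := (r₅ 0 (by simp [gramCmd, Cmd.regWrites])).trans R₄
  refine ensures_seq (((ensures_inverseCmd R₅ hgram (gram_transpose _ _ _)
    fun z hz => gram_pos hθ h0 h1 w hz).and
    ((ensures_mem_eq _ σ₅).and (ensures_reg_eq _ σ₅))).mono ?_)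
  rintro σ₆ ⟨hinv, m₆, r₆⟩
  have R₆ : σ₆.reg 0 = n :=
    (r₆ 0 (by simp [inverseCmd, borderCmd, sumCmd, Cmd.regWrites])).trans R₅
  have M₆ : ∀ A, A ≠ 8 → A ≠ 9 → A ≠ 10 → A ≠ 11 → σ₆.mem A = σ₄.mem A := fun A h8 h9 h10 h11 =>
    (m₆ A (by simp [inverseCmd, borderCmd, sumCmd, Cmd.memWrites, h9, h10, h11])).trans
      (m₅ A (by simpa [gramCmd, Cmd.memWrites] using h8))
  have hγ₆ : σ₆.mem 0 0 0 = γ := by rw [M₆ 0 (by simp) (by simp) (by simp) (by simp), hγ₄]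
  have hmean₆ : ∀ v : Fin n, σ₆.mem 5 v 0 = meanVec (odds w) v := by
    rw [M₆ 5 (by simp) (by simp) (by simp) (by simp)]
    exact hmean₄
  have hπ₆ : ∀ v : Fin n, σ₆.mem 1 v 0 = ((π v : ℕ) : ℝ) + 1 := by
    rw [M₆ 1 (by simp) (by simp) (by simp) (by simp), M₄ 1 (by simp) (by simp),
      M₂ 1 (by simp) (by simp)]
    exact hπ
  refine ensures_seq (((ensures_estimateCmd R₆ θ hγ₆ hπ₆ hmean₆ hinv).and
    ((ensures_mem_eq _ σ₆).and (ensures_reg_eq _ σ₆))).mono ?_)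
  rintro σ₇ ⟨hest, m₇, r₇⟩
  have R₇ : σ₇.reg 0 = n := (r₇ 0 (by simp [estimateCmd, sumCmd, Cmd.regWrites])).trans R₆
  have M₇ : ∀ A, A = 0 ∨ A = 2 → σ₇.mem A = σ.mem A := by
    intro A hA
    rw [m₇ A (by rcases hA with rfl | rfl <;> simp [estimateCmd, sumCmd, Cmd.memWrites]),
      M₆ A (by omega) (by omega) (by omega) (by omega), M₄ A (by omega) (by omega),
      M₂ A (by omega) (by omega)]
  refine ensures_addCmd R₇ ?_ ?_ ?_ hest
  · rw [M₇ 0 (Or.inl rfl), hη]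
  · rw [M₇ 0 (Or.inl rfl), hℓ]
  · rw [M₇ 2 (Or.inr rfl)]
    exact hw

end Update

/-! ### The program -/

/-- The program for `banditRank` (`θ = 0`) and for the standard game (`θ = 1`). -/
def rankProgram (θ : ℕ) : Program := ⟨drawCmd, updateCmd θ⟩

/-- The store holds the parameters and the weights. -/
structure Represents (n : ℕ) (γ η : ℝ) (w : Fin n → ℝ) (σ : Store) : Prop where
  size : σ.reg 0 = n
  gamma : σ.mem 0 0 0 = γ
  eta : σ.mem 0 0 1 = η
  weights : ∀ v : Fin n, σ.mem 2 v 0 = w v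

theorem output_eq {n : ℕ} {σ : Store} {π : Equiv.Perm (Fin n)}
    (h : ∀ v : Fin n, σ.mem 1 v 0 = ((π v : ℕ) : ℝ) + 1) : σ.output n = π := by
  have hex : ∃ π : Equiv.Perm (Fin n), ∀ v : Fin n, σ.mem 1 v 0 = ((π v : ℕ) : ℝ) + 1 := ⟨π, h⟩
  rw [Store.output, dif_pos hex]
  ext v
  have := (hex.choose_spec v).symm.trans (h v)
  exact_mod_cast add_right_cancel this

theorem drawCmd_bounded : drawCmd.Bounded := by
  simp [drawCmd, roundCmd, reservoirCmd, Cmd.Bounded]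

theorem updateCmd_bounded (θ : ℕ) : (updateCmd θ).Bounded := by
  simp [updateCmd, oddsCmd, meanCmd, weightCmd, degreeCmd, gramCmd, inverseCmd, borderCmd,
    estimateCmd, addCmd, sumCmd, Cmd.Bounded]

theorem drawCmd_depth : drawCmd.depth ≤ 3 := by
  simp [drawCmd, roundCmd, reservoirCmd, Cmd.depth]

theorem updateCmd_depth (θ : ℕ) : (updateCmd θ).depth ≤ 3 := by
  simp [updateCmd, oddsCmd, meanCmd, weightCmd, degreeCmd, gramCmd, inverseCmd, borderCmd,
    estimateCmd, addCmd, sumCmd, Cmd.depth]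

/-! ### Running time of the program -/

theorem rankProgram_run_reg_zero (θ n : ℕ) (γ η : ℝ) (x : Equiv.Perm (Fin n) → Fin n → ℝ)
    (s : ℕ → Fin n → ℝ) (T : ℕ) :
    ∀ mh ∈ (((rankProgram θ).player n γ η).run x s T).support, Store.reg mh.1 0 = n := by
  induction T with
  | zero =>
    intro mh hmh
    rw [Player.run, PMF.mem_support_pure_iff] at hmh
    subst hmh
    simp [Program.player, Store.setMem]
  | succ T ih =>
    intro mh hmh
    rw [Player.run, PMF.mem_support_bind_iff] at hmh
    obtain ⟨mh', hmh', hmh⟩ := hmh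
    rw [PMF.mem_support_bind_iff] at hmh
    obtain ⟨πm, hπm, hmh⟩ := hmh
    obtain ⟨τ, hτ, rfl⟩ := (PMF.mem_support_map_iff _ _ _).1 hπm
    obtain ⟨τ', hτ', rfl⟩ := (PMF.mem_support_map_iff _ _ _).1 hmh
    have e1 := drawCmd_bounded.reg_zero_eq _ τ hτ
    have e2 := (updateCmd_bounded θ).reg_zero_eq _ τ' hτ'
    exact e2.trans (e1.trans (ih mh' hmh'))

theorem rankProgram_cubicTime (θ : ℕ) (x : (n : ℕ) → Equiv.Perm (Fin n) → Fin n → ℝ) :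
    (rankProgram θ).CubicTime x := by
  refine ⟨drawCmd.size + (updateCmd θ).size, fun n hn γ η _ _ _ s t mh hmh => ?_⟩
  rw [Player.run, PMF.mem_support_bind_iff] at hmh
  obtain ⟨mh', hmh', hmh⟩ := hmh
  rw [PMF.mem_support_bind_iff] at hmh
  obtain ⟨πm, hπm, hmh⟩ := hmh
  obtain ⟨τ, hτ, rfl⟩ := (PMF.mem_support_map_iff _ _ _).1 hπm
  obtain ⟨τ', hτ', rfl⟩ := (PMF.mem_support_map_iff _ _ _).1 hmh
  have h0 := rankProgram_run_reg_zero θ n γ η (x n) s t mh' hmh'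
  have h1 : τ.reg 0 = n := (drawCmd_bounded.reg_zero_eq _ τ hτ).trans h0
  have c1 : τ.clock ≤ 0 + drawCmd.size * n ^ drawCmd.depth :=
    drawCmd_bounded.clock_le hn (σ := { mh'.1 with clock := 0 }) h0 τ hτ
  have c2 : τ'.clock ≤ τ.clock + (updateCmd θ).size * n ^ (updateCmd θ).depth :=
    (updateCmd_bounded θ).clock_le hn (σ := τ.setMem 0 0 2 _) h1 τ' hτ'
  have p1 := Nat.mul_le_mul_left drawCmd.size (Nat.pow_le_pow_right hn drawCmd_depth)
  have p2 := Nat.mul_le_mul_left (updateCmd θ).size (Nat.pow_le_pow_right hn (updateCmd_depth θ))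
  change τ'.clock ≤ _
  rw [add_mul]
  omega

/-! ### Equality of the laws of program and player -/

theorem coupled_draw {n : ℕ} {γ η : ℝ} {w : Fin n → ℝ} {σ : Store} (h : Represents n γ η w σ) :
    Coupled (fun π τ => Represents n γ η w τ ∧ ∀ v : Fin n, τ.mem 1 v 0 = ((π v : ℕ) : ℝ) + 1)
      (mixture γ w) (drawCmd.exec { σ with clock := 0 }) := by
  refine (coupled_drawCmd (σ := { σ with clock := 0 }) h.size h.gamma h.weights).mono
    fun π τ _ hτ hπ => ⟨?_, hπ⟩
  have hm := ensures_mem_eq _ _ τ hτ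
  have hr := ensures_reg_eq _ _ τ hτ
  have m0 := hm 0 (by simp [drawCmd, roundCmd, reservoirCmd, Cmd.memWrites])
  have m2 := hm 2 (by simp [drawCmd, roundCmd, reservoirCmd, Cmd.memWrites])
  refine ⟨?_, ?_, ?_, ?_⟩
  · rw [hr 0 (by simp [drawCmd, roundCmd, reservoirCmd, Cmd.regWrites])]
    exact h.size
  · rw [m0]
    exact h.gamma
  · rw [m0]
    exact h.eta
  · rw [m2]
    exact h.weights

theorem ensures_update {n θ : ℕ} (hθ : (θ : ℝ) = 0 ∨ (θ : ℝ) = 1) {γ η : ℝ} (h0 : 0 < γ)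
    (h1 : γ ≤ 1) {w : Fin n → ℝ} {σ : Store} (h : Represents n γ η w σ)
    {π : Equiv.Perm (Fin n)} (hπ : ∀ v : Fin n, σ.mem 1 v 0 = ((π v : ℕ) : ℝ) + 1) (ℓ : ℝ) :
    Ensures (updateCmd θ) (σ.setMem 0 0 2 ℓ)
      (Represents n γ η (w + η • (ℓ • estimate θ γ (odds w) π))) := by
  set σ' := σ.setMem 0 0 2 ℓ with hσ'
  have hm : ∀ A, A ≠ 0 → σ'.mem A = σ.mem A := by
    intro A hA
    funext i j
    simp [hσ', Store.setMem, hA]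
  have hγ : σ'.mem 0 0 0 = γ := by
    rw [← h.gamma]
    simp [hσ', Store.setMem]
  have hη : σ'.mem 0 0 1 = η := by
    rw [← h.eta]
    simp [hσ', Store.setMem]
  have hℓ : σ'.mem 0 0 2 = ℓ := by simp [hσ', Store.setMem]
  have hw : ∀ v : Fin n, σ'.mem 2 v 0 = w v := by
    rw [hm 2 (by simp)]
    exact h.weights
  have hπ' : ∀ v : Fin n, σ'.mem 1 v 0 = ((π v : ℕ) : ℝ) + 1 := by
    rw [hm 1 (by simp)]
    exact hπ
  refine ((ensures_updateCmd (σ := σ') h.size hθ h0 h1 hγ hη hℓ hw hπ').and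
    ((ensures_mem_eq _ σ').and ((updateCmd_bounded θ).reg_zero_eq σ'))).mono ?_
  rintro τ ⟨hτw, hτm, hτr⟩
  have m0 : τ.mem 0 = σ'.mem 0 := hτm 0 (by
    simp [updateCmd, oddsCmd, meanCmd, weightCmd, degreeCmd, gramCmd, inverseCmd, borderCmd,
      estimateCmd, addCmd, sumCmd, Cmd.memWrites])
  exact ⟨hτr.trans h.size, by rw [m0, hγ], by rw [m0, hη], hτw⟩

/-- Only the draw is random. The update loops are matched with a deterministic step of the player,
for which a statement about all reachable stores is enough. -/
theorem coupled_run {n θ : ℕ} (hθ : (θ : ℝ) = 0 ∨ (θ : ℝ) = 1) {γ η : ℝ} (h0 : 0 < γ)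
    (h1 : γ ≤ 1) (x : Equiv.Perm (Fin n) → Fin n → ℝ) (s : ℕ → Fin n → ℝ) (T : ℕ) :
    Coupled (fun a b => Represents n γ η a.1 b.1 ∧ a.2 = b.2)
      ((estPlayer θ n γ η).run x s T) (((rankProgram θ).player n γ η).run x s T) := by
  induction T with
  | zero =>
    refine Coupled.pure ⟨⟨?_, ?_, ?_, fun v => ?_⟩, rfl⟩ <;>
      simp [Program.player, Store.setMem, estPlayer]
  | succ T ih =>
    rw [Player.run, Player.run]
    refine ih.bind ?_
    rintro ⟨w, h⟩ ⟨σ, h'⟩ ⟨hrep, rfl⟩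
    refine Coupled.bind (R := fun a b => a.1 = b.1 ∧ a.2 = w ∧ Represents n γ η w b.2 ∧
      ∀ v : Fin n, Store.mem b.2 1 v 0 = ((a.1 v : ℕ) : ℝ) + 1)
      (Coupled.map ((coupled_draw hrep).mono fun π τ _ _ hτ =>
        ⟨(output_eq hτ.2).symm, rfl, hτ.1, hτ.2⟩)) ?_
    rintro ⟨π, w'⟩ ⟨π', τ⟩ ⟨rfl, rfl, hτ, hπ⟩
    refine Coupled.map (Coupled.of_support fun τ' hτ' => ⟨?_, rfl⟩)
    exact ensures_update hθ h0 h1 hτ hπ _ τ' hτ'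

theorem rankProgram_plays {n θ : ℕ} (hθ : (θ : ℝ) = 0 ∨ (θ : ℝ) = 1) {γ η : ℝ} (h0 : 0 < γ)
    (h1 : γ ≤ 1) (x : Equiv.Perm (Fin n) → Fin n → ℝ) (s : ℕ → Fin n → ℝ) (T : ℕ) :
    ((rankProgram θ).player n γ η).plays x s T = (estPlayer θ n γ η).plays x s T :=
  (Coupled.map_eq _ _ ((coupled_run hθ h0 h1 x s T).mono fun _ _ _ _ h => h.2)).symm

theorem rankProgram_implementsBanditRank : (rankProgram 0).ImplementsBanditRank := by
  intro n _ γ η h0 h1 _ s T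
  rw [rankProgram_plays (Or.inl Nat.cast_zero) h0 h1, banditRank_eq_estPlayer n η h0 h1,
    Nat.cast_zero]

theorem rankProgram_regretBound : RegretBound (rankProgram 1).player fun _ => stdVec := by
  refine regretBound_stdVec_of_plays fun n _ γ η h0 h1 _ s T => ?_
  rw [rankProgram_plays (Or.inr Nat.cast_one) h0 h1, Nat.cast_one]

end

end PermBandit

theorem theorem1 :
    PermBandit.RegretBound PermBandit.banditRank (fun _ => PermBandit.symVec) ∧
    (∃ M : PermBandit.Program, M.ImplementsBanditRank ∧
      M.CubicTime (fun _ => PermBandit.symVec)) ∧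
    (∃ M : PermBandit.Program, M.CubicTime (fun _ => PermBandit.stdVec) ∧
      PermBandit.RegretBound M.player (fun _ => PermBandit.stdVec)) :=
  ⟨PermBandit.regretBound_banditRank,
    ⟨PermBandit.rankProgram 0, PermBandit.rankProgram_implementsBanditRank,
      PermBandit.rankProgram_cubicTime 0 _⟩,
    ⟨PermBandit.rankProgram 1, PermBandit.rankProgram_cubicTime 1 _,
      PermBandit.rankProgram_regretBound⟩⟩
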